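/- Let $\mathbf{k}$ be a field of characteristic $0$ and let $n\ge 1$. Let $z_1,\dots,z_n$ be the coordinates on $\mathbb{A}^n$, let $V=\mathbf{k}^n$ be the space spanned by them, let $z_1^*,\dots,z_n^*$ be the dual coordinates, and put $zz^*=\sum_\nu z_\nu z_\nu^*$. For $0\le p\le n$ and $0\le q\le n-1$ let $A_{[n]}^{p,q}$ be the space of differential forms $$\omega=\sum f^{i_1\dots i_p}_{j_1\dots j_q}(z,z^*)\,dz_{i_1}\wedge\cdots\wedge dz_{i_p}\wedge dz^*_{j_1}\wedge\cdots\wedge dz^*_{j_q},\qquad f^{i_1\dots i_p}_{j_1\dots j_q}\in \mathbf{k}[z,z^*][(zz^*)^{-1}],$$ which have total degree $0$ in the $z^*_\nu, dz^*_\nu$ (that is, each coefficient is homogeneous of degree $-q$ in the variables $z^*_1,\dots,z^*_n$) and are annihilated by contraction with the vector field $\sum_\nu z^*_\nu\,\partial/\partial z^*_\nu$. Multiplication of forms gives maps $A_{[n]}^{p,q}\otimes A_{[n]}^{p',q'}\to A_{[n]}^{p+p',q+q'}$. The group $GL_n=GL(V)$ acts on these spaces through its action on $V$ (on the $z_\nu$,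 $dz_\nu$) and on $V^*$ (on the $z^*_\nu$, $dz^*_\nu$), compatibly with products. Let $$\Omega=\frac{\sum_{\nu=1}^n(-1)^{\nu-1}z^*_\nu\,dz^*_1\wedge\cdots\wedge\widehat{dz^*_\nu}\wedge\cdots\wedge dz^*_n}{(zz^*)^n}\in A_{[n]}^{0,n-1}$$ be the Martinelli--Bochner form. There is exactly one $GL_n$-invariant linear functional $\operatorname{Res}\colon A_{[n]}^{n,n-1}\to\mathbf{k}$ with $\operatorname{Res}(\Omega\,dz_1\wedge\cdots\wedge dz_n)=1$ (the residue map). For all $0\le p\le n$ and $0\le q\le n-1$, the $GL_n$-module $E=A_{[n]}^{p,q}$ is a direct sum $E\simeq\bigoplus_\alpha C_\alpha\otimes\Sigma^\alpha(V)$ of irreducible representations with finite multiplicities (each isotypic component $C_\alpha\otimes\Sigma^\alpha(V)$ is finite-dimensional), so that its restricted dual $E^\bigstar=\bigoplus_\alpha C_\alpha^*\otimes\Sigma^\alpha(V)^*$ (the direct sum of the dual spaces of the isotypic components) is defined. The residue pairing $$A_{[n]}^{p,q}\otimes_{\mathbf{k}}A_{[n]}^{n-p,\,n-1-q}\to\mathbf{k},\qquad(\alpha,\beta)\mapsto\operatorname{Res}(\alpha\cdot\beta),$$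 is $GL_n$-invariant and gives an isomorphism $A_{[n]}^{n-p,\,n-1-q}\to(A_{[n]}^{p,q})^\bigstar$, which sends $\beta$ to the family of the restrictions of the functional $\operatorname{Res}(\,\cdot\,\beta)$ to the isotypic components of $A_{[n]}^{p,q}$. -/

import Mathlib

open scoped TensorProduct

noncomputable section

namespace Jouanolou

section Forms

variable (k : Type*) [Field k] (n : ℕ)

/-- The polynomial ring `k[z, z*] = k[z₁, …, zₙ, z₁*, …, zₙ*]`; the left copy of `Fin n` indexes the
`z_i`, the right copy indexes the `z_i*`. -/
abbrev Poly : Type _ := MvPolynomial (Fin n ⊕ Fin n) k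

/-- `zz* = ∑ z_ν z_ν*`. -/
def zzs : Poly k n := ∑ i : Fin n, MvPolynomial.X (Sum.inl i) * MvPolynomial.X (Sum.inr i)

/-- The localized algebra `k[z, z*][(zz*)⁻¹]` of regular functions on the complement `U` of the
hypersurface `zz* = 0` in the product of the affine space and its dual. -/
def Fun : Type _ := Localization.Away (zzs k n)

instance : CommRing (Fun k n) := inferInstanceAs (CommRing (Localization.Away (zzs k n)))

instance : Algebra (Poly k n) (Fun k n) :=
  inferInstanceAs (Algebra (Poly k n) (Localization.Away (zzs k n)))

instance : Algebra k (Fun k n) := inferInstanceAs (Algebra k (Localization.Away (zzs k n)))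

instance : IsScalarTower k (Poly k n) (Fun k n) :=
  inferInstanceAs (IsScalarTower k (Poly k n) (Localization.Away (zzs k n)))

instance : IsLocalization.Away (zzs k n) (Fun k n) :=
  inferInstanceAs (IsLocalization.Away (zzs k n) (Localization.Away (zzs k n)))

/-- The `k`-span of the symbols `dz_1, …, dz_n, dz_1*, …, dz_n*`. -/
abbrev Cov : Type _ := (Fin n → k) × (Fin n → k)

/-- The algebra of all regular differential forms on `U`: sums of `f(z, z*) dz_I ∧ dz*_J` with `f` in
`k[z, z*][(zz*)⁻¹]`. Its product is the product of differential forms. -/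
abbrev Forms : Type _ := Fun k n ⊗[k] ExteriorAlgebra k (Cov k n)

/-- The exterior generator `dz_i`. -/
def dz (i : Fin n) : ExteriorAlgebra k (Cov k n) := ExteriorAlgebra.ι k (Pi.single i 1, 0)

/-- The exterior generator `dz_i*`. -/
def dzs (i : Fin n) : ExteriorAlgebra k (Cov k n) := ExteriorAlgebra.ι k (0, Pi.single i 1)

/-- The function `z_i*` on `U`. -/
def zs (i : Fin n) : Fun k n := algebraMap (Poly k n) _ (MvPolynomial.X (Sum.inr i))

/-- The function `(zz*)⁻¹` on `U`. -/
def invzzs : Fun k n := IsLocalization.Away.invSelf (zzs k n)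

/-- The weights computing the degree in the `z*`-variables. -/
def wt : Fin n ⊕ Fin n → ℕ := Sum.elim (fun _ => 0) (fun _ => 1)

lemma zzs_homogeneous : MvPolynomial.IsWeightedHomogeneous (wt n) (zzs k n) 1 := by
  refine MvPolynomial.IsWeightedHomogeneous.sum _ _ _ fun i _ => ?_
  have h1 := MvPolynomial.isWeightedHomogeneous_X k (wt n) (Sum.inl i)
  have h2 := MvPolynomial.isWeightedHomogeneous_X k (wt n) (Sum.inr i)
  simpa [wt] using h1.mul h2

/-- The functions on `U` which are homogeneous of degree `-q` in the `z*`-variables: the fractions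
`P / (zz*)^(N+q)` with `P` a polynomial homogeneous of degree `N` in the `z*`-variables. -/
def homFun (q : ℕ) : Submodule k (Fun k n) where
  carrier := {f | ∃ (N : ℕ) (P : Poly k n), MvPolynomial.IsWeightedHomogeneous (wt n) P N ∧
    f * algebraMap (Poly k n) (Fun k n) (zzs k n) ^ (N + q) = algebraMap (Poly k n) (Fun k n) P}
  zero_mem' := ⟨0, 0, MvPolynomial.isWeightedHomogeneous_zero k _ _, by simp⟩
  add_mem' := by
    rintro f g ⟨N, P, hP, hf⟩ ⟨M, Q, hQ, hg⟩
    refine ⟨N + M + q, P * zzs k n ^ (M + q) + Q * zzs k n ^ (N + q), ?_, ?_⟩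
    · refine MvPolynomial.IsWeightedHomogeneous.add ?_ ?_
      · have := hP.mul ((zzs_homogeneous k n).pow (M + q))
        simpa [add_assoc] using this
      · have := hQ.mul ((zzs_homogeneous k n).pow (N + q))
        have e : M + (N + q) = N + M + q := by omega
        simpa [e] using this
    · rw [map_add, map_mul, map_mul, ← hf, ← hg, map_pow, map_pow]
      ring
  smul_mem' := by
    rintro c f ⟨N, P, hP, hf⟩
    refine ⟨N, c • P, (MvPolynomial.weightedHomogeneousSubmodule k (wt n) N).smul_mem c hP, ?_⟩
    rw [smul_mul_assoc, hf, Algebra.smul_def c P, map_mul, Algebra.smul_def,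
      IsScalarTower.algebraMap_apply k (Poly k n) (Fun k n)]

/-- The span of the `dz_i`. -/
def spanDz : Submodule k (ExteriorAlgebra k (Cov k n)) :=
  LinearMap.range (ExteriorAlgebra.ι k ∘ₗ LinearMap.inl k (Fin n → k) (Fin n → k))

/-- The span of the `dz_i*`. -/
def spanDzs : Submodule k (ExteriorAlgebra k (Cov k n)) :=
  LinearMap.range (ExteriorAlgebra.ι k ∘ₗ LinearMap.inr k (Fin n → k) (Fin n → k))

/-- The span of the products `dz_{i₁} ∧ ⋯ ∧ dz_{i_p} ∧ dz*_{j₁} ∧ ⋯ ∧ dz*_{j_q}`. -/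
def extPart (p q : ℕ) : Submodule k (ExteriorAlgebra k (Cov k n)) := spanDz k n ^ p * spanDzs k n ^ q

/-- The forms `∑ f^I_J dz_I ∧ dz*_J` on `U` with `|I| = p`, `|J| = q` and all `f^I_J` homogeneous of
degree `-q` in the `z*`, so that the form has total degree `0` in the `z*_ν, dz*_ν`. -/
def homForms (p q : ℕ) : Submodule k (Forms k n) :=
  Submodule.map₂ (TensorProduct.mk k (Fun k n) (ExteriorAlgebra k (Cov k n)))
    (homFun k n q) (extPart k n p q)

/-- The coefficient of `dz_ν*`, as a linear form on the span of the `dz_i` and `dz_i*`; it is the value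
of such a constant form on the vector field `∂/∂z_ν*`. -/
def coordS (ν : Fin n) : Module.Dual k (Cov k n) :=
  LinearMap.proj ν ∘ₗ LinearMap.snd k (Fin n → k) (Fin n → k)

/-- Contraction of forms on `U` with the Euler vector field `ξ = ∑ z_ν* ∂/∂z_ν*`. -/
def contractEuler : Forms k n →ₗ[k] Forms k n :=
  ∑ ν : Fin n, TensorProduct.map (LinearMap.mulLeft k (zs k n ν))
    (CliffordAlgebra.contractLeft (Q := (0 : QuadraticForm k (Cov k n))) (coordS k n ν))

/-- The space `A^{p,q}` of the Jouanolou model, that is, the relative `q`-forms on the Jouanolou torsor `J` of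
the punctured affine space with values in the pullback of the `p`-forms, seen by pullback along the
`𝔾ₘ`-torsor `U → J` (with infinitesimal generator `ξ`) as forms on `U`: forms on `U` of bidegree `(p, q)` of total degree `0` in the
`z*_ν, dz*_ν` which are annihilated by the contraction with `ξ = ∑ z_ν* ∂/∂z_ν*`. -/
def A (p q : ℕ) : Submodule k (Forms k n) := homForms k n p q ⊓ LinearMap.ker (contractEuler k n)

/-! ### Products -/

variable {k n}

/-- The sign involution of forms. -/
def invol : Forms k n →ₗ[k] Forms k n :=
  TensorProduct.map LinearMap.id
    (CliffordAlgebra.involute (Q := (0 : QuadraticForm k (Cov k n)))).toLinearMap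

lemma contract_mul (d : Module.Dual k (Cov k n)) (x y : ExteriorAlgebra k (Cov k n)) :
    CliffordAlgebra.contractLeft (Q := (0 : QuadraticForm k (Cov k n))) d (x * y) =
      CliffordAlgebra.contractLeft (Q := (0 : QuadraticForm k (Cov k n))) d x * y +
      CliffordAlgebra.involute (Q := (0 : QuadraticForm k (Cov k n))) x *
        CliffordAlgebra.contractLeft (Q := (0 : QuadraticForm k (Cov k n))) d y := by
  induction x using CliffordAlgebra.left_induction with
  | algebraMap r =>
    rw [CliffordAlgebra.contractLeft_algebraMap_mul, CliffordAlgebra.contractLeft_algebraMap]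
    simp
  | add a b ha hb => rw [add_mul, map_add, ha, hb, map_add, map_add]; noncomm_ring
  | ι_mul a v ha =>
    rw [mul_assoc, CliffordAlgebra.contractLeft_ι_mul, ha, CliffordAlgebra.contractLeft_ι_mul,
      map_mul, CliffordAlgebra.involute_ι]
    simp only [sub_mul, mul_add, smul_mul_assoc, neg_mul, mul_assoc]
    abel

lemma contractEuler_tmul (f : Fun k n) (x : ExteriorAlgebra k (Cov k n)) :
    contractEuler k n (f ⊗ₜ x) = ∑ ν : Fin n, (zs k n ν * f) ⊗ₜ[k]
      (CliffordAlgebra.contractLeft (Q := (0 : QuadraticForm k (Cov k n))) (coordS k n ν) x) := by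
  simp [contractEuler, LinearMap.sum_apply]

lemma contractEuler_mul (a b : Forms k n) :
    contractEuler k n (a * b) = contractEuler k n a * b + invol a * contractEuler k n b := by
  induction a using TensorProduct.induction_on with
  | zero => simp
  | add a a' h h' => rw [add_mul, map_add, h, h', map_add, map_add]; noncomm_ring
  | tmul f x =>
    induction b using TensorProduct.induction_on with
    | zero => simp
    | add b b' h h' => rw [mul_add, map_add, h, h', map_add]; noncomm_ring
    | tmul g y =>
      rw [Algebra.TensorProduct.tmul_mul_tmul, contractEuler_tmul, contractEuler_tmul,
        contractEuler_tmul, Finset.sum_mul, invol, TensorProduct.map_tmul, Finset.mul_sum,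
        ← Finset.sum_add_distrib]
      refine Finset.sum_congr rfl fun ν _ => ?_
      rw [contract_mul, TensorProduct.tmul_add, Algebra.TensorProduct.tmul_mul_tmul,
        Algebra.TensorProduct.tmul_mul_tmul, mul_assoc, LinearMap.id_apply, mul_left_comm f]
      rfl

lemma homFun_mul {q q' : ℕ} {f g : Fun k n} (hf : f ∈ homFun k n q) (hg : g ∈ homFun k n q') :
    f * g ∈ homFun k n (q + q') := by
  obtain ⟨N, P, hP, hf⟩ := hf
  obtain ⟨M, Q, hQ, hg⟩ := hg
  refine ⟨N + M, P * Q, hP.mul hQ, ?_⟩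
  rw [map_mul, ← hf, ← hg]
  ring

lemma spanDzs_mul_spanDz : spanDzs k n * spanDz k n ≤ spanDz k n * spanDzs k n := by
  rw [Submodule.mul_le]
  rintro _ ⟨w, rfl⟩ _ ⟨v, rfl⟩
  have h := ExteriorAlgebra.ι_add_mul_swap (R := k) (LinearMap.inr k (Fin n → k) (Fin n → k) w)
    (LinearMap.inl k (Fin n → k) (Fin n → k) v)
  rw [LinearMap.comp_apply, LinearMap.comp_apply, eq_neg_of_add_eq_zero_left h]
  exact Submodule.neg_mem _ (Submodule.mul_mem_mul ⟨v, rfl⟩ ⟨w, rfl⟩)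

lemma spanDz_mul_spanDzs : spanDz k n * spanDzs k n ≤ spanDzs k n * spanDz k n := by
  rw [Submodule.mul_le]
  rintro _ ⟨v, rfl⟩ _ ⟨w, rfl⟩
  have h := ExteriorAlgebra.ι_add_mul_swap (R := k) (LinearMap.inl k (Fin n → k) (Fin n → k) v)
    (LinearMap.inr k (Fin n → k) (Fin n → k) w)
  rw [LinearMap.comp_apply, LinearMap.comp_apply, eq_neg_of_add_eq_zero_left h]
  exact Submodule.neg_mem _ (Submodule.mul_mem_mul ⟨w, rfl⟩ ⟨v, rfl⟩)

lemma extPart_mul (p q p' q' : ℕ) :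
    extPart k n p q * extPart k n p' q' = extPart k n (p + p') (q + q') := by
  have hc : Commute (spanDzs k n) (spanDz k n) := le_antisymm spanDzs_mul_spanDz spanDz_mul_spanDzs
  have := (hc.pow_pow q p').eq
  rw [extPart, extPart, extPart, pow_add, pow_add, mul_assoc, ← mul_assoc (spanDzs k n ^ q), this]
  simp only [mul_assoc]

lemma homForms_mul {p q p' q' : ℕ} {a b : Forms k n} (ha : a ∈ homForms k n p q)
    (hb : b ∈ homForms k n p' q') : a * b ∈ homForms k n (p + p') (q + q') := by
  have hmul : homForms k n p q * homForms k n p' q' ≤ homForms k n (p + p') (q + q') := by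
    rw [homForms, homForms, Submodule.map₂_eq_span_image2, Submodule.map₂_eq_span_image2,
      Submodule.span_mul_span, Submodule.span_le]
    rintro _ ⟨_, ⟨f, hf, x, hx, rfl⟩, _, ⟨g, hg, y, hy, rfl⟩, rfl⟩
    simp only [TensorProduct.mk_apply, Algebra.TensorProduct.tmul_mul_tmul]
    refine Submodule.apply_mem_map₂ (TensorProduct.mk k _ _) (homFun_mul hf hg) ?_
    rw [← extPart_mul]
    exact Submodule.mul_mem_mul hx hy
  exact hmul (Submodule.mul_mem_mul ha hb)

/-- The product of forms maps `A^{p,q} × A^{p',q'}` to `A^{p+p',q+q'}`. -/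
lemma A_mul {p q p' q' : ℕ} {a b : Forms k n} (ha : a ∈ A k n p q) (hb : b ∈ A k n p' q') :
    a * b ∈ A k n (p + p') (q + q') := by
  refine ⟨homForms_mul ha.1 hb.1, ?_⟩
  change contractEuler k n (a * b) = 0
  rw [contractEuler_mul, show contractEuler k n a = 0 from ha.2,
    show contractEuler k n b = 0 from hb.2]
  simp

end Forms

/-! ### The action of the general linear group -/

section Action

variable {k : Type*} [Field k] {n : ℕ}

/-- The action of `g` on polynomials: `z_j ↦ ∑ g_{ij} z_i` (the action of `GL(V)` on the space `V = kⁿ`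
spanned by the `z_i`), and `z_j* ↦ ∑ (g⁻¹)_{ji} z_i*` (the dual action), so that `zz*` is invariant. -/
def actPoly (g : GL (Fin n) k) : Poly k n →ₐ[k] Poly k n :=
  MvPolynomial.aeval (Sum.elim
    (fun j => ∑ i, MvPolynomial.C (g.1 i j) * MvPolynomial.X (Sum.inl i))
    (fun j => ∑ i, MvPolynomial.C ((g⁻¹).1 j i) * MvPolynomial.X (Sum.inr i)))

/-- The action of `g` on the span of the `dz_i`, `dz_i*`, by the same formulas. -/
def actCov (g : GL (Fin n) k) : Cov k n →ₗ[k] Cov k n :=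
  LinearMap.prodMap (Matrix.mulVecLin g.1) (Matrix.mulVecLin (g⁻¹).1.transpose)

lemma actPoly_zzs (g : GL (Fin n) k) : actPoly g (zzs k n) = zzs k n := by
  have h : ∀ i l : Fin n, ∑ j, g.1 i j * (g⁻¹).1 j l = if i = l then 1 else 0 := by
    intro i l
    have h0 : g.1 * (g⁻¹).1 = 1 := Units.mul_inv g
    rw [← Matrix.mul_apply, h0, Matrix.one_apply]
  simp only [zzs, actPoly, map_sum, map_mul, MvPolynomial.aeval_X, Sum.elim_inl, Sum.elim_inr,
    Finset.sum_mul_sum]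
  rw [Finset.sum_comm]
  refine Finset.sum_congr rfl fun i _ => ?_
  rw [Finset.sum_comm]
  have e : ∀ l j : Fin n, (MvPolynomial.C (g.1 i j) * MvPolynomial.X (Sum.inl i) *
      (MvPolynomial.C ((g⁻¹).1 j l) * MvPolynomial.X (Sum.inr l)) : Poly k n) =
      MvPolynomial.C (g.1 i j * (g⁻¹).1 j l) *
        (MvPolynomial.X (Sum.inl i) * MvPolynomial.X (Sum.inr l)) := by
    intro l j
    rw [MvPolynomial.C_mul]
    ring
  simp only [e, ← Finset.sum_mul, ← map_sum, h]
  simp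

/-- The action of `g` on functions on `U`. -/
def actFun (g : GL (Fin n) k) : Fun k n →ₐ[k] Fun k n :=
  IsLocalization.liftAlgHom (M := Submonoid.powers (zzs k n))
    (f := (IsScalarTower.toAlgHom k (Poly k n) (Fun k n)).comp (actPoly g)) (by
      rintro ⟨_, m, rfl⟩
      simp only [AlgHom.comp_apply, map_pow, actPoly_zzs]
      exact (IsLocalization.Away.algebraMap_isUnit (zzs k n)).pow m)

@[simp] lemma actFun_algebraMap (g : GL (Fin n) k) (P : Poly k n) :
    actFun g (algebraMap (Poly k n) (Fun k n) P) = algebraMap _ _ (actPoly g P) := by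
  simp [actFun]

/-- The action of `g` on forms on `U`, by algebra endomorphisms. -/
def actForms (g : GL (Fin n) k) : Forms k n →ₐ[k] Forms k n :=
  Algebra.TensorProduct.map (actFun g) (ExteriorAlgebra.map (actCov g))

lemma actPoly_mul (g h : GL (Fin n) k) : actPoly (g * h) = (actPoly g).comp (actPoly h) := by
  refine MvPolynomial.algHom_ext fun s => ?_
  rcases s with j | j
  · simp only [actPoly, AlgHom.comp_apply, MvPolynomial.aeval_X, Sum.elim_inl, map_sum, map_mul,
      MvPolynomial.algHom_C, Units.val_mul, Matrix.mul_apply, Finset.sum_mul, Finset.mul_sum,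
      MvPolynomial.algebraMap_eq]
    rw [Finset.sum_comm]
    refine Finset.sum_congr rfl fun i _ => Finset.sum_congr rfl fun l _ => ?_
    ring
  · simp only [actPoly, AlgHom.comp_apply, MvPolynomial.aeval_X, Sum.elim_inr, map_sum, map_mul,
      MvPolynomial.algHom_C, mul_inv_rev, Units.val_mul, Matrix.mul_apply, Finset.sum_mul,
      Finset.mul_sum, MvPolynomial.algebraMap_eq]
    rw [Finset.sum_comm]
    refine Finset.sum_congr rfl fun i _ => Finset.sum_congr rfl fun l _ => ?_
    ring

lemma actPoly_one : actPoly (1 : GL (Fin n) k) = AlgHom.id k _ := by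
  refine MvPolynomial.algHom_ext fun s => ?_
  rcases s with j | j <;> simp [actPoly, Matrix.one_apply]

lemma actCov_mul (g h : GL (Fin n) k) : actCov (g * h) = actCov g ∘ₗ actCov h := by
  refine LinearMap.ext fun v => ?_
  simp [actCov, Matrix.mulVec_mulVec]

lemma actCov_one : actCov (1 : GL (Fin n) k) = LinearMap.id := by
  refine LinearMap.ext fun v => ?_
  simp [actCov]

lemma actFun_mul (g h : GL (Fin n) k) : actFun (g * h) = (actFun g).comp (actFun h) := by
  refine IsLocalization.algHom_ext (Submonoid.powers (zzs k n)) (AlgHom.ext fun P => ?_)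
  change actFun (g * h) (algebraMap _ _ P) = actFun g (actFun h (algebraMap _ _ P))
  simp [actPoly_mul]

lemma actFun_one : actFun (1 : GL (Fin n) k) = AlgHom.id k _ := by
  refine IsLocalization.algHom_ext (Submonoid.powers (zzs k n)) (AlgHom.ext fun P => ?_)
  change actFun 1 (algebraMap _ _ P) = algebraMap _ _ P
  simp [actPoly_one]

variable (k n)

/-- The representation of `GL_n` on the forms on `U`. -/
def formsRep : Representation k (GL (Fin n) k) (Forms k n) where
  toFun g := (actForms g).toLinearMap
  map_one' := by
    rw [actForms, actFun_one, actCov_one, ExteriorAlgebra.map_id, Algebra.TensorProduct.map_id]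
    rfl
  map_mul' g h := by
    rw [actForms, actFun_mul, actCov_mul, ← ExteriorAlgebra.map_comp_map,
      Algebra.TensorProduct.map_comp]
    rfl

variable {k n}

lemma actPoly_homogeneous (g : GL (Fin n) k) {P : Poly k n} {N : ℕ}
    (hP : MvPolynomial.IsWeightedHomogeneous (wt n) P N) :
    MvPolynomial.IsWeightedHomogeneous (wt n) (actPoly g P) N := by
  have hX : ∀ s, MvPolynomial.IsWeightedHomogeneous (wt n)
      (actPoly g (MvPolynomial.X s : Poly k n)) (wt n s) := by
    rintro (j | j)
    · simp only [actPoly, MvPolynomial.aeval_X, Sum.elim_inl]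
      refine MvPolynomial.IsWeightedHomogeneous.sum _ _ _ fun i _ => ?_
      have := (MvPolynomial.isWeightedHomogeneous_C (wt n) (g.1 i j)).mul
        (MvPolynomial.isWeightedHomogeneous_X k (wt n) (Sum.inl i))
      simpa [wt] using this
    · simp only [actPoly, MvPolynomial.aeval_X, Sum.elim_inr]
      refine MvPolynomial.IsWeightedHomogeneous.sum _ _ _ fun i _ => ?_
      have := (MvPolynomial.isWeightedHomogeneous_C (wt n) ((g⁻¹).1 j i)).mul
        (MvPolynomial.isWeightedHomogeneous_X k (wt n) (Sum.inr i))
      simpa [wt] using this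
  rw [P.as_sum, map_sum]
  refine MvPolynomial.IsWeightedHomogeneous.sum _ _ _ fun d hd => ?_
  have hdeg := hP (MvPolynomial.mem_support_iff.1 hd)
  rw [MvPolynomial.monomial_eq, map_mul, MvPolynomial.algHom_C, Finsupp.prod, map_prod]
  have h2 : MvPolynomial.IsWeightedHomogeneous (wt n)
      (∏ s ∈ d.support, actPoly g ((MvPolynomial.X s : Poly k n) ^ d s))
      (∑ s ∈ d.support, d s • wt n s) := by
    refine MvPolynomial.IsWeightedHomogeneous.prod _ _ _ fun s _ => ?_
    rw [map_pow]
    exact (hX s).pow (d s)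
  have h3 := (MvPolynomial.isWeightedHomogeneous_C (wt n) (MvPolynomial.coeff d P)).mul h2
  rw [zero_add] at h3
  rw [← hdeg, Finsupp.weight_apply]
  exact h3

lemma actFun_homFun (g : GL (Fin n) k) {q : ℕ} {f : Fun k n} (hf : f ∈ homFun k n q) :
    actFun g f ∈ homFun k n q := by
  obtain ⟨N, P, hP, hf⟩ := hf
  refine ⟨N, actPoly g P, actPoly_homogeneous g hP, ?_⟩
  rw [← actFun_algebraMap, ← hf, map_mul, map_pow, actFun_algebraMap, actPoly_zzs]

lemma map_extPart (g : GL (Fin n) k) {p q : ℕ} {x : ExteriorAlgebra k (Cov k n)}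
    (hx : x ∈ extPart k n p q) : ExteriorAlgebra.map (actCov g) x ∈ extPart k n p q := by
  have h1 : (spanDz k n).map (ExteriorAlgebra.map (actCov g)).toLinearMap ≤ spanDz k n := by
    rintro _ ⟨_, ⟨v, rfl⟩, rfl⟩
    refine ⟨Matrix.mulVecLin g.1 v, ?_⟩
    simp [actCov]
  have h2 : (spanDzs k n).map (ExteriorAlgebra.map (actCov g)).toLinearMap ≤ spanDzs k n := by
    rintro _ ⟨_, ⟨v, rfl⟩, rfl⟩
    refine ⟨Matrix.mulVecLin (g⁻¹).1.transpose v, ?_⟩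
    simp [actCov]
  have h3 : (extPart k n p q).map (ExteriorAlgebra.map (actCov g)).toLinearMap ≤
      extPart k n p q := by
    rw [extPart, Submodule.map_mul, Submodule.map_pow, Submodule.map_pow]
    exact mul_le_mul' (pow_le_pow_left' h1 p) (pow_le_pow_left' h2 q)
  exact h3 ⟨x, hx, rfl⟩

lemma contract_map (f : Cov k n →ₗ[k] Cov k n) (d : Module.Dual k (Cov k n))
    (x : ExteriorAlgebra k (Cov k n)) :
    CliffordAlgebra.contractLeft (Q := (0 : QuadraticForm k (Cov k n))) d
      (ExteriorAlgebra.map f x) = ExteriorAlgebra.map f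
        (CliffordAlgebra.contractLeft (Q := (0 : QuadraticForm k (Cov k n))) (d ∘ₗ f) x) := by
  induction x using CliffordAlgebra.left_induction with
  | algebraMap r =>
    rw [CliffordAlgebra.contractLeft_algebraMap, map_zero]
    erw [AlgHom.commutes, CliffordAlgebra.contractLeft_algebraMap]
  | add a b ha hb => rw [map_add, map_add, ha, hb, map_add, map_add]
  | ι_mul a v ha =>
    have e : ExteriorAlgebra.map f (CliffordAlgebra.ι (0 : QuadraticForm k (Cov k n)) v) =
      CliffordAlgebra.ι (0 : QuadraticForm k (Cov k n)) (f v) := ExteriorAlgebra.map_apply_ι f v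
    rw [map_mul, e, CliffordAlgebra.contractLeft_ι_mul, CliffordAlgebra.contractLeft_ι_mul, ha,
      map_sub, map_mul, e, map_smul]
    rfl

lemma contractEuler_act (g : GL (Fin n) k) (a : Forms k n) :
    contractEuler k n (actForms g a) = actForms g (contractEuler k n a) := by
  induction a using TensorProduct.induction_on with
  | zero => simp
  | add a b ha hb => rw [map_add, map_add, ha, hb, map_add, map_add]
  | tmul f x =>
    have hd : ∀ ν, coordS k n ν ∘ₗ actCov g = ∑ j, (g⁻¹).1 j ν • coordS k n j := by
      intro ν
      refine LinearMap.ext fun v => ?_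
      simp [coordS, actCov, Matrix.vecMul, dotProduct, LinearMap.sum_apply, mul_comm]
    have hz : ∀ j, actFun g (zs k n j) = ∑ ν, (g⁻¹).1 j ν • zs k n ν := by
      intro j
      rw [zs, actFun_algebraMap, actPoly, MvPolynomial.aeval_X, Sum.elim_inr, map_sum]
      refine Finset.sum_congr rfl fun ν _ => ?_
      rw [zs, map_mul, Algebra.smul_def, IsScalarTower.algebraMap_apply k (Poly k n) (Fun k n)]
      rfl
    rw [contractEuler_tmul, actForms, Algebra.TensorProduct.map_tmul, contractEuler_tmul, map_sum]
    simp only [Algebra.TensorProduct.map_tmul, contract_map, hd, map_sum, map_mul, hz,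
      LinearMap.sum_apply, map_smul, LinearMap.smul_apply, TensorProduct.tmul_sum,
      Finset.sum_mul, TensorProduct.sum_tmul, TensorProduct.tmul_smul, smul_mul_assoc,
      TensorProduct.smul_tmul']
    rw [Finset.sum_comm]

lemma A_act (g : GL (Fin n) k) {p q : ℕ} {a : Forms k n} (ha : a ∈ A k n p q) :
    actForms g a ∈ A k n p q := by
  refine ⟨?_, ?_⟩
  · have h : homForms k n p q ≤ (homForms k n p q).comap (actForms g).toLinearMap := by
      refine Submodule.map₂_le.2 fun f hf x hx => ?_
      exact Submodule.apply_mem_map₂ (TensorProduct.mk k _ _) (actFun_homFun g hf) (map_extPart g hx)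
    exact h ha.1
  · change contractEuler k n (actForms g a) = 0
    rw [contractEuler_act, show contractEuler k n a = 0 from ha.2, map_zero]

variable (k n)

/-- The representation of `GL_n` on `A^{p,q}`. -/
def rep (p q : ℕ) : Representation k (GL (Fin n) k) (A k n p q) :=
  Subrepresentation.toRepresentation (ρ := formsRep k n)
    { toSubmodule := A k n p q
      apply_mem_toSubmodule := fun g _ hv => A_act g hv }

end Action

/-! ### The Martinelli-Bochner form and the residue -/

section Residue

variable (k : Type*) [Field k] (n : ℕ)

/-- The Martinelli-Bochner form
`Ω = (zz*)⁻ⁿ ∑_ν (-1)^(ν-1) z_ν* dz_1* ∧ ⋯ ∧ (omit dz_ν*) ∧ ⋯ ∧ dz_n*`; here `ν` is counted from `0`, which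
turns the sign into `(-1)^ν`. -/
def martinelliBochner : Forms k n :=
  ∑ ν : Fin n, ((-1) ^ (ν : ℕ) * zs k n ν * invzzs k n ^ n) ⊗ₜ[k]
    (((List.finRange n).eraseIdx ν).map (dzs k n)).prod

/-- The form `dz_1 ∧ ⋯ ∧ dz_n`. -/
def dzTop : Forms k n := 1 ⊗ₜ[k] ((List.finRange n).map (dz k n)).prod

variable {k n}

lemma zs_mem (ν : Fin n) : (-1) ^ (ν : ℕ) * zs k n ν * invzzs k n ^ n ∈ homFun k n (n - 1) := by
  have hn : 1 + (n - 1) = n := by have := ν.2; omega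
  refine ⟨1, (-1) ^ (ν : ℕ) * MvPolynomial.X (Sum.inr ν), ?_, ?_⟩
  · have h1 : MvPolynomial.IsWeightedHomogeneous (wt n)
        (MvPolynomial.C ((-1) ^ (ν : ℕ)) : Poly k n) 0 := MvPolynomial.isWeightedHomogeneous_C _ _
    have h2 := h1.mul (MvPolynomial.isWeightedHomogeneous_X k (wt n) (Sum.inr ν))
    simpa [wt] using h2
  · have h : invzzs k n * algebraMap (Poly k n) (Fun k n) (zzs k n) = 1 := by
      rw [mul_comm]
      exact IsLocalization.Away.mul_invSelf (zzs k n)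
    rw [hn, mul_assoc, ← mul_pow, h, one_pow, mul_one, zs]
    simp

lemma prod_dz_mem (l : List (Fin n)) : (l.map (dz k n)).prod ∈ extPart k n l.length 0 := by
  have : (l.map (dz k n)).prod ∈ spanDz k n ^ l.length := by
    induction l with
    | nil => simp
    | cons a l ih =>
      rw [List.map_cons, List.prod_cons, List.length_cons, pow_succ']
      exact Submodule.mul_mem_mul ⟨Pi.single a 1, rfl⟩ ih
  simpa [extPart] using this

lemma prod_dzs_mem (l : List (Fin n)) : (l.map (dzs k n)).prod ∈ extPart k n 0 l.length := by
  have : (l.map (dzs k n)).prod ∈ spanDzs k n ^ l.length := by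
    induction l with
    | nil => simp
    | cons a l ih =>
      rw [List.map_cons, List.prod_cons, List.length_cons, pow_succ']
      exact Submodule.mul_mem_mul ⟨Pi.single a 1, rfl⟩ ih
  simpa [extPart] using this

lemma contractEuler_dzs_mul (i : Fin n) (f : Fun k n) (x : ExteriorAlgebra k (Cov k n)) :
    contractEuler k n (f ⊗ₜ (dzs k n i * x)) =
      (zs k n i * f) ⊗ₜ x - (1 ⊗ₜ dzs k n i) * contractEuler k n (f ⊗ₜ x) := by
  rw [contractEuler_tmul, contractEuler_tmul, Finset.mul_sum]
  have h : ∀ ν, CliffordAlgebra.contractLeft (Q := (0 : QuadraticForm k (Cov k n))) (coordS k n ν)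
      (dzs k n i * x) = (if ν = i then (1 : k) else 0) • x - dzs k n i *
        CliffordAlgebra.contractLeft (Q := (0 : QuadraticForm k (Cov k n))) (coordS k n ν) x := by
    intro ν
    have := CliffordAlgebra.contractLeft_ι_mul (Q := (0 : QuadraticForm k (Cov k n)))
      (d := coordS k n ν) (0, Pi.single i 1) x
    rw [dzs, show (if ν = i then (1 : k) else 0) = coordS k n ν (0, Pi.single i 1) by
      simp [coordS, Pi.single_apply]]
    exact this
  simp only [h, TensorProduct.tmul_sub, Finset.sum_sub_distrib,
    Algebra.TensorProduct.tmul_mul_tmul, one_mul]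
  congr 1
  rw [Finset.sum_eq_single i]
  · simp
  · intro ν _ hν
    simp [hν]
  · simp

lemma contractEuler_prod_dzs (l : List (Fin n)) (f : Fun k n) :
    contractEuler k n (f ⊗ₜ (l.map (dzs k n)).prod) =
      ∑ i : Fin l.length, ((-1) ^ (i : ℕ) * zs k n (l.get i) * f) ⊗ₜ[k]
        ((l.eraseIdx i).map (dzs k n)).prod := by
  induction l generalizing f with
  | nil =>
    have h : ∀ ν, CliffordAlgebra.contractLeft (Q := (0 : QuadraticForm k (Cov k n)))
      (coordS k n ν) (1 : ExteriorAlgebra k (Cov k n)) = 0 :=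
      fun ν => CliffordAlgebra.contractLeft_one (Q := (0 : QuadraticForm k (Cov k n))) _
    simp [contractEuler_tmul, h]
  | cons a l ih =>
    rw [List.map_cons, List.prod_cons, contractEuler_dzs_mul, ih, Finset.mul_sum]
    simp only [List.length_cons]
    rw [Fin.sum_univ_succ, sub_eq_add_neg, ← Finset.sum_neg_distrib]
    congr 1
    · simp
    · refine Finset.sum_congr rfl fun i _ => ?_
      rw [Algebra.TensorProduct.tmul_mul_tmul, ← TensorProduct.neg_tmul]
      simp [pow_succ]

lemma contractEuler_sq [CharZero k] (a : Forms k n) : contractEuler k n (contractEuler k n a) = 0 := by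
  induction a using TensorProduct.induction_on with
  | zero => simp
  | add a b ha hb => rw [map_add, map_add, ha, hb, add_zero]
  | tmul f x =>
    have h : contractEuler k n (contractEuler k n (f ⊗ₜ x)) =
        - contractEuler k n (contractEuler k n (f ⊗ₜ x)) := by
      simp only [contractEuler_tmul, map_sum]
      conv_lhs => rw [Finset.sum_comm]
      simp only [← Finset.sum_neg_distrib]
      refine Finset.sum_congr rfl fun i _ => Finset.sum_congr rfl fun j _ => ?_
      have h := CliffordAlgebra.contractLeft_comm (Q := (0 : QuadraticForm k (Cov k n)))
        (d := coordS k n i) (d' := coordS k n j) x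
      erw [h]
      rw [TensorProduct.tmul_neg, mul_left_comm]
    have h2 : (2 : k) • contractEuler k n (contractEuler k n (f ⊗ₜ[k] x)) = 0 := by
      rw [two_smul]
      nth_rewrite 1 [h]
      simp
    exact (smul_eq_zero.1 h2).resolve_left two_ne_zero

lemma martinelliBochner_mem [CharZero k] : martinelliBochner k n ∈ A k n 0 (n - 1) := by
  refine ⟨?_, ?_⟩
  · refine Submodule.sum_mem _ fun ν _ => ?_
    refine Submodule.apply_mem_map₂ (TensorProduct.mk k _ _) (zs_mem ν) ?_
    have h := prod_dzs_mem (k := k) ((List.finRange n).eraseIdx ν)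
    rwa [List.length_eraseIdx_of_lt (by simp), List.length_finRange] at h
  · have h : martinelliBochner k n = contractEuler k n
        ((invzzs k n ^ n) ⊗ₜ ((List.finRange n).map (dzs k n)).prod) := by
      rw [contractEuler_prod_dzs, martinelliBochner]
      refine Fintype.sum_equiv (finCongr (List.length_finRange (n := n)).symm) _ _ fun ν => ?_
      simp
    rw [h]
    exact contractEuler_sq _

lemma one_mem_homFun : (1 : Fun k n) ∈ homFun k n 0 :=
  ⟨0, 1, MvPolynomial.isWeightedHomogeneous_one k _, by simp⟩

lemma dzTop_mem : dzTop k n ∈ A k n n 0 := by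
  refine ⟨?_, ?_⟩
  · refine Submodule.apply_mem_map₂ (TensorProduct.mk k _ _) one_mem_homFun ?_
    have h := prod_dz_mem (k := k) (List.finRange n)
    rwa [List.length_finRange] at h
  · change contractEuler k n (dzTop k n) = 0
    rw [dzTop, contractEuler_tmul]
    refine Finset.sum_eq_zero fun ν _ => ?_
    have h : ∀ l : List (Fin n), CliffordAlgebra.contractLeft
        (Q := (0 : QuadraticForm k (Cov k n))) (coordS k n ν) (l.map (dz k n)).prod = 0 := by
      intro l
      induction l with
      | nil => exact CliffordAlgebra.contractLeft_one (Q := (0 : QuadraticForm k (Cov k n))) _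
      | cons a l ih =>
        rw [List.map_cons, List.prod_cons]
        have := CliffordAlgebra.contractLeft_ι_mul (Q := (0 : QuadraticForm k (Cov k n)))
          (d := coordS k n ν) (Pi.single a 1, 0) (l.map (dz k n)).prod
        refine this.trans ?_
        rw [ih]
        simp [coordS]
    rw [h, TensorProduct.tmul_zero]

variable (k n)

/-- The element `Ω · dz_1 ∧ ⋯ ∧ dz_n` of `A^{n,n-1}`. -/
def martinelliBochnerTop [CharZero k] : A k n n (n - 1) :=
  ⟨martinelliBochner k n * dzTop k n, by simpa using A_mul martinelliBochner_mem dzTop_mem⟩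

/-- The two properties characterizing the residue: it is a `GL_n`-invariant functional on `A^{n,n-1}`,
and it takes the value `1` on `Ω · dz_1 ∧ ⋯ ∧ dz_n`. -/
def IsResidue [CharZero k] (R : A k n n (n - 1) →ₗ[k] k) : Prop :=
  (∀ (g : GL (Fin n) k) (a : A k n n (n - 1)), R (rep k n n (n - 1) g a) = R a) ∧
    R (martinelliBochnerTop k n) = 1

/-- The residue map `Res : A^{n,n-1} → k`: the functional with the property `IsResidue`. -/
def residue [CharZero k] : A k n n (n - 1) →ₗ[k] k := Classical.epsilon (IsResidue k n)

variable {k n}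

/-- The product of forms `A^{p,q} × A^{n-p,n-1-q} → A^{n,n-1}`. -/
def mulTop {p q : ℕ} (hp : p ≤ n) (hq : q ≤ n - 1) :
    A k n p q →ₗ[k] A k n (n - p) (n - 1 - q) →ₗ[k] A k n n (n - 1) :=
  LinearMap.mk₂ k
    (fun a b => ⟨(a : Forms k n) * (b : Forms k n), by
      have h := A_mul a.2 b.2
      rwa [Nat.add_sub_cancel' hp, Nat.add_sub_cancel' hq] at h⟩)
    (fun a a' b => Subtype.ext (add_mul _ _ _))
    (fun c a b => Subtype.ext (smul_mul_assoc _ _ _))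
    (fun a b b' => Subtype.ext (mul_add _ _ _))
    (fun c a b => Subtype.ext (mul_smul_comm _ _ _))

/-- The residue pairing `(α, β) ↦ Res(α · β)`. -/
def residuePairing [CharZero k] {p q : ℕ} (hp : p ≤ n) (hq : q ≤ n - 1) :
    A k n p q →ₗ[k] A k n (n - p) (n - 1 - q) →ₗ[k] k :=
  (mulTop hp hq).compr₂ (residue k n)

end Residue

/-! ### The restricted dual -/

section RestrictedDual

variable {k G E : Type*} [Field k] [Group G] [AddCommGroup E] [Module k E]

/-- The isotypic components of a representation: for each irreducible subrepresentation `S`, the sum of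
all the subrepresentations isomorphic to `S`. -/
abbrev Isotypic (ρ : Representation k G E) : Set (Submodule (MonoidAlgebra k G) ρ.asModule) :=
  isotypicComponents (MonoidAlgebra k G) ρ.asModule

/-- `E ≃ ⨁ C_α ⊗ Σ_α` with pairwise non-isomorphic irreducible `Σ_α` and finite-dimensional
isotypic components `C_α ⊗ Σ_α`. -/
def HasFiniteMultiplicities (ρ : Representation k G E) : Prop :=
  IsSemisimpleModule (MonoidAlgebra k G) ρ.asModule ∧ ∀ c ∈ Isotypic ρ, FiniteDimensional k c

/-- The restricted dual of `E ≃ ⨁ C_α ⊗ Σ_α`: the direct sum, over the isotypic components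
`C_α ⊗ Σ_α`, of their dual spaces `C_α^* ⊗ Σ_α^*`. -/
abbrev RestrictedDual (ρ : Representation k G E) : Type _ :=
  DirectSum (Isotypic ρ) fun c => Module.Dual k c

/-- The bilinear pairing `B : E × F → k` induces an isomorphism of `F` onto the restricted dual of `E`:
there is a linear isomorphism taking each `b` to the family of the restrictions of the functional
`B(·, b)` to the isotypic components of `E`. -/
def InducesIsoOntoRestrictedDual {F : Type*} [AddCommGroup F] [Module k F]
    (ρ : Representation k G E) (B : E →ₗ[k] F →ₗ[k] k) : Prop :=
  ∃ e : F ≃ₗ[k] RestrictedDual ρ, ∀ (b : F) (c : Isotypic ρ) (x : c.1),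
    e b c x = B (ρ.asModuleEquiv (x : ρ.asModule)) b

end RestrictedDual

end Jouanolou

end

/-!
Call `U` the open set `zz* ≠ 0`. Contraction with the Euler field `∑ z_ν* ∂/∂z_ν*` is an
antiderivation of the algebra of forms on `U`, and `A^{p,q}` is the part of its kernel in bidegree
`(p, q)` and total degree zero in the `z*`, `dz*`. The invariant one-form `η = (zz*)⁻¹ ∑ z_i
dz_i*` has contraction `1`, so that multiplication by `η` is a contracting homotopy
(`contractEuler_eta_mul`). In particular contraction is injective on forms of bidegree `(p, n)`,
and every element of `A^{n,n-1}` is `f · Ω dz_1 ∧ ⋯ ∧ dz_n` for a unique function `f` of degree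
zero in the `z*`, its `density`, obtained by multiplication with `η` and comparison of top forms.

*The residue.* The Gaussian functional `z^α z*^β ↦ δ_{αβ} α!` on polynomials satisfies integration
by parts: multiplication by a coordinate becomes differentiation along the dual one. This property
characterizes the functional (`eq_gauss`), which is therefore invariant under `GL_n`, and in
characteristic zero it makes the pairing `(P, Q) ↦ ⟨P Q⟩` nondegenerate
(`exists_gauss_mul_ne_zero`). Rescaled in each degree so as to be compatible with multiplication
by `zz*`, it descends to an invariant functional `funRes` on functions on `U`, an algebraic form
of the mean value over the unit sphere. Its value at the density is an invariant functional
`resMap` on `A^{n,n-1}` which takes `Ω dz_1 ∧ ⋯ ∧ dz_n` to `1`.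

*Nondegeneracy.* Let `a ∈ A^{p,q}` be nonzero. The product on constant forms is a perfect pairing
in complementary bidegrees, so `a b ≠ 0` for some form `b` of bidegree `(n-p, n-q)`. Contraction
is injective in top degree and kills `a`, so the contraction of `b`, which lies in
`A^{n-p,n-1-q}`, still has a nonzero product with `a` (`exists_A_mul_ne_zero`). Multiplying by a
suitable function of degree zero makes the residue nonzero, since `funRes` gives a nondegenerate
pairing on these functions.

*Complete reducibility.* The forms on `U` are spanned by finite families on which `GL_n` acts
through mixed tensors `V^{⊗ α} ⊗ (V^*)^{⊗ β}`. On the span of the operators of `GL_n(ℚ)` on mixed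
tensors, the trace form is nondegenerate because this span is stable under transposition and `tr
(x xᵀ)` is a sum of squares. By density of the rational points this passes to `k`
(`eq_zero_of_trace_mul_eq_zero`), and an algebra of operators with nondegenerate trace form has
zero radical. Thus the spaces `A^{p,q}` are semisimple and locally finite.

*Finite multiplicities and uniqueness.* The orbit of the point `z = z* = (1, 0, …, 0)` is dense in
`zz* = 1`, so that a form of pure bidegree vanishing on it is zero. Hence an equivariant map from
an irreducible `S` to `A^{p,q}` is determined by its composition with evaluation at that point, a
linear map from `S` to a space of finite dimension (`hasFiniteMultiplicities_of_eval`). For the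
same reason the invariant elements of `A^{n,n-1}` are the multiples of `Ω dz_1 ∧ ⋯ ∧ dz_n`, and by
semisimplicity an invariant functional is determined by its value there.

*The restricted dual.* It remains to see that a nondegenerate invariant pairing `E × F → k`, with
`E` of finite multiplicities and `F` semisimple and locally finite, identifies `F` with the
restricted dual of `E` (`inducesIsoOntoRestrictedDual_of_nondegenerate`). An element of `F` lies
in a finite-dimensional subrepresentation `W`, whose orthogonal complement in `E` has finite
codimension and thus contains almost all isotypic components. Conversely, for an isotypic
component `c` of `E`, a complement `C` of the orthogonal of `c` in `F` is paired perfectly with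
`c`, and its orthogonal in `E` is a complement of `c`, which contains all other components.
-/

noncomputable section

namespace Jouanolou

/-! ### The Gaussian functional on polynomials -/

section Gauss

open MvPolynomial

variable {k : Type*} [Field k] {n : ℕ}

/-- The value of the Gaussian functional on the monomial `z^α z*^β`, with `d = (α, β)`: it is `α!`
if `α = β`, and zero otherwise. -/
def gaussWeight (d : Fin n ⊕ Fin n →₀ ℕ) : ℕ :=
  ∏ i, if d (Sum.inl i) = d (Sum.inr i) then (d (Sum.inl i)).factorial else 0

variable (k n) in
/-- The Gaussian functional `k[z, z*] → k`, `z^α z*^β ↦ δ_{αβ} α!`. For `k = ℂ` and `z* = z̄` it is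
the integral against the Gaussian probability measure `π⁻ⁿ exp(-|z|²)`. -/
def gauss : Poly k n →ₗ[k] k :=
  (basisMonomials (Fin n ⊕ Fin n) k).constr k fun d => (gaussWeight d : k)

@[simp] lemma gauss_monomial (d : Fin n ⊕ Fin n →₀ ℕ) (c : k) :
    gauss k n (monomial d c) = c * gaussWeight d := by
  have h : monomial d c = c • basisMonomials (Fin n ⊕ Fin n) k d := by
    simp [smul_monomial]
  rw [h, map_smul, gauss, Module.Basis.constr_basis, smul_eq_mul]

lemma gauss_one : gauss k n 1 = 1 := by
  have h : (1 : Poly k n) = monomial 0 1 := rfl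
  rw [h, gauss_monomial]
  simp [gaussWeight]

lemma gaussWeight_add_single (d : Fin n ⊕ Fin n →₀ ℕ) (s : Fin n ⊕ Fin n) :
    gaussWeight (Finsupp.single s 1 + d) =
      d s.swap * gaussWeight (d - Finsupp.single s.swap 1) := by
  classical
  have key : ∀ i : Fin n, ∀ e e' : Fin n ⊕ Fin n →₀ ℕ, ∀ m : ℕ,
      (∀ j, j ≠ i → e (Sum.inl j) = e' (Sum.inl j) ∧ e (Sum.inr j) = e' (Sum.inr j)) →
      ((if e (Sum.inl i) = e (Sum.inr i) then (e (Sum.inl i)).factorial else 0) =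
        m * if e' (Sum.inl i) = e' (Sum.inr i) then (e' (Sum.inl i)).factorial else 0) →
      gaussWeight e = m * gaussWeight e' := by
    intro i e e' m h1 h2
    rw [gaussWeight, gaussWeight, ← Finset.mul_prod_erase _ _ (Finset.mem_univ i),
      ← Finset.mul_prod_erase _ _ (Finset.mem_univ i), h2, mul_assoc]
    congr 2
    refine Finset.prod_congr rfl fun j hj => ?_
    rw [(h1 j (Finset.ne_of_mem_erase hj)).1, (h1 j (Finset.ne_of_mem_erase hj)).2]
  rcases s with i | i
  · refine key i _ _ _ (fun j hj => by simp [Ne.symm hj]) ?_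
    simp only [Finsupp.add_apply, Finsupp.single_apply, Sum.swap_inl, Finsupp.tsub_apply]
    rcases hd : d (Sum.inr i) with _ | m
    · simp
    · by_cases h : d (Sum.inl i) = m
      · simp [h, add_comm 1 m, Nat.factorial_succ]
      · have h' : 1 + d (Sum.inl i) ≠ m + 1 := by omega
        simp [h, h']
  · refine key i _ _ _ (fun j hj => by simp [Ne.symm hj]) ?_
    simp only [Finsupp.add_apply, Finsupp.single_apply, Sum.swap_inr, Finsupp.tsub_apply]
    rcases hd : d (Sum.inl i) with _ | m
    · have h' : 0 ≠ 1 + d (Sum.inr i) := by omega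
      simp [h']
    · by_cases h : m = d (Sum.inr i)
      · simp [← h, add_comm 1 m, Nat.factorial_succ]
      · have h' : m + 1 ≠ 1 + d (Sum.inr i) := by omega
        simp [h, h']

/-- Integration by parts: under the Gaussian functional, multiplication by a coordinate amounts to
differentiation along the dual coordinate. -/
lemma gauss_X_mul (s : Fin n ⊕ Fin n) (F : Poly k n) :
    gauss k n (X s * F) = gauss k n (pderiv s.swap F) := by
  induction F using MvPolynomial.induction_on' with
  | add p q hp hq => rw [mul_add, map_add, map_add, map_add, hp, hq]
  | monomial d c =>
    rw [pderiv_monomial, gauss_monomial, X, monomial_mul, gauss_monomial, one_mul,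
      gaussWeight_add_single, Nat.cast_mul, mul_assoc]

/-- Integration by parts determines the Gaussian functional up to its value at `1`. -/
lemma eq_gauss (L : Poly k n →ₗ[k] k) (h1 : L 1 = 1)
    (hL : ∀ s F, L (X s * F) = L (pderiv s.swap F)) : L = gauss k n := by
  have key : ∀ (m : ℕ) (d : Fin n ⊕ Fin n →₀ ℕ), d.degree = m → ∀ c : k,
      L (monomial d c) = gauss k n (monomial d c) := by
    intro m
    induction m using Nat.strong_induction_on with
    | _ m ih =>
      intro d hd c
      by_cases hd0 : d = 0
      · have h : monomial d c = c • (1 : Poly k n) := by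
          rw [hd0, ← C_apply, smul_eq_C_mul, mul_one]
        rw [h, map_smul, map_smul, h1, gauss_one]
      · obtain ⟨s, hs⟩ : ∃ s, d s ≠ 0 := by
          by_contra! h
          exact hd0 (Finsupp.ext h)
        have hle : Finsupp.single s 1 ≤ d := by
          rw [Finsupp.single_le_iff]; omega
        have hds : Finsupp.single s 1 + (d - Finsupp.single s 1) = d := add_tsub_cancel_of_le hle
        have hdeg := congrArg Finsupp.degree hds
        rw [map_add, Finsupp.degree_single, hd] at hdeg
        have h : monomial d c = X s * monomial (d - Finsupp.single s 1) c := by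
          rw [X, monomial_mul, one_mul, hds]
        rw [h, hL, gauss_X_mul, pderiv_monomial]
        refine ih _ ?_ _ rfl _
        have h2 : Finsupp.degree (d - Finsupp.single s 1 - Finsupp.single s.swap 1) ≤
            Finsupp.degree (d - Finsupp.single s 1) := Finsupp.degree_mono tsub_le_self
        omega
  refine LinearMap.ext fun P => ?_
  induction P using MvPolynomial.induction_on' with
  | add p q hp hq => rw [map_add, map_add, hp, hq]
  | monomial d c => exact key _ d rfl c

lemma actPoly_X_inl (g : GL (Fin n) k) (j : Fin n) :
    actPoly g (X (Sum.inl j)) = ∑ i, g.1 i j • (X (Sum.inl i) : Poly k n) := by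
  simp [actPoly, smul_eq_C_mul]

lemma actPoly_X_inr (g : GL (Fin n) k) (j : Fin n) :
    actPoly g (X (Sum.inr j)) = ∑ i, (g⁻¹).1 j i • (X (Sum.inr i) : Poly k n) := by
  simp [actPoly, smul_eq_C_mul]

/-- The chain rule for a linear substitution, whose linear forms have the partial derivatives `c`.
-/
lemma pderiv_algHom (φ : Poly k n →ₐ[k] Poly k n) (s : Fin n ⊕ Fin n)
    (c : Fin n ⊕ Fin n → k) (hφ : ∀ r, pderiv s (φ (X r)) = C (c r)) (F : Poly k n) :
    pderiv s (φ F) = ∑ r, c r • φ (pderiv r F) := by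
  classical
  induction F using MvPolynomial.induction_on with
  | C a => simp [MvPolynomial.algHom_C, algebraMap_eq]
  | add p q hp hq => simp [hp, hq, Finset.sum_add_distrib]
  | mul_X p r hp =>
    have h : ∀ l, c l • φ (pderiv l (p * X r)) =
        c l • φ (pderiv l p) * φ (X r) + if l = r then c r • φ p else 0 := by
      intro l
      rw [pderiv_mul, map_add, map_mul, smul_add, smul_mul_assoc]
      congr 1
      by_cases hl : l = r
      · subst hl; simp
      · simp [hl, pderiv_X_of_ne (Ne.symm hl)]
    rw [map_mul, pderiv_mul, hp, hφ, Finset.sum_congr rfl fun l _ => h l, Finset.sum_add_distrib,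
      Finset.sum_mul, Finset.sum_ite_eq', if_pos (Finset.mem_univ r), smul_eq_C_mul, mul_comm (φ p)]

lemma pderiv_inl_actPoly (g : GL (Fin n) k) (i : Fin n) (F : Poly k n) :
    pderiv (Sum.inl i) (actPoly g F) =
      ∑ l, g.1 i l • actPoly g (pderiv (Sum.inl l) F) := by
  classical
  rw [pderiv_algHom (actPoly g) (Sum.inl i) (Sum.elim (fun l => g.1 i l) fun _ => 0)]
  · simp
  · rintro (j | j)
    · simp only [actPoly_X_inl, map_sum, Derivation.map_smul, pderiv_X]
      simp [Pi.single_apply, smul_eq_C_mul]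
    · simp only [actPoly_X_inr, map_sum, Derivation.map_smul, pderiv_X]
      simp

lemma pderiv_inr_actPoly (g : GL (Fin n) k) (i : Fin n) (F : Poly k n) :
    pderiv (Sum.inr i) (actPoly g F) =
      ∑ l, (g⁻¹).1 l i • actPoly g (pderiv (Sum.inr l) F) := by
  classical
  rw [pderiv_algHom (actPoly g) (Sum.inr i) (Sum.elim (fun _ => 0) fun l => (g⁻¹).1 l i)]
  · simp
  · rintro (j | j)
    · simp only [actPoly_X_inl, map_sum, Derivation.map_smul, pderiv_X]
      simp
    · simp only [actPoly_X_inr, map_sum, Derivation.map_smul, pderiv_X]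
      simp [Pi.single_apply, smul_eq_C_mul]

lemma sum_mul_inv_apply (g : GL (Fin n) k) (i j : Fin n) :
    ∑ l, g.1 i l * (g⁻¹).1 l j = if i = j then 1 else 0 := by
  rw [← Matrix.mul_apply, show g.1 * (g⁻¹).1 = 1 from Units.mul_inv g, Matrix.one_apply]

lemma sum_inv_mul_apply (g : GL (Fin n) k) (i j : Fin n) :
    ∑ l, (g⁻¹).1 i l * g.1 l j = if i = j then 1 else 0 := by
  rw [← Matrix.mul_apply, show (g⁻¹).1 * g.1 = 1 from Units.inv_mul g, Matrix.one_apply]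

lemma gauss_actPoly (g : GL (Fin n) k) (F : Poly k n) :
    gauss k n (actPoly g F) = gauss k n F := by
  have h := eq_gauss (gauss k n ∘ₗ (actPoly g).toLinearMap) (by simp [gauss_one]) ?_
  · exact LinearMap.congr_fun h F
  intro s F
  rcases s with j | j
  · simp only [LinearMap.comp_apply, AlgHom.toLinearMap_apply, map_mul, Sum.swap_inl,
      actPoly_X_inl, Finset.sum_mul, map_sum, smul_mul_assoc, map_smul, gauss_X_mul,
      pderiv_inr_actPoly, Finset.smul_sum]
    rw [Finset.sum_comm]
    simp only [← mul_smul, ← Finset.sum_smul, mul_comm (g.1 _ j), sum_inv_mul_apply, ite_smul,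
      one_smul, zero_smul, Finset.sum_ite_eq', Finset.mem_univ, if_true]
  · simp only [LinearMap.comp_apply, AlgHom.toLinearMap_apply, map_mul, Sum.swap_inr,
      actPoly_X_inr, Finset.sum_mul, map_sum, smul_mul_assoc, map_smul, gauss_X_mul,
      pderiv_inl_actPoly, Finset.smul_sum]
    rw [Finset.sum_comm]
    simp only [← mul_smul, ← Finset.sum_smul, sum_inv_mul_apply, ite_smul,
      one_smul, zero_smul, Finset.sum_ite_eq, Finset.mem_univ, if_true]

/-- The radical of the pairing `(P, Q) ↦ ⟨P Q⟩` is stable under all derivatives, by integration by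
parts; in characteristic zero, a nonzero element of it would have a nonzero constant among its
iterated derivatives, but `⟨1⟩ = 1`. -/
lemma exists_gauss_mul_ne_zero [CharZero k] {P : Poly k n} (hP : P ≠ 0) :
    ∃ Q, gauss k n (P * Q) ≠ 0 := by
  by_contra! h
  have key : ∀ (m : ℕ) (d : Fin n ⊕ Fin n →₀ ℕ), d.degree = m →
      ∀ P : Poly k n, (∀ Q, gauss k n (P * Q) = 0) → (∀ d', m < d'.degree → P.coeff d' = 0) →
        P.coeff d = 0 := by
    intro m
    induction m with
    | zero =>
      intro d hd P hP hdeg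
      have hC : P = C (P.coeff 0) := by
        ext d'
        rw [coeff_C]
        split_ifs with h0
        · rw [h0]
        · refine hdeg d' (Nat.pos_of_ne_zero fun h1 => h0 ?_)
          exact ((Finsupp.degree_eq_zero_iff d').1 h1).symm
      have h1 := hP 1
      rw [hC, mul_one, ← mul_one (C _), ← smul_eq_C_mul, map_smul, gauss_one, smul_eq_mul,
        mul_one] at h1
      rw [(Finsupp.degree_eq_zero_iff d).1 hd, h1]
    | succ m ih =>
      intro d hd P hP hdeg
      obtain ⟨s, hs⟩ : ∃ s, d s ≠ 0 := by
        by_contra! h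
        rw [(Finsupp.ext h : d = 0)] at hd
        simp at hd
      have hle : Finsupp.single s 1 ≤ d := by
        rw [Finsupp.single_le_iff]; omega
      have hds : d - Finsupp.single s 1 + Finsupp.single s 1 = d := tsub_add_cancel_of_le hle
      have hdg := congrArg Finsupp.degree hds
      rw [map_add, Finsupp.degree_single, hd] at hdg
      have h1 := ih (d - Finsupp.single s 1) (by omega) (pderiv s P) (fun Q => ?_)
        (fun d' hd' => ?_)
      · rw [coeff_pderiv, hds] at h1
        exact (mul_eq_zero.1 h1).resolve_right (Nat.cast_add_one_ne_zero _)
      · have h2 := gauss_X_mul s.swap (P * Q)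
        rw [Sum.swap_swap, pderiv_mul, map_add, hP, add_zero, mul_left_comm, hP] at h2
        exact h2.symm
      · rw [coeff_pderiv, hdeg, zero_mul]
        rw [map_add, Finsupp.degree_single]
        omega
  -- the coefficients vanish in descending order of their degree
  have key2 : ∀ (m : ℕ) (d : Fin n ⊕ Fin n →₀ ℕ), P.totalDegree < d.degree + m →
      P.coeff d = 0 := by
    intro m
    induction m with
    | zero => exact fun d hd => coeff_eq_zero_of_totalDegree_lt hd
    | succ m ih => exact fun d hd => key _ d rfl P h fun d' hd' => ih d' (by omega)
  refine hP (MvPolynomial.ext _ _ fun d => ?_)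
  rw [coeff_zero]
  exact key2 (P.totalDegree + 1) d (by omega)

end Gauss

/-! ### The invariant functional on functions -/

section FunResidue

open MvPolynomial

variable {k : Type*} [Field k] {n : ℕ}

lemma exists_mul_zzs_pow (f : Fun k n) : ∃ (N : ℕ) (P : Poly k n),
    f * algebraMap (Poly k n) (Fun k n) (zzs k n) ^ N = algebraMap (Poly k n) (Fun k n) P :=
  IsLocalization.Away.surj (zzs k n) f

variable (k n) in
/-- The functional `P ↦ ((n-1)! / (N+n-1)!) ⟨P_N⟩` on polynomials, with `P_N` the component of
degree `N` in the `z*`; it describes the invariant functional on the functions `P / (zz*)^N`. -/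
def sphere (N : ℕ) : Poly k n →ₗ[k] k :=
  (basisMonomials (Fin n ⊕ Fin n) k).constr k fun d =>
    if Finsupp.weight (wt n) d = N then (∏ j ∈ Finset.range N, ((n + j : ℕ) : k)⁻¹) * gaussWeight d
    else 0

lemma sphere_monomial (N : ℕ) (d : Fin n ⊕ Fin n →₀ ℕ) (c : k) :
    sphere k n N (monomial d c) = if Finsupp.weight (wt n) d = N then
      (∏ j ∈ Finset.range N, ((n + j : ℕ) : k)⁻¹) * gauss k n (monomial d c) else 0 := by
  have h : monomial d c = c • basisMonomials (Fin n ⊕ Fin n) k d := by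
    simp [smul_monomial]
  rw [gauss_monomial, h, map_smul, sphere, Module.Basis.constr_basis, smul_eq_mul]
  split_ifs
  · ring
  · simp

lemma sphere_of_isWeightedHomogeneous (N : ℕ) {M : ℕ} {P : Poly k n}
    (hP : IsWeightedHomogeneous (wt n) P M) : sphere k n N P = if M = N then
      (∏ j ∈ Finset.range N, ((n + j : ℕ) : k)⁻¹) * gauss k n P else 0 := by
  rw [P.as_sum, map_sum, map_sum, Finset.mul_sum]
  have h : ∀ d ∈ P.support, sphere k n N (monomial d (coeff d P)) = if M = N then
      (∏ j ∈ Finset.range N, ((n + j : ℕ) : k)⁻¹) * gauss k n (monomial d (coeff d P)) else 0 := by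
    intro d hd
    rw [sphere_monomial, hP (mem_support_iff.1 hd)]
  rw [Finset.sum_congr rfl h]
  split_ifs <;> simp

lemma gauss_zzs_mul_monomial (d : Fin n ⊕ Fin n →₀ ℕ) (c : k) :
    gauss k n (zzs k n * monomial d c) =
      ((n + Finsupp.weight (wt n) d : ℕ) : k) * gauss k n (monomial d c) := by
  have h : ∀ i : Fin n, gauss k n (X (Sum.inl i) * X (Sum.inr i) * monomial d c) =
      ((1 + d (Sum.inr i) : ℕ) : k) * gauss k n (monomial d c) := by
    intro i
    rw [mul_assoc, gauss_X_mul, Sum.swap_inl, pderiv_mul, pderiv_X_self, one_mul,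
      X_mul_pderiv_monomial, map_add, map_nsmul, nsmul_eq_mul]
    push_cast
    ring
  rw [zzs, Finset.sum_mul, map_sum, Finset.sum_congr rfl fun i _ => h i, ← Finset.sum_mul,
    ← Nat.cast_sum, Finset.sum_add_distrib]
  simp [Finsupp.weight_apply, Finsupp.sum_fintype, wt]

lemma sphere_actPoly (N : ℕ) (g : GL (Fin n) k) (P : Poly k n) :
    sphere k n N (actPoly g P) = sphere k n N P := by
  induction P using MvPolynomial.induction_on' with
  | add p q hp hq => rw [map_add, map_add, map_add, hp, hq]
  | monomial d c =>
    have h := isWeightedHomogeneous_monomial (wt n) d c rfl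
    rw [sphere_of_isWeightedHomogeneous _ h,
      sphere_of_isWeightedHomogeneous _ (actPoly_homogeneous g h), gauss_actPoly]

variable [CharZero k] [NeZero n]

lemma zzs_ne_zero : zzs k n ≠ 0 := by
  intro h
  have h1 := congrArg (MvPolynomial.eval (Pi.single (Sum.inl 0) 1 + Pi.single (Sum.inr 0) 1)) h
  rw [zzs, map_sum, map_zero, Finset.sum_eq_single 0] at h1
  · simp at h1
  · intro i _ hi
    simp [hi]
  · simp

lemma algebraMap_injective : Function.Injective (algebraMap (Poly k n) (Fun k n)) :=
  IsLocalization.injective _ (powers_le_nonZeroDivisors_of_noZeroDivisors zzs_ne_zero)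

instance : IsDomain (Fun k n) :=
  IsLocalization.isDomain_of_le_nonZeroDivisors (M := Submonoid.powers (zzs k n)) _
    (powers_le_nonZeroDivisors_of_noZeroDivisors zzs_ne_zero)

lemma sphere_zzs_mul (N : ℕ) (P : Poly k n) :
    sphere k n (N + 1) (zzs k n * P) = sphere k n N P := by
  induction P using MvPolynomial.induction_on' with
  | add p q hp hq => rw [mul_add, map_add, map_add, hp, hq]
  | monomial d c =>
    have h1 : IsWeightedHomogeneous (wt n) (zzs k n * monomial d c)
        (1 + Finsupp.weight (wt n) d) :=
      (zzs_homogeneous k n).mul (isWeightedHomogeneous_monomial _ _ _ rfl)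
    rw [sphere_of_isWeightedHomogeneous _ h1, sphere_monomial, add_comm 1, gauss_zzs_mul_monomial]
    by_cases h : Finsupp.weight (wt n) d = N
    · rw [if_pos (by rw [h]), if_pos h, Finset.prod_range_succ, h, mul_assoc, inv_mul_cancel_left₀]
      have := NeZero.ne n
      exact_mod_cast (by omega : n + N ≠ 0)
    · rw [if_neg (by omega), if_neg h]

lemma sphere_zzs_pow_mul (N M : ℕ) (P : Poly k n) :
    sphere k n (N + M) (zzs k n ^ M * P) = sphere k n N P := by
  induction M with
  | zero => simp
  | succ M ih => rw [pow_succ', mul_assoc, ← add_assoc, sphere_zzs_mul, ih]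

lemma sphere_eq_of_mul_zzs_pow {f : Fun k n} {N M : ℕ} {P Q : Poly k n}
    (hP : f * algebraMap (Poly k n) (Fun k n) (zzs k n) ^ N = algebraMap (Poly k n) (Fun k n) P)
    (hQ : f * algebraMap (Poly k n) (Fun k n) (zzs k n) ^ M = algebraMap (Poly k n) (Fun k n) Q) :
    sphere k n N P = sphere k n M Q := by
  have h : zzs k n ^ M * P = zzs k n ^ N * Q := by
    apply algebraMap_injective
    rw [map_mul, map_mul, ← hP, ← hQ, map_pow, map_pow]
    ring
  rw [← sphere_zzs_pow_mul N M, h, add_comm N M, sphere_zzs_pow_mul]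

variable (k n) in
/-- The invariant functional on functions on `U`, which takes `P / (zz*)^N` to `((n-1)! / (N+n-1)!)
⟨P_N⟩`. For `k = ℂ` it is the mean value over the unit sphere `z* = z̄`, `|z| = 1` of the part of
degree `0` in the `z*`. -/
def funRes : Fun k n →ₗ[k] k where
  toFun f := sphere k n (exists_mul_zzs_pow f).choose (exists_mul_zzs_pow f).choose_spec.choose
  map_add' f g := by
    have hf := (exists_mul_zzs_pow f).choose_spec.choose_spec
    have hg := (exists_mul_zzs_pow g).choose_spec.choose_spec
    set N := (exists_mul_zzs_pow f).choose
    set M := (exists_mul_zzs_pow g).choose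
    rw [← sphere_zzs_pow_mul N M, ← sphere_zzs_pow_mul M N, add_comm M N, ← map_add]
    refine sphere_eq_of_mul_zzs_pow (exists_mul_zzs_pow (f + g)).choose_spec.choose_spec ?_
    rw [map_add, map_mul, map_mul, ← hf, ← hg, map_pow, map_pow]
    ring
  map_smul' c f := by
    have hf := (exists_mul_zzs_pow f).choose_spec.choose_spec
    rw [RingHom.id_apply, ← map_smul]
    refine sphere_eq_of_mul_zzs_pow (exists_mul_zzs_pow (c • f)).choose_spec.choose_spec
      (M := (exists_mul_zzs_pow f).choose) ?_
    rw [smul_mul_assoc]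
    exact (congrArg (c • ·) hf).trans
      (map_smul (IsScalarTower.toAlgHom k (Poly k n) (Fun k n)) c _).symm

lemma funRes_eq {f : Fun k n} {N : ℕ} {P : Poly k n}
    (h : f * algebraMap (Poly k n) (Fun k n) (zzs k n) ^ N = algebraMap (Poly k n) (Fun k n) P) :
    funRes k n f = sphere k n N P :=
  sphere_eq_of_mul_zzs_pow (exists_mul_zzs_pow f).choose_spec.choose_spec h

lemma funRes_one : funRes k n 1 = 1 := by
  rw [funRes_eq (N := 0) (P := 1) (by simp),
    sphere_of_isWeightedHomogeneous 0 (isWeightedHomogeneous_one k _)]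
  simp [gauss_one]

lemma funRes_actFun (g : GL (Fin n) k) (f : Fun k n) :
    funRes k n (actFun g f) = funRes k n f := by
  obtain ⟨N, P, h⟩ := exists_mul_zzs_pow f
  have h' := congrArg (actFun g) h
  rw [map_mul, map_pow, actFun_algebraMap, actFun_algebraMap, actPoly_zzs] at h'
  rw [funRes_eq h, funRes_eq h', sphere_actPoly]

/-- The pairing `(f, g) ↦ funRes (f g)` on functions of degree zero in the `z*` is nondegenerate. -/
lemma exists_funRes_mul_ne_zero {f : Fun k n} (hf : f ∈ homFun k n 0) (h0 : f ≠ 0) :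
    ∃ g ∈ homFun k n 0, funRes k n (g * f) ≠ 0 := by
  obtain ⟨N, P, hP, h⟩ := hf
  rw [add_zero] at h
  have hP0 : P ≠ 0 := by
    rintro rfl
    rw [map_zero] at h
    refine (mul_ne_zero h0 (pow_ne_zero _ ?_)) h
    rw [Ne, ← map_zero (algebraMap (Poly k n) (Fun k n)), algebraMap_injective.eq_iff]
    exact zzs_ne_zero
  obtain ⟨Q, hQ⟩ := exists_gauss_mul_ne_zero hP0
  obtain ⟨d, hd⟩ : ∃ d, gauss k n (P * monomial d (coeff d Q)) ≠ 0 := by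
    by_contra! hd
    apply hQ
    rw [Q.as_sum, Finset.mul_sum, map_sum]
    exact Finset.sum_eq_zero fun d _ => hd d
  have hm := isWeightedHomogeneous_monomial (wt n) d (coeff d Q) rfl
  set M := Finsupp.weight (wt n) d
  have hz : algebraMap (Poly k n) (Fun k n) (zzs k n) * invzzs k n = 1 :=
    IsLocalization.Away.mul_invSelf (zzs k n)
  have hg : algebraMap (Poly k n) (Fun k n) (monomial d (coeff d Q)) * invzzs k n ^ M *
      algebraMap (Poly k n) (Fun k n) (zzs k n) ^ M =
      algebraMap (Poly k n) (Fun k n) (monomial d (coeff d Q)) := by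
    rw [mul_assoc, ← mul_pow, mul_comm (invzzs k n), hz, one_pow, mul_one]
  refine ⟨algebraMap _ _ (monomial d (coeff d Q)) * invzzs k n ^ M, ⟨M, _, hm, hg⟩, ?_⟩
  rw [funRes_eq (N := N + M) (P := P * monomial d (coeff d Q)),
    sphere_of_isWeightedHomogeneous _ (hP.mul hm), if_pos rfl]
  · refine mul_ne_zero (Finset.prod_ne_zero_iff.2 fun j _ => inv_ne_zero ?_) hd
    have := NeZero.ne n
    exact_mod_cast (by omega : n + j ≠ 0)
  · calc _ = f * algebraMap (Poly k n) (Fun k n) (zzs k n) ^ N *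
          (algebraMap (Poly k n) (Fun k n) (monomial d (coeff d Q)) * invzzs k n ^ M *
            algebraMap (Poly k n) (Fun k n) (zzs k n) ^ M) := by rw [pow_add]; ring
      _ = _ := by rw [hg, h, map_mul]

end FunResidue

/-! ### The top coefficient of constant forms -/

section TopCoeff

variable (k : Type*) [Field k] (n : ℕ)

/-- The basis `dz_1*, …, dz_n*, dz_1, …, dz_n` of the space of constant one-forms. -/
def covBasis : Module.Basis (Fin (n + n)) k (Cov k n) :=
  ((Pi.basisFun k (Fin n)).prod (Pi.basisFun k (Fin n))).reindex
    ((Equiv.sumComm _ _).trans finSumFinEquiv)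

/-- The form `dz_1* ∧ ⋯ ∧ dz_n* ∧ dz_1 ∧ ⋯ ∧ dz_n`. -/
def topForm : ExteriorAlgebra k (Cov k n) :=
  ((List.finRange n).map (dzs k n)).prod * ((List.finRange n).map (dz k n)).prod

/-- The coefficient of `topForm` in a constant form, as a linear functional (the Berezin integral).
-/
def topCoeff : ExteriorAlgebra k (Cov k n) →ₗ[k] k :=
  ExteriorAlgebra.liftAlternating (Pi.single (n + n) (covBasis k n).det)

variable {k n}

lemma covBasis_castAdd (i : Fin n) : covBasis k n (Fin.castAdd n i) = (0, Pi.single i 1) := by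
  simp [covBasis]

lemma covBasis_natAdd (i : Fin n) : covBasis k n (Fin.natAdd n i) = (Pi.single i 1, 0) := by
  simp [covBasis, -Fin.natAdd_eq_addNat]

lemma ιMulti_covBasis : ExteriorAlgebra.ιMulti k (n + n) (covBasis k n) = topForm k n := by
  rw [ExteriorAlgebra.ιMulti_apply, List.ofFn_add, List.prod_append, topForm, List.ofFn_eq_map,
    List.ofFn_eq_map]
  have h1 : ∀ i, ExteriorAlgebra.ι k (covBasis k n (Fin.castLE (Nat.le_add_right n n) i)) =
    dzs k n i := fun i => congrArg _ (covBasis_castAdd i)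
  simp only [h1, covBasis_natAdd]
  rfl

lemma topCoeff_ιMulti (v : Fin (n + n) → Cov k n) :
    topCoeff k n (ExteriorAlgebra.ιMulti k (n + n) v) = (covBasis k n).det v := by
  rw [topCoeff, ExteriorAlgebra.liftAlternating_apply_ιMulti, Pi.single_eq_same]

lemma topCoeff_ιMulti_of_ne {m : ℕ} (hm : m ≠ n + n) (v : Fin m → Cov k n) :
    topCoeff k n (ExteriorAlgebra.ιMulti k m v) = 0 := by
  rw [topCoeff, ExteriorAlgebra.liftAlternating_apply_ιMulti, Pi.single_eq_of_ne hm]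
  rfl

lemma topCoeff_topForm : topCoeff k n (topForm k n) = 1 := by
  rw [← ιMulti_covBasis, topCoeff_ιMulti, Module.Basis.det_self]

lemma topCoeff_map (f : Cov k n →ₗ[k] Cov k n) (x : ExteriorAlgebra k (Cov k n)) :
    topCoeff k n (ExteriorAlgebra.map f x) = LinearMap.det f * topCoeff k n x := by
  have h : topCoeff k n ∘ₗ (ExteriorAlgebra.map f).toLinearMap =
      LinearMap.det f • topCoeff k n := by
    refine ExteriorAlgebra.lhom_ext fun m => AlternatingMap.ext fun v => ?_
    simp only [LinearMap.compAlternatingMap_apply, LinearMap.comp_apply,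
      AlgHom.toLinearMap_apply, ExteriorAlgebra.map_apply_ιMulti, LinearMap.smul_apply, smul_eq_mul]
    by_cases hm : m = n + n
    · subst hm
      rw [topCoeff_ιMulti, topCoeff_ιMulti, Module.Basis.det_comp]
    · rw [topCoeff_ιMulti_of_ne hm, topCoeff_ιMulti_of_ne hm, mul_zero]
  exact LinearMap.congr_fun h x

lemma topCoeff_map_actCov (g : GL (Fin n) k) (x : ExteriorAlgebra k (Cov k n)) :
    topCoeff k n (ExteriorAlgebra.map (actCov g) x) = topCoeff k n x := by
  rw [topCoeff_map, actCov, LinearMap.det_prodMap]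
  have h1 : LinearMap.det (Matrix.mulVecLin g.1) = g.1.det := LinearMap.det_toLin' _
  have h2 : LinearMap.det (Matrix.mulVecLin (g⁻¹).1.transpose) = (g⁻¹).1.det :=
    (LinearMap.det_toLin' _).trans (Matrix.det_transpose _)
  rw [h1, h2, ← Matrix.det_mul, show g.1 * (g⁻¹).1 = 1 from Units.mul_inv g, Matrix.det_one,
    one_mul]

lemma topCoeff_basis_of_ne {s : Finset (Fin (n + n))} (hs : s ≠ Finset.univ) :
    topCoeff k n ((covBasis k n).ExteriorAlgebra s) = 0 := by
  rw [ExteriorAlgebra.basis_apply]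
  exact topCoeff_ιMulti_of_ne (fun h => hs ((Finset.card_eq_iff_eq_univ s).1 (by simpa using h))) _

lemma topCoeff_basis_univ :
    topCoeff k n ((covBasis k n).ExteriorAlgebra Finset.univ) ≠ 0 := by
  intro h
  have h0 : topCoeff k n = 0 := by
    refine (covBasis k n).ExteriorAlgebra.ext fun s => ?_
    by_cases hs : s = Finset.univ
    · rw [hs, h]; rfl
    · rw [topCoeff_basis_of_ne hs]; rfl
  have h1 := topCoeff_topForm (k := k) (n := n)
  rw [h0] at h1
  exact zero_ne_one h1

lemma topCoeff_basis_mul (u v : Finset (Fin (n + n))) :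
    topCoeff k n ((covBasis k n).ExteriorAlgebra u * (covBasis k n).ExteriorAlgebra v) ≠ 0 ↔
      v = uᶜ := by
  have hu : u ∈ Set.powersetCard (Fin (n + n)) u.card := rfl
  have hv : v ∈ Set.powersetCard (Fin (n + n)) v.card := rfl
  by_cases hd : Disjoint u v
  · obtain ⟨ε, hε⟩ : ∃ ε : ℤˣ, (covBasis k n).ExteriorAlgebra u * (covBasis k n).ExteriorAlgebra v =
        ε • (covBasis k n).ExteriorAlgebra (u.disjUnion v hd) :=
      ⟨_, ExteriorAlgebra.basis_mul_of_disjoint (covBasis k n) ⟨u, hu⟩ ⟨v, hv⟩ hd⟩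
    have h1 : topCoeff k n
        ((covBasis k n).ExteriorAlgebra u * (covBasis k n).ExteriorAlgebra v) ≠ 0 ↔
        topCoeff k n ((covBasis k n).ExteriorAlgebra (u.disjUnion v hd)) ≠ 0 := by
      rw [hε]
      rcases Int.units_eq_one_or ε with rfl | rfl
      · rw [one_smul]
      · rw [Units.neg_smul, one_smul, map_neg, neg_ne_zero]
    have h2 : v = uᶜ ↔ u.disjUnion v hd = Finset.univ := by
      rw [Finset.disjUnion_eq_union, eq_comm (a := v)]
      constructor
      · rintro rfl; exact Finset.union_compl u
      · exact fun h => (IsCompl.compl_eq ⟨hd, codisjoint_iff.2 h⟩)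
    rw [h1, h2]
    refine ⟨fun h => ?_, fun h => h ▸ topCoeff_basis_univ⟩
    by_contra hne
    exact h (topCoeff_basis_of_ne hne)
  · rw [ExteriorAlgebra.basis_mul_of_not_disjoint (covBasis k n) ⟨u, hu⟩ ⟨v, hv⟩ hd, map_zero]
    refine ⟨fun h => (h rfl).elim, ?_⟩
    rintro rfl
    exact (hd disjoint_compl_right).elim

/-- The pairing `(x, y) ↦ topCoeff (x y)` on constant forms is nondegenerate: complementary basis
monomials have nonzero product. -/
lemma exists_topCoeff_mul_ne_zero {x : ExteriorAlgebra k (Cov k n)} (hx : x ≠ 0) :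
    (∃ y, topCoeff k n (x * y) ≠ 0) ∧ ∃ y, topCoeff k n (y * x) ≠ 0 := by
  set b := (covBasis k n).ExteriorAlgebra with hb
  obtain ⟨s, hs⟩ : ∃ s, b.repr x s ≠ 0 := by
    by_contra! h
    exact hx (b.ext_elem_iff.2 fun s => by rw [h, map_zero]; rfl)
  refine ⟨⟨b sᶜ, ?_⟩, b sᶜ, ?_⟩
  · rw [← b.sum_repr x, Finset.sum_mul, map_sum, Finset.sum_eq_single s]
    · rw [smul_mul_assoc, map_smul]
      exact smul_ne_zero hs ((topCoeff_basis_mul s sᶜ).2 rfl)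
    · intro u _ hu
      have h := not_ne_iff.1 (mt (topCoeff_basis_mul (k := k) u sᶜ).1 fun h =>
        hu (compl_injective h).symm)
      rw [smul_mul_assoc, map_smul, hb, h, smul_zero]
    · simp
  · rw [← b.sum_repr x, Finset.mul_sum, map_sum, Finset.sum_eq_single s]
    · rw [mul_smul_comm, map_smul]
      exact smul_ne_zero hs ((topCoeff_basis_mul sᶜ s).2 (compl_compl s).symm)
    · intro u _ hu
      have h := not_ne_iff.1 (mt (topCoeff_basis_mul (k := k) sᶜ u).1 fun h =>
        hu (h.trans (compl_compl s)))
      rw [mul_smul_comm, map_smul, hb, h, smul_zero]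
    · simp

lemma map_eq_smul_of_mem_extPart (a b : k) {p q : ℕ} {x : ExteriorAlgebra k (Cov k n)}
    (hx : x ∈ extPart k n p q) :
    ExteriorAlgebra.map (LinearMap.prodMap (a • LinearMap.id) (b • LinearMap.id)) x =
      (a ^ p * b ^ q) • x := by
  set φ : ExteriorAlgebra k (Cov k n) →ₐ[k] ExteriorAlgebra k (Cov k n) :=
    ExteriorAlgebra.map (LinearMap.prodMap (a • LinearMap.id) (b • LinearMap.id))
  have hpow : ∀ (S : Submodule k (ExteriorAlgebra k (Cov k n))) (c : k) (m : ℕ),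
      (∀ x ∈ S, φ x = c • x) → ∀ x ∈ S ^ m, φ x = c ^ m • x := by
    intro S c m hS
    induction m with
    | zero =>
      intro x hx
      obtain ⟨r, rfl⟩ := Submodule.mem_one.1 (by simpa using hx)
      simp
    | succ m ih =>
      intro x hx
      rw [pow_succ] at hx
      induction hx using Submodule.mul_induction_on' with
      | mem_mul_mem y hy z hz =>
        rw [map_mul, ih y hy, hS z hz, smul_mul_smul_comm, pow_succ]
      | add y _ z _ hy hz => rw [map_add, hy, hz, smul_add]
  have h1 := hpow (spanDz k n) a p (by
    rintro _ ⟨v, rfl⟩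
    simp only [φ, LinearMap.comp_apply, ExteriorAlgebra.map_apply_ι, ← map_smul]
    simp)
  have h2 := hpow (spanDzs k n) b q (by
    rintro _ ⟨v, rfl⟩
    simp only [φ, LinearMap.comp_apply, ExteriorAlgebra.map_apply_ι, ← map_smul]
    simp)
  rw [extPart] at hx
  induction hx using Submodule.mul_induction_on' with
  | mem_mul_mem y hy z hz => rw [map_mul, h1 y hy, h2 z hz, smul_mul_smul_comm]
  | add y _ z _ hy hz => rw [map_add, hy, hz, smul_add]

/-- The top coefficient vanishes outside bidegree `(n, n)`, by homogeneity under the scalings of the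
`dz` and of the `dz*`. -/
lemma topCoeff_eq_zero [CharZero k] {p q : ℕ} (h : p ≠ n ∨ q ≠ n)
    {x : ExteriorAlgebra k (Cov k n)} (hx : x ∈ extPart k n p q) : topCoeff k n x = 0 := by
  have key : ∀ a b : k, a ^ p * b ^ q * topCoeff k n x = a ^ n * b ^ n * topCoeff k n x := by
    intro a b
    have h1 := topCoeff_map (LinearMap.prodMap (a • LinearMap.id) (b • LinearMap.id)) x
    rw [map_eq_smul_of_mem_extPart a b hx, map_smul, smul_eq_mul, LinearMap.det_prodMap] at h1
    simpa using h1
  have h2 : ∀ m : ℕ, m ≠ n → (2 : k) ^ m * topCoeff k n x = 2 ^ n * topCoeff k n x →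
      topCoeff k n x = 0 := by
    intro m hm h
    rw [mul_eq_mul_right_iff] at h
    refine h.resolve_left fun h => hm (Nat.pow_right_injective le_rfl ?_)
    exact_mod_cast h
  rcases h with h | h
  · exact h2 p h (by simpa using key 2 1)
  · exact h2 q h (by simpa using key 1 2)

lemma iSup_extPart : ⨆ r : ℕ × ℕ, extPart k n r.1 r.2 = ⊤ := by
  set S := ⨆ r : ℕ × ℕ, extPart k n r.1 r.2
  have hle : ∀ p q, extPart k n p q ≤ S := fun p q =>
    le_iSup (fun r : ℕ × ℕ => extPart k n r.1 r.2) (p, q)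
  refine eq_top_iff.2 fun x _ => ?_
  induction x using ExteriorAlgebra.induction with
  | algebraMap r =>
    refine hle 0 0 ?_
    rw [extPart, pow_zero, pow_zero, one_mul]
    exact Submodule.algebraMap_mem r
  | ι v =>
    have e : v = (v.1, 0) + (0, v.2) := by simp
    rw [e, map_add]
    refine S.add_mem (hle 1 0 ?_) (hle 0 1 ?_)
    · rw [extPart, pow_one, pow_zero, mul_one]
      exact ⟨v.1, rfl⟩
    · rw [extPart, pow_one, pow_zero, one_mul]
      exact ⟨v.2, rfl⟩
  | add x y hx hy => exact S.add_mem (hx trivial) (hy trivial)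
  | mul x y hx hy =>
    have h : S * S ≤ S := by
      rw [Submodule.iSup_mul]
      refine iSup_le fun r => ?_
      rw [Submodule.mul_iSup]
      refine iSup_le fun r' => ?_
      rw [extPart_mul]
      exact hle _ _
    exact h (Submodule.mul_mem_mul (hx trivial) (hy trivial))

lemma exists_mem_extPart {L : ExteriorAlgebra k (Cov k n) →ₗ[k] k} (hL : L ≠ 0) :
    ∃ p q, ∃ y ∈ extPart k n p q, L y ≠ 0 := by
  by_contra! h
  refine hL (LinearMap.ext fun y => ?_)
  have hle : (⊤ : Submodule k (ExteriorAlgebra k (Cov k n))) ≤ LinearMap.ker L := by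
    rw [← iSup_extPart]
    exact iSup_le fun r y hy => h _ _ y hy
  exact hle (Submodule.mem_top (x := y))

lemma exists_mem_extPart_topCoeff_mul_ne_zero {x : ExteriorAlgebra k (Cov k n)} (hx : x ≠ 0) :
    (∃ p q, ∃ y ∈ extPart k n p q, topCoeff k n (x * y) ≠ 0) ∧
      ∃ p q, ∃ y ∈ extPart k n p q, topCoeff k n (y * x) ≠ 0 := by
  obtain ⟨⟨y, hy⟩, y', hy'⟩ := exists_topCoeff_mul_ne_zero hx
  exact ⟨exists_mem_extPart (L := topCoeff k n ∘ₗ LinearMap.mulLeft k x)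
      fun h => hy (LinearMap.congr_fun h y),
    exists_mem_extPart (L := topCoeff k n ∘ₗ LinearMap.mulRight k x)
      fun h => hy' (LinearMap.congr_fun h y')⟩

lemma extPart_eq_bot [CharZero k] {p q : ℕ} (hq : n < q) : extPart k n p q = ⊥ := by
  refine (Submodule.eq_bot_iff _).2 fun x hx => ?_
  by_contra h0
  obtain ⟨⟨p', q', y, hy, h⟩, -⟩ := exists_mem_extPart_topCoeff_mul_ne_zero h0
  have hm := Submodule.mul_mem_mul hx hy
  rw [extPart_mul] at hm
  exact h (topCoeff_eq_zero (by omega) hm)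

lemma topForm_mem : topForm k n ∈ extPart k n n n := by
  have h1 := prod_dzs_mem (k := k) (List.finRange n)
  have h2 := prod_dz_mem (k := k) (List.finRange n)
  rw [List.length_finRange] at h1 h2
  have h := Submodule.mul_mem_mul h1 h2
  rwa [extPart_mul, zero_add, add_zero] at h

lemma eq_topCoeff_smul [CharZero k] {x : ExteriorAlgebra k (Cov k n)}
    (hx : x ∈ extPart k n n n) : x = topCoeff k n x • topForm k n := by
  by_contra hne
  obtain ⟨⟨p, q, y, hy, h⟩, -⟩ := exists_mem_extPart_topCoeff_mul_ne_zero (sub_ne_zero.2 hne)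
  have hx' := Submodule.sub_mem _ hx (Submodule.smul_mem _ (topCoeff k n x) topForm_mem)
  have hm := Submodule.mul_mem_mul hx' hy
  rw [extPart_mul] at hm
  by_cases hpq : p = 0 ∧ q = 0
  · obtain ⟨rfl, rfl⟩ := hpq
    rw [extPart, pow_zero, pow_zero, one_mul] at hy
    obtain ⟨r, rfl⟩ := Submodule.mem_one.1 hy
    apply h
    rw [← Algebra.commutes, ← Algebra.smul_def, map_smul, map_sub, map_smul, topCoeff_topForm]
    simp
  · exact h (topCoeff_eq_zero (by omega) hm)

end TopCoeff

/-! ### The residue and its pairing -/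

section Res

variable {k : Type*} [Field k] {n : ℕ}

variable (k n) in
/-- The function `zz*` on `U`. -/
def zzsFun : Fun k n := algebraMap (Poly k n) (Fun k n) (zzs k n)

lemma zzsFun_mul_invzzs : zzsFun k n * invzzs k n = 1 :=
  IsLocalization.Away.mul_invSelf (zzs k n)

lemma zzsFun_pow_mul_invzzs_pow (m : ℕ) : zzsFun k n ^ m * invzzs k n ^ m = 1 := by
  rw [← mul_pow, zzsFun_mul_invzzs, one_pow]

lemma actFun_zzsFun (g : GL (Fin n) k) : actFun g (zzsFun k n) = zzsFun k n := by
  rw [zzsFun, actFun_algebraMap, actPoly_zzs]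

lemma actFun_invzzs (g : GL (Fin n) k) : actFun g (invzzs k n) = invzzs k n := by
  have h := congrArg (actFun g) (zzsFun_mul_invzzs (k := k) (n := n))
  rw [map_mul, actFun_zzsFun, map_one] at h
  calc actFun g (invzzs k n) = zzsFun k n * invzzs k n * actFun g (invzzs k n) := by
        rw [zzsFun_mul_invzzs, one_mul]
    _ = invzzs k n * (zzsFun k n * actFun g (invzzs k n)) := by ring
    _ = invzzs k n := by rw [h, mul_one]

lemma invzzs_pow_mem (m : ℕ) : invzzs k n ^ m ∈ homFun k n m :=
  ⟨0, 1, MvPolynomial.isWeightedHomogeneous_one k _, by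
    rw [zero_add, mul_comm, map_one]; exact zzsFun_pow_mul_invzzs_pow m⟩

lemma zzsFun_pow_mul_mem {m : ℕ} {f : Fun k n} (hf : f ∈ homFun k n m) :
    zzsFun k n ^ m * f ∈ homFun k n 0 := by
  obtain ⟨N, P, hP, h⟩ := hf
  refine ⟨N, P, hP, ?_⟩
  rw [← h, zzsFun]
  ring

lemma zs_mul_mem {m : ℕ} {f : Fun k n} (hf : f ∈ homFun k n (m + 1)) (ν : Fin n) :
    zs k n ν * f ∈ homFun k n m := by
  obtain ⟨N, P, hP, h⟩ := hf
  refine ⟨1 + N, MvPolynomial.X (Sum.inr ν) * P,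
    (MvPolynomial.isWeightedHomogeneous_X k (wt n) (Sum.inr ν)).mul hP, ?_⟩
  rw [map_mul, ← h, zs]
  ring

variable (k n) in
/-- The function `z_i` on `U`. -/
def zz (i : Fin n) : Fun k n := algebraMap (Poly k n) _ (MvPolynomial.X (Sum.inl i))

variable (k n) in
/-- The one-form `η = (zz*)⁻¹ ∑ z_i dz_i*`. It is invariant, and its contraction with the Euler
field is `1`; hence multiplication by `η` is a contracting homotopy for the contraction. -/
def eta : Forms k n := ∑ i : Fin n, (zz k n i * invzzs k n) ⊗ₜ[k] dzs k n i

lemma dzs_mem (i : Fin n) : dzs k n i ∈ extPart k n 0 1 := by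
  rw [extPart, pow_zero, pow_one, one_mul]
  exact ⟨Pi.single i 1, rfl⟩

lemma eta_mem : eta k n ∈ homForms k n 0 1 := by
  refine Submodule.sum_mem _ fun i _ => ?_
  refine Submodule.apply_mem_map₂ (TensorProduct.mk k _ _) ?_ (dzs_mem i)
  have h : zz k n i ∈ homFun k n 0 :=
    ⟨0, MvPolynomial.X (Sum.inl i), MvPolynomial.isWeightedHomogeneous_X k (wt n) (Sum.inl i),
      by simp [zz]⟩
  simpa using homFun_mul h (invzzs_pow_mem 1)

lemma contractEuler_tmul_one (f : Fun k n) : contractEuler k n (f ⊗ₜ 1) = 0 := by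
  have h := contractEuler_prod_dzs ([] : List (Fin n)) f
  simpa using h

lemma contractEuler_eta : contractEuler k n (eta k n) = 1 := by
  have h : ∀ i, contractEuler k n ((zz k n i * invzzs k n) ⊗ₜ[k] dzs k n i) =
      (zz k n i * zs k n i * invzzs k n) ⊗ₜ 1 := by
    intro i
    rw [← mul_one (dzs k n i), contractEuler_dzs_mul, contractEuler_tmul_one, mul_zero, sub_zero]
    congr 1
    ring
  rw [eta, map_sum, Finset.sum_congr rfl fun i _ => h i, ← TensorProduct.sum_tmul, ← Finset.sum_mul]
  have e : ∑ i, zz k n i * zs k n i = zzsFun k n := by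
    simp [zz, zs, zzsFun, zzs]
  rw [e, zzsFun_mul_invzzs]
  rfl

lemma invol_of_mem_homForms {p q : ℕ} {a : Forms k n} (ha : a ∈ homForms k n p q) :
    invol a = (-1 : k) ^ (p + q) • a := by
  have hinv : (CliffordAlgebra.involute (Q := (0 : QuadraticForm k (Cov k n)))) =
      ExteriorAlgebra.map
        (LinearMap.prodMap ((-1 : k) • LinearMap.id) ((-1 : k) • LinearMap.id)) := by
    refine ExteriorAlgebra.hom_ext (LinearMap.ext fun v => ?_)
    have h1 := CliffordAlgebra.involute_ι (Q := (0 : QuadraticForm k (Cov k n))) v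
    have h2 := ExteriorAlgebra.map_apply_ι (R := k) (M := Cov k n) (N := Cov k n)
      (LinearMap.prodMap ((-1 : k) • LinearMap.id) ((-1 : k) • LinearMap.id)) v
    refine Eq.trans h1 (Eq.trans ?_ h2.symm)
    have h3 : (LinearMap.prodMap ((-1 : k) • LinearMap.id) ((-1 : k) • LinearMap.id) :
        Cov k n →ₗ[k] Cov k n) v = -v := by
      ext <;> simp
    rw [h3, map_neg]
  have hle : homForms k n p q ≤ LinearMap.eqLocus invol ((-1 : k) ^ (p + q) • LinearMap.id) := by
    refine Submodule.map₂_le.2 fun f _ x hx => LinearMap.mem_eqLocus.2 ?_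
    rw [TensorProduct.mk_apply, invol, TensorProduct.map_tmul, hinv]
    refine (congrArg (f ⊗ₜ ·) (map_eq_smul_of_mem_extPart (-1 : k) (-1) hx)).trans ?_
    rw [← pow_add, TensorProduct.tmul_smul]
    rfl
  exact hle ha

lemma contractEuler_eta_mul (a : Forms k n) :
    contractEuler k n (eta k n * a) = a - eta k n * contractEuler k n a := by
  rw [contractEuler_mul, contractEuler_eta, one_mul, invol_of_mem_homForms eta_mem]
  simp [sub_eq_add_neg]

lemma contractEuler_mem {p q : ℕ} {a : Forms k n} (ha : a ∈ homForms k n p (q + 1)) :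
    contractEuler k n a ∈ homForms k n p q := by
  have hpow : ∀ (m : ℕ) (ν : Fin n), ∀ x ∈ spanDzs k n ^ m,
      CliffordAlgebra.contractLeft (Q := (0 : QuadraticForm k (Cov k n))) (coordS k n ν) x ∈
        spanDzs k n ^ (m - 1) := by
    intro m ν
    induction m with
    | zero =>
      intro x hx
      obtain ⟨r, rfl⟩ := Submodule.mem_one.1 (by simpa using hx)
      have := CliffordAlgebra.contractLeft_algebraMap (Q := (0 : QuadraticForm k (Cov k n)))
        (coordS k n ν) r
      rw [show CliffordAlgebra.contractLeft (Q := (0 : QuadraticForm k (Cov k n))) (coordS k n ν)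
        (algebraMap k (ExteriorAlgebra k (Cov k n)) r) = 0 from this]
      exact Submodule.zero_mem _
    | succ m ih =>
      intro x hx
      rw [pow_succ'] at hx
      induction hx using Submodule.mul_induction_on' with
      | mem_mul_mem y hy z hz =>
        obtain ⟨v, rfl⟩ := hy
        have h := CliffordAlgebra.contractLeft_ι_mul (Q := (0 : QuadraticForm k (Cov k n)))
          (d := coordS k n ν) (0, v) z
        refine (show _ = _ from h) ▸ Submodule.sub_mem _ (Submodule.smul_mem _ _ hz) ?_
        rcases m with _ | m
        · obtain ⟨r, rfl⟩ := Submodule.mem_one.1 (by simpa using hz)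
          have := CliffordAlgebra.contractLeft_algebraMap (Q := (0 : QuadraticForm k (Cov k n)))
            (coordS k n ν) r
          rw [show CliffordAlgebra.contractLeft (Q := (0 : QuadraticForm k (Cov k n)))
            (coordS k n ν) (algebraMap k (ExteriorAlgebra k (Cov k n)) r) = 0 from this, mul_zero]
          exact Submodule.zero_mem _
        · rw [Nat.add_sub_cancel, pow_succ']
          exact Submodule.mul_mem_mul ⟨v, rfl⟩ (ih z hz)
      | add y _ z _ hy hz => rw [map_add]; exact Submodule.add_mem _ hy hz
  have hdz : ∀ (m : ℕ) (ν : Fin n), ∀ x ∈ spanDz k n ^ m, ∀ y,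
      CliffordAlgebra.contractLeft (Q := (0 : QuadraticForm k (Cov k n))) (coordS k n ν) (x * y) =
        (-1 : k) ^ m • (x * CliffordAlgebra.contractLeft (Q := (0 : QuadraticForm k (Cov k n)))
          (coordS k n ν) y) := by
    intro m ν
    induction m with
    | zero =>
      intro x hx y
      obtain ⟨r, rfl⟩ := Submodule.mem_one.1 (by simpa using hx)
      rw [← Algebra.smul_def, map_smul, pow_zero, one_smul, ← Algebra.smul_def]
    | succ m ih =>
      intro x hx y
      rw [pow_succ'] at hx
      induction hx using Submodule.mul_induction_on' with
      | mem_mul_mem u hu w hw =>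
        obtain ⟨v, rfl⟩ := hu
        have h := CliffordAlgebra.contractLeft_ι_mul (Q := (0 : QuadraticForm k (Cov k n)))
          (d := coordS k n ν) (v, 0) (w * y)
        rw [mul_assoc]
        refine (show _ = _ from h).trans ?_
        rw [ih w hw y]
        simp [coordS, pow_succ, mul_assoc]
      | add u _ w _ hu hw => rw [add_mul, map_add, hu, hw, add_mul, smul_add]
  have hle : homForms k n p (q + 1) ≤ (homForms k n p q).comap (contractEuler k n) := by
    refine Submodule.map₂_le.2 fun f hf x hx => Submodule.mem_comap.2 ?_
    rw [TensorProduct.mk_apply, contractEuler_tmul]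
    refine Submodule.sum_mem _ fun ν _ => ?_
    refine Submodule.apply_mem_map₂ (TensorProduct.mk k _ _) (zs_mul_mem hf ν) ?_
    rw [extPart] at hx
    induction hx using Submodule.mul_induction_on' with
    | mem_mul_mem y hy z hz =>
      rw [hdz p ν y hy]
      exact Submodule.smul_mem _ _ (Submodule.mul_mem_mul hy (hpow _ ν z hz))
    | add y _ z _ hy hz => rw [map_add]; exact Submodule.add_mem _ hy hz
  exact hle ha

lemma actFun_zz (g : GL (Fin n) k) (j : Fin n) :
    actFun g (zz k n j) = ∑ i, g.1 i j • zz k n i := by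
  rw [zz, actFun_algebraMap, actPoly_X_inl, map_sum]
  exact Finset.sum_congr rfl fun i _ =>
    map_smul (IsScalarTower.toAlgHom k (Poly k n) (Fun k n)) _ _

lemma actFun_zs (g : GL (Fin n) k) (j : Fin n) :
    actFun g (zs k n j) = ∑ i, (g⁻¹).1 j i • zs k n i := by
  rw [zs, actFun_algebraMap, actPoly_X_inr, map_sum]
  exact Finset.sum_congr rfl fun i _ =>
    map_smul (IsScalarTower.toAlgHom k (Poly k n) (Fun k n)) _ _

lemma map_actCov_dz (g : GL (Fin n) k) (j : Fin n) :
    ExteriorAlgebra.map (actCov g) (dz k n j) = ∑ i, g.1 i j • dz k n i := by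
  simp only [dz]
  rw [ExteriorAlgebra.map_apply_ι]
  simp only [← map_smul, ← map_sum]
  congr 1
  ext b
  · simp [actCov, Prod.fst_sum, Finset.sum_apply, Pi.single_apply]
  · simp [actCov, Prod.snd_sum]

lemma map_actCov_dzs (g : GL (Fin n) k) (j : Fin n) :
    ExteriorAlgebra.map (actCov g) (dzs k n j) = ∑ i, (g⁻¹).1 j i • dzs k n i := by
  simp only [dzs]
  rw [ExteriorAlgebra.map_apply_ι]
  simp only [← map_smul, ← map_sum]
  congr 1
  ext b
  · simp [actCov, Prod.fst_sum]
  · simp [actCov, Prod.snd_sum, Finset.sum_apply, Pi.single_apply]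

lemma actForms_eta (g : GL (Fin n) k) : actForms g (eta k n) = eta k n := by
  have h1 : ∀ i, actFun g (zz k n i * invzzs k n) = ∑ a, g.1 a i • (zz k n a * invzzs k n) := by
    intro i
    simp only [map_mul, actFun_invzzs, actFun_zz, Finset.sum_mul, smul_mul_assoc]
  simp only [eta, map_sum, actForms, Algebra.TensorProduct.map_tmul, h1, map_actCov_dzs,
    TensorProduct.sum_tmul, TensorProduct.tmul_sum, TensorProduct.tmul_smul,
    ← TensorProduct.smul_tmul']
  simp only [Finset.smul_sum, ← mul_smul]
  rw [Finset.sum_comm]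
  refine Finset.sum_congr rfl fun b _ => ?_
  rw [Finset.sum_comm]
  simp only [← Finset.sum_smul, mul_comm ((g⁻¹).1 _ _), sum_mul_inv_apply, ite_smul,
    one_smul, zero_smul, Finset.sum_ite_eq', Finset.mem_univ, if_true]

variable (k n) in
/-- The coefficient of `topForm` in a form on `U`. -/
def topFun : Forms k n →ₗ[k] Fun k n :=
  (TensorProduct.rid k (Fun k n)).toLinearMap ∘ₗ TensorProduct.map LinearMap.id (topCoeff k n)

lemma topFun_tmul (f : Fun k n) (x : ExteriorAlgebra k (Cov k n)) :
    topFun k n (f ⊗ₜ x) = topCoeff k n x • f := by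
  simp [topFun]

lemma mul_tmul_one_comm (f : Fun k n) (w : Forms k n) : w * (f ⊗ₜ 1) = (f ⊗ₜ 1) * w := by
  induction w using TensorProduct.induction_on with
  | zero => simp
  | add a b ha hb => rw [add_mul, mul_add, ha, hb]
  | tmul e x => simp [mul_comm]

lemma topFun_smul (f : Fun k n) (w : Forms k n) :
    topFun k n ((f ⊗ₜ 1) * w) = f * topFun k n w := by
  induction w using TensorProduct.induction_on with
  | zero => simp
  | add a b ha hb => rw [mul_add, map_add, map_add, ha, hb, mul_add]
  | tmul h x =>
    rw [Algebra.TensorProduct.tmul_mul_tmul, topFun_tmul, topFun_tmul, one_mul, mul_smul_comm]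

lemma topFun_actForms (g : GL (Fin n) k) (w : Forms k n) :
    topFun k n (actForms g w) = actFun g (topFun k n w) := by
  induction w using TensorProduct.induction_on with
  | zero => simp
  | add a b ha hb => rw [map_add, map_add, map_add, map_add, ha, hb]
  | tmul h x =>
    rw [actForms, Algebra.TensorProduct.map_tmul, topFun_tmul, topFun_tmul, topCoeff_map_actCov,
      map_smul]

lemma tmul_one_mul_mem_A {p q : ℕ} {f : Fun k n} (hf : f ∈ homFun k n 0) {a : Forms k n}
    (ha : a ∈ A k n p q) : (f ⊗ₜ 1) * a ∈ A k n p q := by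
  have h1 : f ⊗ₜ 1 ∈ A k n 0 0 := by
    refine ⟨Submodule.apply_mem_map₂ (TensorProduct.mk k _ _) hf ?_, contractEuler_tmul_one f⟩
    rw [extPart, pow_zero, pow_zero, one_mul]
    exact Submodule.one_le.1 le_rfl
  simpa using A_mul h1 ha

variable (k n) in
/-- The linear map from `A^{n,n-1}` to functions with `c = density c · Ω dz_1 ∧ ⋯ ∧ dz_n`. -/
def density : Forms k n →ₗ[k] Fun k n :=
  LinearMap.mulLeft k (zzsFun k n ^ n) ∘ₗ topFun k n ∘ₗ LinearMap.mulLeft k (eta k n)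

lemma density_apply (c : Forms k n) : density k n c = zzsFun k n ^ n * topFun k n (eta k n * c) :=
  rfl

lemma density_smul (f : Fun k n) (c : Forms k n) :
    density k n ((f ⊗ₜ 1) * c) = f * density k n c := by
  rw [density_apply, density_apply, ← mul_assoc, mul_tmul_one_comm, mul_assoc, topFun_smul]
  ring

lemma density_actForms (g : GL (Fin n) k) (c : Forms k n) :
    density k n (actForms g c) = actFun g (density k n c) := by
  rw [density_apply, density_apply, map_mul (actFun g), map_pow, actFun_zzsFun, ← topFun_actForms,
    map_mul (actForms g), actForms_eta]

lemma eta_mul_mem {c : Forms k n} (hn : 1 ≤ n) (hc : c ∈ A k n n (n - 1)) :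
    eta k n * c ∈ homForms k n n n := by
  have h := homForms_mul eta_mem hc.1
  rwa [zero_add, Nat.add_sub_cancel' hn] at h

lemma martinelliBochner_eq : martinelliBochner k n = contractEuler k n
    ((invzzs k n ^ n) ⊗ₜ ((List.finRange n).map (dzs k n)).prod) := by
  rw [contractEuler_prod_dzs, martinelliBochner]
  refine Fintype.sum_equiv (finCongr (List.length_finRange (n := n)).symm) _ _ fun ν => ?_
  simp

lemma topFun_mem {w : Forms k n} (hw : w ∈ homForms k n n n) : topFun k n w ∈ homFun k n n := by
  have hle : homForms k n n n ≤ (homFun k n n).comap (topFun k n) := by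
    refine Submodule.map₂_le.2 fun f hf x hx => Submodule.mem_comap.2 ?_
    rw [TensorProduct.mk_apply, topFun_tmul]
    exact Submodule.smul_mem _ _ hf
  exact hle hw

lemma density_mem {c : Forms k n} (hn : 1 ≤ n) (hc : c ∈ A k n n (n - 1)) :
    density k n c ∈ homFun k n 0 :=
  zzsFun_pow_mul_mem (topFun_mem (eta_mul_mem hn hc))

variable [CharZero k]

lemma eq_topFun_tmul {w : Forms k n} (hw : w ∈ homForms k n n n) :
    w = topFun k n w ⊗ₜ topForm k n := by
  have hle : homForms k n n n ≤ LinearMap.eqLocus LinearMap.id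
      ((TensorProduct.mk k (Fun k n) _).flip (topForm k n) ∘ₗ topFun k n) := by
    refine Submodule.map₂_le.2 fun f hf x hx => LinearMap.mem_eqLocus.2 ?_
    change f ⊗ₜ[k] x = topFun k n (f ⊗ₜ[k] x) ⊗ₜ[k] topForm k n
    rw [topFun_tmul, ← TensorProduct.smul_tmul', ← TensorProduct.tmul_smul, ← eq_topCoeff_smul hx]
  exact hle hw

lemma homForms_eq_bot {p q : ℕ} (hq : n < q) : homForms k n p q = ⊥ := by
  rw [homForms, extPart_eq_bot hq, Submodule.map₂_bot_right]

/-- Contraction with the Euler field is injective in the top bidegree. -/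
lemma eq_zero_of_contractEuler_eq_zero {p : ℕ} {w : Forms k n} (hw : w ∈ homForms k n p n)
    (h : contractEuler k n w = 0) : w = 0 := by
  have h1 := homForms_mul eta_mem hw
  rw [homForms_eq_bot (by omega), Submodule.mem_bot] at h1
  have h2 := contractEuler_eta_mul w
  rwa [h1, h, map_zero, mul_zero, sub_zero, eq_comm] at h2

lemma eq_zero_of_density_eq_zero {c : Forms k n} (hn : 1 ≤ n) (hc : c ∈ A k n n (n - 1))
    (h : density k n c = 0) : c = 0 := by
  have h1 : topFun k n (eta k n * c) = 0 := by
    calc topFun k n (eta k n * c) =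
        zzsFun k n ^ n * invzzs k n ^ n * topFun k n (eta k n * c) := by
          rw [zzsFun_pow_mul_invzzs_pow, one_mul]
      _ = invzzs k n ^ n * density k n c := by rw [density_apply]; ring
      _ = 0 := by rw [h, mul_zero]
  have h2 := eq_topFun_tmul (eta_mul_mem hn hc)
  rw [h1, TensorProduct.zero_tmul] at h2
  have h3 := contractEuler_eta_mul c
  rwa [h2, show contractEuler k n c = 0 from hc.2, map_zero, mul_zero, sub_zero, eq_comm] at h3

lemma density_martinelliBochner_mul :
    density k n (martinelliBochner k n * dzTop k n) = 1 := by
  have hW : (invzzs k n ^ n) ⊗ₜ ((List.finRange n).map (dzs k n)).prod ∈ homForms k n 0 n := by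
    refine Submodule.apply_mem_map₂ (TensorProduct.mk k _ _) (invzzs_pow_mem n) ?_
    have h := prod_dzs_mem (k := k) (List.finRange n)
    rwa [List.length_finRange] at h
  have h1 := homForms_mul eta_mem hW
  rw [homForms_eq_bot (by omega), Submodule.mem_bot] at h1
  have h2 := contractEuler_eta_mul ((invzzs k n ^ n) ⊗ₜ ((List.finRange n).map (dzs k n)).prod)
  rw [h1, map_zero, eq_comm, sub_eq_zero] at h2
  rw [density_apply, martinelliBochner_eq, ← mul_assoc, ← h2, dzTop,
    Algebra.TensorProduct.tmul_mul_tmul, topFun_tmul, mul_one]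
  change _ * (topCoeff k n (topForm k n) • _) = _
  rw [topCoeff_topForm, one_smul, zzsFun_pow_mul_invzzs_pow]

end Res

/-! ### Nondegeneracy of the residue pairing -/

section Pairing

variable {k : Type*} [Field k] {n : ℕ}

/-- The extension of a functional on functions to a map from forms to constant forms, acting on the
coefficients of the form. -/
def coeffMap (d : Fun k n →ₗ[k] k) : Forms k n →ₗ[k] ExteriorAlgebra k (Cov k n) :=
  (TensorProduct.lid k _).toLinearMap ∘ₗ TensorProduct.map d LinearMap.id

lemma coeffMap_tmul (d : Fun k n →ₗ[k] k) (f : Fun k n) (x : ExteriorAlgebra k (Cov k n)) :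
    coeffMap d (f ⊗ₜ x) = d f • x := by
  simp [coeffMap]

lemma exists_coeffMap_ne_zero {w : Forms k n} (hw : w ≠ 0) : ∃ d, coeffMap d w ≠ 0 := by
  classical
  by_contra! h
  let b := Module.Basis.ofVectorSpace k (Fun k n)
  have key : ∀ (i) (v : Forms k n),
      TensorProduct.equivFinsuppOfBasisLeft b v i = coeffMap (b.coord i) v := by
    intro i v
    induction v using TensorProduct.induction_on with
    | zero => simp
    | add a c ha hc => rw [map_add, map_add, Finsupp.add_apply, ha, hc]
    | tmul f x =>
      rw [TensorProduct.equivFinsuppOfBasisLeft_apply_tmul_apply, coeffMap_tmul]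
      rfl
  refine hw ((LinearEquiv.map_eq_zero_iff (TensorProduct.equivFinsuppOfBasisLeft b)).1
    (Finsupp.ext fun i => ?_))
  rw [key, h]
  rfl

lemma apply_topFun_map (L : ExteriorAlgebra k (Cov k n) →ₗ[k] ExteriorAlgebra k (Cov k n))
    (d : Fun k n →ₗ[k] k) (w : Forms k n) :
    d (topFun k n (TensorProduct.map LinearMap.id L w)) = topCoeff k n (L (coeffMap d w)) := by
  induction w using TensorProduct.induction_on with
  | zero => simp
  | add a b ha hb => simp only [map_add, ha, hb]
  | tmul f x =>
    rw [TensorProduct.map_tmul, topFun_tmul, LinearMap.id_apply, coeffMap_tmul, map_smul, map_smul,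
      map_smul, smul_eq_mul, smul_eq_mul, mul_comm]

lemma mul_one_tmul (w : Forms k n) (y : ExteriorAlgebra k (Cov k n)) :
    w * (1 ⊗ₜ y) = TensorProduct.map LinearMap.id (LinearMap.mulRight k y) w := by
  induction w using TensorProduct.induction_on with
  | zero => simp
  | add a b ha hb => rw [add_mul, map_add, ha, hb]
  | tmul f x => simp

lemma one_tmul_mul (w : Forms k n) (y : ExteriorAlgebra k (Cov k n)) :
    (1 ⊗ₜ y) * w = TensorProduct.map LinearMap.id (LinearMap.mulLeft k y) w := by
  induction w using TensorProduct.induction_on with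
  | zero => simp
  | add a b ha hb => rw [mul_add, map_add, ha, hb]
  | tmul f x => simp

variable [CharZero k]

lemma topFun_eq_zero {p q : ℕ} (h : p ≠ n ∨ q ≠ n) {w : Fun k n ⊗[k] ExteriorAlgebra k (Cov k n)}
    (hw : w ∈ Submodule.map₂ (TensorProduct.mk k (Fun k n) (ExteriorAlgebra k (Cov k n)))
      ⊤ (extPart k n p q)) : topFun k n w = 0 := by
  have hle : Submodule.map₂ (TensorProduct.mk k (Fun k n) (ExteriorAlgebra k (Cov k n)))
      ⊤ (extPart k n p q) ≤ LinearMap.ker (topFun k n) := by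
    refine Submodule.map₂_le.2 fun f _ x hx => LinearMap.mem_ker.2 ?_
    rw [TensorProduct.mk_apply, topFun_tmul, topCoeff_eq_zero h hx, zero_smul]
  exact hle hw

/-- A nonzero form of bidegree `(p, q)` has nonzero products, from either side, with suitable forms
of the complementary bidegree. -/
lemma exists_homForms_mul_ne_zero {p q : ℕ} (hp : p ≤ n) (hq : q ≤ n) {w : Forms k n}
    (hw : w ∈ homForms k n p q) (h0 : w ≠ 0) :
    (∃ b ∈ homForms k n (n - p) (n - q), w * b ≠ 0) ∧
      ∃ b ∈ homForms k n (n - p) (n - q), b * w ≠ 0 := by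
  obtain ⟨d, hd⟩ := exists_coeffMap_ne_zero h0
  have hne : ∀ {L : ExteriorAlgebra k (Cov k n) →ₗ[k] ExteriorAlgebra k (Cov k n)},
      topCoeff k n (L (coeffMap d w)) ≠ 0 →
      topFun k n (TensorProduct.map LinearMap.id L w) ≠ 0 := by
    intro L hL h
    rw [← apply_topFun_map, h, map_zero] at hL
    exact hL rfl
  have hdeg : ∀ {p' q' : ℕ} {L : ExteriorAlgebra k (Cov k n) →ₗ[k] ExteriorAlgebra k (Cov k n)},
      (∀ x ∈ extPart k n p q, L x ∈ extPart k n (p + p') (q + q')) →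
      topFun k n (TensorProduct.map LinearMap.id L w) ≠ 0 → p' = n - p ∧ q' = n - q := by
    intro p' q' L hL hne
    by_contra hcon
    refine hne (topFun_eq_zero (p := p + p') (q := q + q') (by omega) ?_)
    have hle : homForms k n p q ≤ (Submodule.map₂ (TensorProduct.mk k (Fun k n)
        (ExteriorAlgebra k (Cov k n))) ⊤ (extPart k n (p + p') (q + q'))).comap
          (TensorProduct.map LinearMap.id L) := by
      refine Submodule.map₂_le.2 fun f _ x hx => Submodule.mem_comap.2 ?_
      rw [TensorProduct.mk_apply, TensorProduct.map_tmul]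
      exact Submodule.apply_mem_map₂ (TensorProduct.mk k _ _) Submodule.mem_top (hL x hx)
    exact hle hw
  have hinv : ∀ w' : Forms k n, topFun k n w' ≠ 0 → ∀ m,
      ((invzzs k n ^ m) ⊗ₜ[k] (1 : ExteriorAlgebra k (Cov k n))) * w' ≠ 0 := by
    intro w' hw' m h
    apply hw'
    have h1 := congrArg (fun v => zzsFun k n ^ m * topFun k n v) h
    simpa [topFun_smul, ← mul_assoc, zzsFun_pow_mul_invzzs_pow] using h1
  have hmem : ∀ {p' q' : ℕ} {y : ExteriorAlgebra k (Cov k n)}, y ∈ extPart k n p' q' →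
      (invzzs k n ^ q') ⊗ₜ[k] y ∈ homForms k n p' q' := fun hy =>
    Submodule.apply_mem_map₂ (TensorProduct.mk k _ _) (invzzs_pow_mem _) hy
  obtain ⟨⟨p₁, q₁, y, hy, hy0⟩, p₂, q₂, x, hx, hx0⟩ :=
    exists_mem_extPart_topCoeff_mul_ne_zero hd
  constructor
  · have h1 := hne (L := LinearMap.mulRight k y) hy0
    obtain ⟨rfl, rfl⟩ := hdeg (p' := p₁) (q' := q₁) (fun x hx => by
      rw [← extPart_mul]; exact Submodule.mul_mem_mul hx hy) h1
    refine ⟨_, hmem hy, ?_⟩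
    rw [← mul_one_tmul] at h1
    convert hinv _ h1 (n - q) using 1
    rw [← mul_tmul_one_comm, mul_assoc]
    congr 1
    simp
  · have h1 := hne (L := LinearMap.mulLeft k x) hx0
    obtain ⟨rfl, rfl⟩ := hdeg (p' := p₂) (q' := q₂) (fun z hz => by
      rw [add_comm p, add_comm q, ← extPart_mul]; exact Submodule.mul_mem_mul hx hz) h1
    refine ⟨_, hmem hx, ?_⟩
    rw [← one_tmul_mul] at h1
    convert hinv _ h1 (n - q) using 1
    rw [← mul_assoc]
    congr 1
    simp

/-- A nonzero element of `A^{p,q}` has nonzero products, from either side, with suitable elements of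
`A^{n-p,n-1-q}`: these are contractions of forms of bidegree `(n-p, n-q)`, and contraction with the
Euler field is injective in top bidegree. -/
lemma exists_A_mul_ne_zero {p q : ℕ} (hp : p ≤ n) (hq : q + 1 ≤ n) {a : Forms k n}
    (ha : a ∈ A k n p q) (h0 : a ≠ 0) :
    (∃ b ∈ A k n (n - p) (n - 1 - q), a * b ≠ 0) ∧
      ∃ b ∈ A k n (n - p) (n - 1 - q), b * a ≠ 0 := by
  have ha0 : contractEuler k n a = 0 := ha.2
  have hA : ∀ b ∈ homForms k n (n - p) (n - q),
      contractEuler k n b ∈ A k n (n - p) (n - 1 - q) := by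
    intro b hb
    refine ⟨contractEuler_mem ?_, contractEuler_sq _⟩
    rwa [show n - 1 - q + 1 = n - q by omega]
  obtain ⟨⟨b, hb, hab⟩, c, hc, hca⟩ := exists_homForms_mul_ne_zero hp (by omega) ha.1 h0
  constructor
  · refine ⟨_, hA b hb, fun h => hab ?_⟩
    have hm := homForms_mul ha.1 hb
    rw [Nat.add_sub_cancel' hp, Nat.add_sub_cancel' (by omega : q ≤ n)] at hm
    refine eq_zero_of_contractEuler_eq_zero hm ?_
    rw [contractEuler_mul, ha0, zero_mul, zero_add, invol_of_mem_homForms ha.1, smul_mul_assoc, h,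
      smul_zero]
  · refine ⟨_, hA c hc, fun h => hca ?_⟩
    have hm := homForms_mul hc ha.1
    rw [Nat.sub_add_cancel hp, Nat.sub_add_cancel (by omega : q ≤ n)] at hm
    refine eq_zero_of_contractEuler_eq_zero hm ?_
    rw [contractEuler_mul, ha0, mul_zero, add_zero, h]

variable [NeZero n]

variable (k n) in
/-- The residue of `c = f · Ω dz_1 ∧ ⋯ ∧ dz_n`, as the value of the invariant functional at `f`. -/
def resMap : A k n n (n - 1) →ₗ[k] k :=
  funRes k n ∘ₗ density k n ∘ₗ (A k n n (n - 1)).subtype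

lemma isResidue_resMap : IsResidue k n (resMap k n) := by
  refine ⟨fun g a => ?_, ?_⟩
  · change funRes k n (density k n (actForms g a)) = funRes k n (density k n a)
    rw [density_actForms, funRes_actFun]
  · change funRes k n (density k n (martinelliBochner k n * dzTop k n)) = 1
    rw [density_martinelliBochner_mul, funRes_one]

lemma resMap_mulTop {p q : ℕ} (hp : p ≤ n) (hq : q ≤ n - 1) (a : A k n p q)
    (b : A k n (n - p) (n - 1 - q)) : resMap k n (mulTop hp hq a b) =
      funRes k n (density k n ((a : Forms k n) * (b : Forms k n))) := rfl

lemma exists_resMap_ne_zero {c : Forms k n} (hc : c ∈ A k n n (n - 1)) (h0 : c ≠ 0) :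
    ∃ f ∈ homFun k n 0, funRes k n (density k n ((f ⊗ₜ 1) * c)) ≠ 0 := by
  have hn : 1 ≤ n := NeZero.one_le
  obtain ⟨f, hf, h⟩ := exists_funRes_mul_ne_zero (density_mem hn hc)
    fun h => h0 (eq_zero_of_density_eq_zero hn hc h)
  exact ⟨f, hf, by rwa [density_smul]⟩

lemma exists_resMap_mulTop_ne_zero_left {p q : ℕ} (hp : p ≤ n) (hq : q ≤ n - 1) {a : A k n p q}
    (h0 : a ≠ 0) : ∃ b, resMap k n (mulTop hp hq a b) ≠ 0 := by
  have hn : 1 ≤ n := NeZero.one_le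
  obtain ⟨⟨b, hb, hab⟩, -⟩ := exists_A_mul_ne_zero hp (by omega) a.2
    fun h => h0 (Subtype.ext h)
  obtain ⟨f, hf, h⟩ := exists_resMap_ne_zero (c := (a : Forms k n) * b)
    (mulTop hp hq a ⟨b, hb⟩).2 hab
  refine ⟨⟨_, tmul_one_mul_mem_A hf hb⟩, ?_⟩
  rwa [resMap_mulTop, ← mul_assoc, mul_tmul_one_comm, mul_assoc]

lemma exists_resMap_mulTop_ne_zero_right {p q : ℕ} (hp : p ≤ n) (hq : q ≤ n - 1)
    {b : A k n (n - p) (n - 1 - q)} (h0 : b ≠ 0) : ∃ a, resMap k n (mulTop hp hq a b) ≠ 0 := by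
  have hn : 1 ≤ n := NeZero.one_le
  obtain ⟨-, a, ha, hab⟩ := exists_A_mul_ne_zero (Nat.sub_le n p) (by omega) b.2
    fun h => h0 (Subtype.ext h)
  rw [show n - (n - p) = p by omega, show n - 1 - (n - 1 - q) = q by omega] at ha
  obtain ⟨f, hf, h⟩ := exists_resMap_ne_zero (c := a * (b : Forms k n))
    (mulTop hp hq ⟨a, ha⟩ b).2 hab
  refine ⟨⟨_, tmul_one_mul_mem_A hf ha⟩, ?_⟩
  rwa [resMap_mulTop, mul_assoc]

end Pairing

/-! ### Complete reducibility of mixed tensors -/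

section TraceForm

/-- A finite-dimensional representation is semisimple as soon as the trace form is nondegenerate on
the image of the group algebra: the Jacobson radical of that image is a nilpotent ideal, hence lies
in the kernel of the trace form. -/
lemma isSemisimpleModule_of_trace {k G V : Type*} [Field k] [Group G] [AddCommGroup V] [Module k V]
    [FiniteDimensional k V] (ρ : Representation k G V)
    (h : ∀ x ∈ ρ.asAlgebraHom.range, (∀ y ∈ ρ.asAlgebraHom.range, LinearMap.trace k V (x * y) = 0) →
      x = 0) : IsSemisimpleModule (MonoidAlgebra k G) ρ.asModule := by
  let B := ρ.asAlgebraHom.range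
  have hB : IsArtinianRing B := IsArtinianRing.of_finite k B
  have hss : IsSemisimpleRing B := by
    rw [IsArtinianRing.isSemisimpleRing_iff_jacobson]
    refine (Submodule.eq_bot_iff _).2 fun x hx => Subtype.ext (h _ x.2 fun y hy => ?_)
    have hxy : x * ⟨y, hy⟩ ∈ Ring.jacobson B := Ideal.mul_mem_right _ _ hx
    obtain ⟨m, hm⟩ := IsArtinianRing.isNilpotent_jacobson_bot (R := B)
    rw [Ideal.jacobson_bot] at hm
    have hnil : IsNilpotent ((x : Module.End k V) * y) := by
      refine ⟨m, ?_⟩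
      have h1 : (x * ⟨y, hy⟩) ^ m ∈ Ring.jacobson B ^ m := Ideal.pow_mem_pow hxy m
      rw [hm] at h1
      exact congrArg Subtype.val ((Submodule.mem_bot _).1 h1)
    exact (LinearMap.isNilpotent_trace_of_isNilpotent hnil).eq_zero
  let σ : MonoidAlgebra k G →+* B := ρ.asAlgebraHom.rangeRestrict.toRingHom
  have : RingHomSurjective σ := ⟨ρ.asAlgebraHom.rangeRestrict_surjective⟩
  let l : ρ.asModule →ₛₗ[σ] V :=
    { toFun := ρ.asModuleEquiv
      map_add' := map_add _
      map_smul' := fun r x => ρ.asModuleEquiv_map_smul r x }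
  exact (LinearMap.isSemisimpleModule_iff_of_bijective l ρ.asModuleEquiv.bijective).2 inferInstance

end TraceForm

section Tensor

variable {n : ℕ} (α β : Type) [Fintype α] [Fintype β]

/-- The matrix of the action of `g` on the mixed tensors `V^{⊗ α} ⊗ (V^*)^{⊗ β}`, where `h` stands
for the inverse of `g`. -/
def tensorMat {R : Type*} [CommRing R] (g h : Matrix (Fin n) (Fin n) R) :
    Matrix ((α → Fin n) × (β → Fin n)) ((α → Fin n) × (β → Fin n)) R :=
  Matrix.of fun i j => (∏ s, g (i.1 s) (j.1 s)) * ∏ t, h (j.2 t) (i.2 t)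

section CommRing

variable {R S : Type*} [CommRing R] [CommRing S]

lemma tensorMat_apply (g h : Matrix (Fin n) (Fin n) R) (i j : (α → Fin n) × (β → Fin n)) :
    tensorMat α β g h i j = (∏ s, g (i.1 s) (j.1 s)) * ∏ t, h (j.2 t) (i.2 t) := rfl

lemma tensorMat_mul [DecidableEq α] [DecidableEq β] (g h g' h' : Matrix (Fin n) (Fin n) R) :
    tensorMat α β g h * tensorMat α β g' h' = tensorMat α β (g * g') (h' * h) := by
  ext i j
  rw [Matrix.mul_apply, Fintype.sum_prod_type, tensorMat_apply]
  simp only [Matrix.mul_apply, tensorMat_apply, Finset.prod_univ_sum, Fintype.piFinset_univ]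
  rw [Finset.sum_mul_sum]
  refine Finset.sum_congr rfl fun a _ => Finset.sum_congr rfl fun b _ => ?_
  rw [Finset.prod_mul_distrib, Finset.prod_mul_distrib]
  ring

lemma tensorMat_one [DecidableEq α] [DecidableEq β] :
    tensorMat α β (1 : Matrix (Fin n) (Fin n) R) 1 = 1 := by
  ext i j
  rw [tensorMat_apply, Matrix.one_apply]
  simp only [Matrix.one_apply, Finset.prod_ite_zero, Finset.prod_const_one, Finset.mem_univ,
    forall_true_left, ← ite_and, mul_ite, mul_one, mul_zero]
  refine if_congr ?_ rfl rfl
  rw [Prod.ext_iff, funext_iff, funext_iff, and_comm]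
  simp only [eq_comm]

lemma tensorMat_smul (c : R) (g h : Matrix (Fin n) (Fin n) R) :
    tensorMat α β g (c • h) = c ^ Fintype.card β • tensorMat α β g h := by
  ext i j
  simp only [tensorMat_apply, Matrix.smul_apply, smul_eq_mul, Finset.prod_mul_distrib,
    Finset.prod_const, Finset.card_univ]
  ring

lemma tensorMat_map (φ : R →+* S) (g h : Matrix (Fin n) (Fin n) R) :
    (tensorMat α β g h).map φ = tensorMat α β (g.map φ) (h.map φ) := by
  ext i j
  simp [tensorMat_apply]

end CommRing

lemma adjugate_eq_smul_inv {K : Type*} [Field K] (y : GL (Fin n) K) :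
    y.1.adjugate = y.1.det • (y⁻¹).1 := by
  have h1 : y.1 * (y⁻¹).1 = 1 := Units.mul_inv y
  calc y.1.adjugate = y.1.adjugate * (y.1 * (y⁻¹).1) := by rw [h1, mul_one]
    _ = y.1.det • (y⁻¹).1 := by
      rw [← mul_assoc, Matrix.adjugate_mul, smul_mul_assoc, one_mul]

variable [DecidableEq α] [DecidableEq β]

/-- The monoid homomorphism giving the action on mixed tensors. -/
def tensorHom (K : Type*) [Field K] :
    GL (Fin n) K →* Matrix ((α → Fin n) × (β → Fin n)) ((α → Fin n) × (β → Fin n)) K where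
  toFun g := tensorMat α β g.1 (g⁻¹).1
  map_one' := by rw [inv_one]; exact tensorMat_one α β
  map_mul' g h := by rw [tensorMat_mul, mul_inv_rev]; rfl

/-- The representation of `GL_n` on mixed tensors. -/
def tensorRep (K : Type*) [Field K] :
    Representation K (GL (Fin n) K) ((α → Fin n) × (β → Fin n) → K) :=
  (Matrix.toLinAlgEquiv' : Matrix _ _ K ≃ₐ[K] _).toAlgHom.toMonoidHom.comp (tensorHom α β K)

lemma tensorRep_apply {K : Type*} [Field K] (g : GL (Fin n) K)
    (v : (α → Fin n) × (β → Fin n) → K) :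
    tensorRep α β K g v = (tensorHom α β K g).mulVec v := rfl

variable {k : Type*} [Field k] [CharZero k]

/-- The actions of the rational points of `GL_n` span the actions of all its points, by density. -/
lemma tensorHom_mem_span (g : GL (Fin n) k) : tensorHom α β k g ∈ Submodule.span k
    (Set.range fun x : GL (Fin n) ℚ => (tensorHom α β ℚ x).map (algebraMap ℚ k)) := by
  by_contra hg
  obtain ⟨f, hf, hle⟩ := Submodule.exists_le_ker_of_notMem hg
  let T := MvPolynomial (Fin n × Fin n) k
  let X : Matrix (Fin n) (Fin n) T := Matrix.mvPolynomialX (Fin n) (Fin n) k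
  -- The value of `f` at `det(y) ^ |β|` times the action of `y`: with the adjugate in place of the
  -- inverse, it is a polynomial in the entries of `y`.
  let p : T := ∑ i, ∑ j, MvPolynomial.C (f (Matrix.single i j 1)) * tensorMat α β X X.adjugate i j
  have heval : ∀ y : Matrix (Fin n) (Fin n) k,
      MvPolynomial.eval (fun ij => y ij.1 ij.2) p = f (tensorMat α β y y.adjugate) := by
    intro y
    set e : T →+* k := MvPolynomial.eval (fun ij => y ij.1 ij.2)
    have hX : X.map e = y := Matrix.mvPolynomialX_mapMatrix_eval y
    have hXa : X.adjugate.map e = y.adjugate := by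
      rw [← hX]
      exact RingHom.map_adjugate e X
    have hT : ∀ i j, e (tensorMat α β X X.adjugate i j) = tensorMat α β y y.adjugate i j := by
      intro i j
      have h := tensorMat_map α β e X X.adjugate
      rw [hX, hXa] at h
      exact congrFun (congrFun h i) j
    rw [Matrix.matrix_eq_sum_single (tensorMat α β y y.adjugate)]
    simp only [p, map_sum, map_mul, hT]
    refine Finset.sum_congr rfl fun i _ => Finset.sum_congr rfl fun j _ => ?_
    rw [show Matrix.single i j (tensorMat α β y y.adjugate i j) =
      tensorMat α β y y.adjugate i j • Matrix.single i j 1 by simp, map_smul, smul_eq_mul, mul_comm]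
    congr 1
    exact MvPolynomial.eval_C _
  -- This polynomial vanishes at the invertible rational matrices.
  have hzero : p * X.det = 0 := by
    refine MvPolynomial.funext_set (fun _ => Set.range (algebraMap ℚ k)) (fun _ =>
      Set.infinite_range_of_injective (algebraMap ℚ k).injective) fun x hx => ?_
    choose y hy using fun ij => hx ij trivial
    have hx' : x = fun ij => (Matrix.of fun i j => y (i, j)).map (algebraMap ℚ k) ij.1 ij.2 :=
      funext fun ij => (hy ij).symm
    set Y : Matrix (Fin n) (Fin n) ℚ := Matrix.of fun i j => y (i, j)
    have hdet : MvPolynomial.eval x X.det = algebraMap ℚ k Y.det := by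
      rw [hx', RingHom.map_det, RingHom.map_det]
      exact congrArg Matrix.det (Matrix.mvPolynomialX_mapMatrix_eval (Y.map (algebraMap ℚ k)))
    rw [map_mul, map_zero]
    by_cases h0 : Y.det = 0
    · rw [hdet, h0, map_zero, mul_zero]
    · let y' : GL (Fin n) ℚ := Matrix.GeneralLinearGroup.mkOfDetNeZero Y h0
      have hY := hle (Submodule.subset_span ⟨y', rfl⟩)
      rw [LinearMap.mem_ker] at hY
      have h1 : tensorMat α β (Y.map (algebraMap ℚ k)) (Y.map (algebraMap ℚ k)).adjugate =
          algebraMap ℚ k (Y.det ^ Fintype.card β) •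
            (tensorHom α β ℚ y').map (algebraMap ℚ k) := by
        have h2 : (Y.map (algebraMap ℚ k)).adjugate = Y.adjugate.map (algebraMap ℚ k) :=
          (RingHom.map_adjugate (algebraMap ℚ k) Y).symm
        have h3 : Y.adjugate = Y.det • (y'⁻¹).1 := adjugate_eq_smul_inv y'
        rw [h2, ← tensorMat_map, h3, tensorMat_smul]
        ext i j
        exact map_mul (algebraMap ℚ k) _ _
      rw [hx', heval, h1, map_smul, hY, smul_zero, zero_mul]
  have hp : p = 0 := by
    refine (mul_eq_zero.1 hzero).resolve_right ?_
    exact Matrix.det_mvPolynomialX_ne_zero (Fin n) k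
  have h := heval g.1
  rw [hp, map_zero, adjugate_eq_smul_inv, tensorMat_smul, map_smul, eq_comm, smul_eq_zero] at h
  refine hf (h.resolve_left (pow_ne_zero _ ?_))
  exact ((Matrix.isUnit_iff_isUnit_det _).1 g.isUnit).ne_zero

/-- The trace form is nondegenerate on the span of the actions of `GL_n` on mixed tensors. That span
is the base change of its analogue over `ℚ`, which is stable under transposition, and `tr (x xᵀ)` is
a sum of squares. -/
lemma eq_zero_of_trace_mul_eq_zero
    {x : Matrix ((α → Fin n) × (β → Fin n)) ((α → Fin n) × (β → Fin n)) k}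
    (hx : x ∈ Submodule.span k (Set.range (tensorHom α β k)))
    (h : ∀ g : GL (Fin n) k, (x * tensorHom α β k g).trace = 0) : x = 0 := by
  let I := (α → Fin n) × (β → Fin n)
  let b := Module.Basis.ofVectorSpace ℚ k
  let B : Submodule ℚ (Matrix I I ℚ) := Submodule.span ℚ (Set.range (tensorHom α β ℚ))
  have hx' : x ∈ Submodule.span k
      (Set.range fun y : GL (Fin n) ℚ => (tensorHom α β ℚ y).map (algebraMap ℚ k)) := by
    refine Submodule.span_le.2 ?_ hx
    rintro _ ⟨g, rfl⟩
    exact tensorHom_mem_span α β g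
  -- the coordinates of `x` with respect to a basis of `k` over `ℚ` lie in the rational span
  have hcoord : ∀ (c : k) (s), (c • x).map (b.coord s) ∈ B := by
    clear h hx
    induction hx' using Submodule.span_induction with
    | mem y hy =>
      obtain ⟨y, rfl⟩ := hy
      intro c s
      have e : (c • (tensorHom α β ℚ y).map (algebraMap ℚ k)).map (b.coord s) =
          b.coord s c • tensorHom α β ℚ y := by
        ext i j
        simp only [Matrix.map_apply, Matrix.smul_apply, smul_eq_mul]
        rw [mul_comm c, ← Algebra.smul_def, map_smul, smul_eq_mul, mul_comm]
      rw [e]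
      exact B.smul_mem _ (Submodule.subset_span ⟨y, rfl⟩)
    | zero =>
      intro c s
      have e : (c • (0 : Matrix I I k)).map (b.coord s) = 0 := by ext i j; simp
      rw [e]
      exact B.zero_mem
    | add y z _ _ hy hz =>
      intro c s
      have e : (c • (y + z)).map (b.coord s) =
          (c • y).map (b.coord s) + (c • z).map (b.coord s) := by
        ext i j; simp
      rw [e]
      exact B.add_mem (hy c s) (hz c s)
    | smul a y _ hy =>
      intro c s
      rw [← mul_smul]
      exact hy _ s
  have htr : ∀ s, ∀ z ∈ B, (x.map (b.coord s) * z).trace = 0 := by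
    intro s z hz
    induction hz using Submodule.span_induction with
    | mem y hy =>
      obtain ⟨y, rfl⟩ := hy
      have h1 := congrArg (b.coord s) (h (Matrix.GeneralLinearGroup.map (algebraMap ℚ k) y))
      rw [map_zero] at h1
      rw [← h1]
      have e : tensorHom α β k (Matrix.GeneralLinearGroup.map (algebraMap ℚ k) y) =
          (tensorHom α β ℚ y).map (algebraMap ℚ k) := by
        refine ((tensorMat_map α β (algebraMap ℚ k) _ _).trans ?_).symm
        change _ = tensorMat α β _ ((Matrix.GeneralLinearGroup.map (algebraMap ℚ k) y)⁻¹).1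
        rw [← map_inv]
        rfl
      rw [e]
      simp only [Matrix.trace, Matrix.diag_apply, Matrix.mul_apply, map_sum, Matrix.map_apply]
      refine Finset.sum_congr rfl fun i _ => Finset.sum_congr rfl fun j _ => ?_
      rw [mul_comm (x i j), ← Algebra.smul_def, map_smul, smul_eq_mul, mul_comm]
    | zero => simp
    | add y z _ _ hy hz => rw [mul_add, Matrix.trace_add, hy, hz, add_zero]
    | smul a y _ hy => rw [Matrix.mul_smul, Matrix.trace_smul, hy, smul_zero]
  have htrans : ∀ z ∈ B, z.transpose ∈ B := by
    intro z hz
    induction hz using Submodule.span_induction with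
    | mem y hy =>
      obtain ⟨y, rfl⟩ := hy
      refine Submodule.subset_span ⟨⟨y.1.transpose, (y⁻¹).1.transpose, ?_, ?_⟩, rfl⟩
      · rw [← Matrix.transpose_mul, show (y⁻¹).1 * y.1 = 1 from Units.inv_mul y,
          Matrix.transpose_one]
      · rw [← Matrix.transpose_mul, show y.1 * (y⁻¹).1 = 1 from Units.mul_inv y,
          Matrix.transpose_one]
    | zero => simp
    | add y z _ _ hy hz => rw [Matrix.transpose_add]; exact B.add_mem hy hz
    | smul a y _ hy => rw [Matrix.transpose_smul]; exact B.smul_mem _ hy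
  have hzero : ∀ s, x.map (b.coord s) = 0 := by
    intro s
    have h1 : x.map (b.coord s) ∈ B := by simpa using hcoord 1 s
    have h2 := htr s _ (htrans _ h1)
    rw [← Matrix.conjTranspose_eq_transpose_of_trivial,
      Matrix.trace_mul_conjTranspose_self_eq_zero_iff] at h2
    exact h2
  ext i j
  refine b.ext_elem_iff.2 fun s => ?_
  rw [Matrix.zero_apply, map_zero]
  exact congrFun (congrFun (hzero s) i) j

instance isSemisimpleModule_tensorRep : IsSemisimpleModule (MonoidAlgebra k (GL (Fin n) k))
    (tensorRep (n := n) α β k).asModule := by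
  let T : Matrix ((α → Fin n) × (β → Fin n)) ((α → Fin n) × (β → Fin n)) k ≃ₐ[k] _ :=
    Matrix.toLinAlgEquiv'
  have hT : ∀ g, T (tensorHom α β k g) = tensorRep α β k g := fun _ => rfl
  have hspan : ∀ r, T.symm ((tensorRep α β k).asAlgebraHom r) ∈
      Submodule.span k (Set.range (tensorHom (n := n) α β k)) := by
    intro r
    induction r using MonoidAlgebra.induction_linear with
    | zero => rw [map_zero, map_zero]; exact Submodule.zero_mem _
    | add r s hr hs => rw [map_add, map_add]; exact Submodule.add_mem _ hr hs
    | single g c =>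
      rw [Representation.asAlgebraHom_single, map_smul, ← hT, AlgEquiv.symm_apply_apply]
      exact Submodule.smul_mem _ _ (Submodule.subset_span ⟨g, rfl⟩)
  refine isSemisimpleModule_of_trace _ ?_
  rintro _ ⟨r, rfl⟩ h
  refine (map_eq_zero_iff T.symm T.symm.injective).1
    (eq_zero_of_trace_mul_eq_zero α β (hspan r) fun g => ?_)
  rw [← h _ ⟨MonoidAlgebra.of k _ g, Representation.asAlgebraHom_of _ g⟩, ← hT]
  have e : (tensorRep α β k).asAlgebraHom r * T (tensorHom α β k g) =
      Matrix.toLin' (T.symm ((tensorRep α β k).asAlgebraHom r) * tensorHom α β k g) := by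
    conv_lhs => rw [← T.apply_symm_apply ((tensorRep α β k).asAlgebraHom r), ← map_mul]
    rfl
  refine Eq.trans ?_ (congrArg (LinearMap.trace k _) e.symm)
  exact (Matrix.trace_toLin'_eq _).symm

end Tensor

/-! ### Complete reducibility and local finiteness of forms -/

section AsModule

variable {k G V W : Type*} [Field k] [Group G] [AddCommGroup V] [Module k V] [AddCommGroup W]
  [Module k W] {ρ : Representation k G V} {σ : Representation k G W}

/-- An equivariant linear map, as a map of modules over the group algebra. -/
def asModuleHom (f : V →ₗ[k] W) (h : ∀ g v, f (ρ g v) = σ g (f v)) :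
    ρ.asModule →ₗ[MonoidAlgebra k G] σ.asModule :=
  MonoidAlgebra.equivariantOfLinearOfComm
    (σ.asModuleEquiv.symm.toLinearMap ∘ₗ f ∘ₗ ρ.asModuleEquiv.toLinearMap) fun g v => by
      rw [Representation.single_smul, Representation.single_smul, one_smul, one_smul]
      exact h g v

lemma asModuleHom_apply (f : V →ₗ[k] W) (h : ∀ g v, f (ρ g v) = σ g (f v)) (v : ρ.asModule) :
    asModuleHom f h v = σ.asModuleEquiv.symm (f (ρ.asModuleEquiv v)) := rfl

variable (ρ) in
/-- A representation is locally finite if every vector lies in a finite-dimensional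
subrepresentation. -/
def IsLocallyFinite : Prop := ∀ v : ρ.asModule,
  ∃ N : Submodule (MonoidAlgebra k G) ρ.asModule, v ∈ N ∧ FiniteDimensional k N

lemma IsLocallyFinite.of_injective (hσ : IsLocallyFinite σ)
    (f : ρ.asModule →ₗ[MonoidAlgebra k G] σ.asModule) (hf : Function.Injective f) :
    IsLocallyFinite ρ := by
  intro v
  obtain ⟨N, hv, hN⟩ := hσ (f v)
  refine ⟨N.comap f, hv, ?_⟩
  let l : N.comap f →ₗ[MonoidAlgebra k G] N := f.restrict fun _ h => h
  have hl : Function.Injective l := fun a b h => Subtype.ext (hf (congrArg Subtype.val h))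
  exact Module.Finite.of_injective (l.restrictScalars k) hl

end AsModule

section Tensorial

variable {k : Type*} [Field k] {n : ℕ}

/-- A form is tensorial if it belongs to a finite family on which `GL_n` acts through the matrices
of its action on mixed tensors. -/
def IsTensorial (x : Forms k n) : Prop :=
  ∃ (α β : Type) (_ : Fintype α) (_ : Fintype β) (_ : DecidableEq α) (_ : DecidableEq β)
    (e : (α → Fin n) × (β → Fin n) → Forms k n),
    (∀ g j, actForms g (e j) = ∑ i, tensorHom α β k g i j • e i) ∧ x ∈ Set.range e

lemma IsTensorial.mul {x y : Forms k n} (hx : IsTensorial x) (hy : IsTensorial y) :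
    IsTensorial (x * y) := by
  obtain ⟨α, β, _, _, _, _, e, he, a, rfl⟩ := hx
  obtain ⟨α', β', _, _, _, _, e', he', a', rfl⟩ := hy
  let ε : ((α ⊕ α' → Fin n) × (β ⊕ β' → Fin n)) ≃
      ((α → Fin n) × (β → Fin n)) × ((α' → Fin n) × (β' → Fin n)) :=
    (Equiv.prodCongr (Equiv.sumArrowEquivProdArrow _ _ _)
      (Equiv.sumArrowEquivProdArrow _ _ _)).trans (Equiv.prodProdProdComm _ _ _ _)
  refine ⟨α ⊕ α', β ⊕ β', inferInstance, inferInstance, inferInstance, inferInstance,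
    fun i => e (ε i).1 * e' (ε i).2, fun g j => ?_, ε.symm (a, a'), by simp⟩
  rw [map_mul, he, he', Finset.sum_mul_sum, ← Finset.sum_product', Finset.univ_product_univ]
  refine (Fintype.sum_equiv ε _ _ fun i => ?_).symm
  rw [smul_mul_smul_comm]
  congr 1
  change tensorMat _ _ _ _ _ _ = tensorMat _ _ _ _ _ _ * tensorMat _ _ _ _ _ _
  rw [tensorMat_apply, tensorMat_apply, tensorMat_apply, Fintype.prod_sum_type,
    Fintype.prod_sum_type, mul_mul_mul_comm]
  rfl

lemma isTensorial_of_invariant {x : Forms k n} (hx : ∀ g, actForms g x = x) : IsTensorial x := by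
  refine ⟨Empty, Empty, inferInstance, inferInstance, inferInstance, inferInstance, fun _ => x,
    fun g j => ?_, (Empty.elim, Empty.elim), rfl⟩
  rw [hx, Fintype.sum_subsingleton _ j]
  change x = tensorMat _ _ _ _ _ _ • x
  simp [tensorMat_apply]

lemma isTensorial_of_vector {e : Fin n → Forms k n}
    (he : ∀ (g : GL (Fin n) k) j, actForms g (e j) = ∑ i, g.1 i j • e i) (j : Fin n) :
    IsTensorial (e j) := by
  refine ⟨Unit, Empty, inferInstance, inferInstance, inferInstance, inferInstance,
    fun i => e (i.1 ()), fun g j => ?_, (fun _ => j, Empty.elim), rfl⟩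
  rw [he]
  refine (Fintype.sum_equiv ((Equiv.prodUnique _ _).trans (Equiv.funUnique Unit (Fin n))) _ _
    fun i => ?_).symm
  change tensorMat _ _ _ _ _ _ • _ = _
  rw [tensorMat_apply]
  simp

lemma isTensorial_of_covector {e : Fin n → Forms k n}
    (he : ∀ (g : GL (Fin n) k) j, actForms g (e j) = ∑ i, (g⁻¹).1 j i • e i) (j : Fin n) :
    IsTensorial (e j) := by
  refine ⟨Empty, Unit, inferInstance, inferInstance, inferInstance, inferInstance,
    fun i => e (i.2 ()), fun g j => ?_, (Empty.elim, fun _ => j), rfl⟩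
  rw [he]
  refine (Fintype.sum_equiv ((Equiv.uniqueProd _ _).trans (Equiv.funUnique Unit (Fin n))) _ _
    fun i => ?_).symm
  change tensorMat _ _ _ _ _ _ • _ = _
  rw [tensorMat_apply]
  simp

/-- Tensorial forms span, since they are closed under products and the generators are tensorial. -/
lemma span_isTensorial : Submodule.span k {x : Forms k n | IsTensorial x} = ⊤ := by
  let S : Submonoid (Forms k n) :=
    { carrier := {x | IsTensorial x}
      one_mem' := isTensorial_of_invariant fun g => map_one _
      mul_mem' := IsTensorial.mul }
  have hS : Submodule.span k {x : Forms k n | IsTensorial x} =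
      Subalgebra.toSubmodule (Algebra.adjoin k (S : Set (Forms k n))) := by
    rw [Algebra.adjoin_eq_span, Submonoid.closure_eq]
    rfl
  rw [hS, ← Algebra.top_toSubmodule]
  congr 1
  set B := Algebra.adjoin k (S : Set (Forms k n))
  have hB : ∀ {x}, IsTensorial x → x ∈ B := fun hx => Algebra.subset_adjoin hx
  have hl : ∀ f : Fun k n, f ⊗ₜ 1 ∈ B := by
    have hX : ∀ s, algebraMap (Poly k n) (Fun k n) (MvPolynomial.X s) ⊗ₜ 1 ∈ B := by
      rintro (j | j)
      · refine hB (isTensorial_of_vector (e := fun j => zz k n j ⊗ₜ 1) (fun g j => ?_) j)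
        simp only [actForms, Algebra.TensorProduct.map_tmul, actFun_zz, TensorProduct.sum_tmul,
          map_one, TensorProduct.smul_tmul']
      · refine hB (isTensorial_of_covector (e := fun j => zs k n j ⊗ₜ 1) (fun g j => ?_) j)
        simp only [actForms, Algebra.TensorProduct.map_tmul, actFun_zs, TensorProduct.sum_tmul,
          map_one, TensorProduct.smul_tmul']
    have hinv : invzzs k n ⊗ₜ 1 ∈ B := hB (isTensorial_of_invariant fun g => by
      rw [actForms, Algebra.TensorProduct.map_tmul, actFun_invzzs, map_one])
    let C : Subalgebra k (Fun k n) := B.comap Algebra.TensorProduct.includeLeft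
    have hP : ∀ P : Poly k n, algebraMap (Poly k n) (Fun k n) P ∈ C := by
      intro P
      induction P using MvPolynomial.induction_on with
      | C a =>
        rw [← MvPolynomial.algebraMap_eq, ← IsScalarTower.algebraMap_apply]
        exact C.algebraMap_mem a
      | add p q hp hq => rw [map_add]; exact C.add_mem hp hq
      | mul_X p s hp => rw [map_mul]; exact C.mul_mem hp (hX s)
    intro f
    obtain ⟨N, P, h⟩ := exists_mul_zzs_pow f
    have hf : f = algebraMap (Poly k n) (Fun k n) P * invzzs k n ^ N := by
      rw [← h, mul_assoc]
      exact (mul_one f).symm.trans (congrArg (f * ·) (zzsFun_pow_mul_invzzs_pow N).symm)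
    have hfC : f ∈ C := hf ▸ C.mul_mem (hP P) (C.pow_mem hinv N)
    exact hfC
  have hr : ∀ x : ExteriorAlgebra k (Cov k n), 1 ⊗ₜ x ∈ B := by
    have h1 : ∀ j, 1 ⊗ₜ dz k n j ∈ B := fun j => by
      refine hB (isTensorial_of_vector (e := fun j => 1 ⊗ₜ dz k n j) (fun g j => ?_) j)
      simp only [actForms, Algebra.TensorProduct.map_tmul, map_actCov_dz, TensorProduct.tmul_sum,
        map_one, TensorProduct.tmul_smul]
    have h2 : ∀ j, 1 ⊗ₜ dzs k n j ∈ B := fun j => by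
      refine hB (isTensorial_of_covector (e := fun j => 1 ⊗ₜ dzs k n j) (fun g j => ?_) j)
      simp only [actForms, Algebra.TensorProduct.map_tmul, map_actCov_dzs, TensorProduct.tmul_sum,
        map_one, TensorProduct.tmul_smul]
    let C : Subalgebra k (ExteriorAlgebra k (Cov k n)) :=
      B.comap Algebra.TensorProduct.includeRight
    intro x
    have hx : x ∈ C := by
      induction x using ExteriorAlgebra.induction with
      | algebraMap r => exact C.algebraMap_mem r
      | add x y hx hy => exact C.add_mem hx hy
      | mul x y hx hy => exact C.mul_mem hx hy
      | ι v =>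
        have hv : ExteriorAlgebra.ι k v = ∑ i, v.1 i • dz k n i + ∑ i, v.2 i • dzs k n i := by
          simp only [dz, dzs, ← map_smul, ← map_sum, ← map_add]
          congr 1
          ext b
          · simp [Prod.fst_sum, Finset.sum_apply, Pi.single_apply]
          · simp [Prod.snd_sum, Finset.sum_apply, Pi.single_apply]
        rw [hv]
        exact C.add_mem (C.sum_mem fun i _ => C.smul_mem (h1 i) _)
          (C.sum_mem fun i _ => C.smul_mem (h2 i) _)
    exact hx
  refine eq_top_iff.2 fun w _ => ?_
  induction w using TensorProduct.induction_on with
  | zero => exact B.zero_mem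
  | add a b ha hb => exact B.add_mem (ha trivial) (hb trivial)
  | tmul f x =>
    have e : f ⊗ₜ[k] x = (f ⊗ₜ 1) * (1 ⊗ₜ x) := by simp
    rw [e]
    exact B.mul_mem (hl f) (hr x)

variable (k n) in
/-- The inclusion of `A^{p,q}` into all forms, as a map of modules over the group algebra. -/
def inclForms (p q : ℕ) :
    (rep k n p q).asModule →ₗ[MonoidAlgebra k (GL (Fin n) k)] (formsRep k n).asModule :=
  asModuleHom (A k n p q).subtype fun _ _ => rfl

lemma inclForms_injective (p q : ℕ) : Function.Injective (inclForms k n p q) :=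
  Subtype.val_injective

variable [CharZero k]

lemma IsTensorial.exists_submodule {x : Forms k n} (hx : IsTensorial x) :
    ∃ N : Submodule (MonoidAlgebra k (GL (Fin n) k)) (formsRep k n).asModule,
      (formsRep k n).asModuleEquiv.symm x ∈ N ∧
        IsSemisimpleModule (MonoidAlgebra k (GL (Fin n) k)) N ∧ FiniteDimensional k N := by
  obtain ⟨α, β, _, _, _, _, e, he, a, rfl⟩ := hx
  let f := Fintype.linearCombination k e
  have hf : ∀ (g : GL (Fin n) k) (v : (α → Fin n) × (β → Fin n) → k),
      f (tensorRep α β k g v) = formsRep k n g (f v) := by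
    intro g v
    change f _ = actForms g (f v)
    simp only [f, Fintype.linearCombination_apply, map_sum, map_smul, he, tensorRep_apply,
      Matrix.mulVec, dotProduct, Finset.sum_smul, Finset.smul_sum]
    rw [Finset.sum_comm]
    refine Finset.sum_congr rfl fun i _ => Finset.sum_congr rfl fun j _ => ?_
    rw [← mul_smul, mul_comm]
  let F := asModuleHom (ρ := tensorRep α β k) (σ := formsRep k n) f hf
  refine ⟨LinearMap.range F, ⟨(tensorRep α β k).asModuleEquiv.symm (Pi.single a 1), ?_⟩,
    IsSemisimpleModule.range F, ?_⟩
  · rw [asModuleHom_apply, LinearEquiv.apply_symm_apply]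
    simp [f, Fintype.linearCombination_apply_single]
  · exact Module.Finite.range (F.restrictScalars k)

instance isSemisimpleModule_formsRep :
    IsSemisimpleModule (MonoidAlgebra k (GL (Fin n) k)) (formsRep k n).asModule := by
  choose N hN hss _ using fun x : {x : Forms k n // IsTensorial x} => x.2.exists_submodule
  refine isSemisimpleModule_of_isSemisimpleModule_submodule' hss (eq_top_iff.2 fun v _ => ?_)
  have hle : Submodule.span k {x : Forms k n | IsTensorial x} ≤
      ((⨆ x, N x).restrictScalars k).comap (formsRep k n).asModuleEquiv.symm.toLinearMap :=
    Submodule.span_le.2 fun x hx => Submodule.mem_iSup_of_mem (p := N) ⟨x, hx⟩ (hN ⟨x, hx⟩)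
  rw [span_isTensorial] at hle
  exact hle (Submodule.mem_top (x := (formsRep k n).asModuleEquiv v))

lemma isLocallyFinite_formsRep : IsLocallyFinite (formsRep k n) := by
  intro v
  have hv : (formsRep k n).asModuleEquiv v ∈ Submodule.span k {x : Forms k n | IsTensorial x} := by
    rw [span_isTensorial]; trivial
  suffices h : ∀ x ∈ Submodule.span k {x : Forms k n | IsTensorial x},
      ∃ N : Submodule (MonoidAlgebra k (GL (Fin n) k)) (formsRep k n).asModule,
        (formsRep k n).asModuleEquiv.symm x ∈ N ∧ FiniteDimensional k N by
    simpa using h _ hv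
  intro x hx
  induction hx using Submodule.span_induction with
  | mem x hx =>
    obtain ⟨N, h1, -, h2⟩ := IsTensorial.exists_submodule hx
    exact ⟨N, h1, h2⟩
  | zero => exact ⟨⊥, by simp, inferInstance⟩
  | add x y _ _ hx hy =>
    obtain ⟨N, hxN, hN⟩ := hx
    obtain ⟨M, hyM, hM⟩ := hy
    refine ⟨N ⊔ M, ?_, ?_⟩
    · rw [map_add]
      exact Submodule.add_mem_sup hxN hyM
    · have h1 : FiniteDimensional k (N.restrictScalars k) := hN
      have h2 : FiniteDimensional k (M.restrictScalars k) := hM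
      have h3 : (N ⊔ M).restrictScalars k = N.restrictScalars k ⊔ M.restrictScalars k :=
        Submodule.restrictScalars_sup _ _ _
      have h4 : FiniteDimensional k ((N ⊔ M).restrictScalars k) := by
        rw [h3]; infer_instance
      exact h4
  | smul c x _ hx =>
    obtain ⟨N, hxN, hN⟩ := hx
    exact ⟨N, by rw [map_smul]; exact (N.restrictScalars k).smul_mem c hxN, hN⟩

instance isSemisimpleModule_rep (p q : ℕ) :
    IsSemisimpleModule (MonoidAlgebra k (GL (Fin n) k)) (rep k n p q).asModule :=
  IsSemisimpleModule.of_injective _ (inclForms_injective p q)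

lemma isLocallyFinite_rep (p q : ℕ) : IsLocallyFinite (rep k n p q) :=
  isLocallyFinite_formsRep.of_injective _ (inclForms_injective p q)

end Tensorial

/-! ### Finiteness of multiplicities and invariant functionals -/

section Multiplicity

lemma finiteDimensional_of_le {k R M : Type*} [Field k] [Ring R] [AddCommGroup M] [Module k M]
    [Module R M] [SMul k R] [IsScalarTower k R M] {S N : Submodule R M} (h : S ≤ N)
    (hN : FiniteDimensional k N) : FiniteDimensional k S :=
  Module.Finite.of_injective ((Submodule.inclusion h).restrictScalars k)
    (Submodule.inclusion_injective h)

lemma finiteDimensional_isotypicComponent {k R M S : Type*} [Field k] [Ring R] [Algebra k R]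
    [AddCommGroup M] [Module k M] [Module R M] [IsScalarTower k R M] [AddCommGroup S] [Module k S]
    [Module R S] [IsScalarTower k R S] [FiniteDimensional k S] [FiniteDimensional k (S →ₗ[R] M)] :
    FiniteDimensional k (isotypicComponent R M S) := by
  let b := Module.finBasis k (S →ₗ[R] M)
  let N : Submodule R M := ⨆ i, LinearMap.range (b i)
  have hN : FiniteDimensional k N := by
    have h1 : N.restrictScalars k = ⨆ i, (LinearMap.range (b i)).restrictScalars k :=
      map_iSup (Submodule.restrictScalarsLatticeHom k R M) _
    have h2 : ∀ i, FiniteDimensional k ((LinearMap.range (b i)).restrictScalars k) := fun i =>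
      Module.Finite.range ((b i).restrictScalars k)
    have h3 : FiniteDimensional k (N.restrictScalars k) := by
      rw [h1]; infer_instance
    exact h3
  refine finiteDimensional_of_le (sSup_le ?_) hN
  rintro m ⟨e⟩ x hx
  let h : S →ₗ[R] M := m.subtype ∘ₗ e.symm.toLinearMap
  have hxh : x = h (e ⟨x, hx⟩) := by simp [h]
  rw [hxh, ← b.sum_repr h, LinearMap.sum_apply]
  refine Submodule.sum_mem _ fun i _ => ?_
  exact (N.restrictScalars k).smul_mem _
    (Submodule.mem_iSup_of_mem (p := fun i => LinearMap.range (b i)) i ⟨_, rfl⟩)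

lemma IsLocallyFinite.finiteDimensional_of_isSimpleModule {k G V : Type*} [Field k] [Group G]
    [AddCommGroup V] [Module k V] {ρ : Representation k G V} (hρ : IsLocallyFinite ρ)
    (S : Submodule (MonoidAlgebra k G) ρ.asModule) [IsSimpleModule (MonoidAlgebra k G) S] :
    FiniteDimensional k S := by
  have := IsSimpleModule.nontrivial (MonoidAlgebra k G) S
  obtain ⟨s, hs⟩ := exists_ne (0 : S)
  obtain ⟨N, hsN, hN⟩ := hρ s
  refine finiteDimensional_of_le (N := N) (fun t ht => ?_) hN
  obtain ⟨r, hr⟩ := IsSimpleModule.toSpanSingleton_surjective (MonoidAlgebra k G) hs ⟨t, ht⟩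
  have h : t = r • (s : ρ.asModule) := (congrArg Subtype.val hr).symm
  rw [h]
  exact N.smul_mem r hsN

/-- If a linear map `ev` to a finite-dimensional space vanishes identically on no orbit but that of
`0`, then an equivariant map from a simple module `S` is determined by its composition with `ev`.
These maps thus form a finite-dimensional space, and the multiplicity of `S` is finite. -/
lemma hasFiniteMultiplicities_of_eval {k G V X : Type*} [Field k] [Group G] [AddCommGroup V]
    [Module k V] [AddCommGroup X] [Module k X] [FiniteDimensional k X] {ρ : Representation k G V}
    (hss : IsSemisimpleModule (MonoidAlgebra k G) ρ.asModule) (hρ : IsLocallyFinite ρ)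
    (ev : V →ₗ[k] X) (hev : ∀ v, (∀ g, ev (ρ g v) = 0) → v = 0) : HasFiniteMultiplicities ρ := by
  refine ⟨hss, ?_⟩
  rintro _ ⟨S, hS, rfl⟩
  have hSfin := hρ.finiteDimensional_of_isSimpleModule S
  let ψ : (S →ₗ[MonoidAlgebra k G] ρ.asModule) →ₗ[k] (S →ₗ[k] X) :=
    { toFun := fun h => ev ∘ₗ ρ.asModuleEquiv.toLinearMap ∘ₗ h.restrictScalars k
      map_add' := fun h h' => by ext s; simp
      map_smul' := fun c h => by ext s; simp }
  have hψ : Function.Injective ψ := by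
    refine (injective_iff_map_eq_zero ψ).2 fun h h0 => LinearMap.ext fun s => ?_
    refine hev (ρ.asModuleEquiv (h s)) fun g => ?_
    have h2 := LinearMap.congr_fun h0 (MonoidAlgebra.single g (1 : k) • s)
    change ev (ρ.asModuleEquiv (h (MonoidAlgebra.single g (1 : k) • s))) = 0 at h2
    rwa [map_smul h, Representation.single_smul, one_smul] at h2
  have hfin : FiniteDimensional k (S →ₗ[MonoidAlgebra k G] ρ.asModule) :=
    Module.Finite.of_injective ψ hψ
  exact finiteDimensional_isotypicComponent

/-- On a semisimple representation, an invariant functional is determined by its values on invariant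
vectors: `G` acts trivially on a complement of its kernel. -/
lemma eq_zero_of_forall_invariant {k G V : Type*} [Field k] [Group G] [AddCommGroup V]
    [Module k V] {ρ : Representation k G V}
    (hss : IsSemisimpleModule (MonoidAlgebra k G) ρ.asModule) (D : V →ₗ[k] k)
    (hD : ∀ g v, D (ρ g v) = D v) (h : ∀ v, (∀ g, ρ g v = v) → D v = 0) : D = 0 := by
  let D' : ρ.asModule →ₗ[MonoidAlgebra k G] (Representation.trivial k G k).asModule :=
    asModuleHom D fun g a => hD g a
  obtain ⟨C, hC⟩ := exists_isCompl (LinearMap.ker D')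
  refine LinearMap.ext fun v => ?_
  obtain ⟨x, hx, c, hc, hv⟩ := Submodule.mem_sup.1
    (hC.sup_eq_top ▸ Submodule.mem_top (x := ρ.asModuleEquiv.symm v))
  have hinv : ∀ g, ρ g (ρ.asModuleEquiv c) = ρ.asModuleEquiv c := by
    intro g
    have h1 : MonoidAlgebra.single g (1 : k) • c - c ∈ LinearMap.ker D' ⊓ C := by
      refine ⟨?_, C.sub_mem (C.smul_mem _ hc) hc⟩
      change D (ρ.asModuleEquiv (MonoidAlgebra.single g (1 : k) • c - c)) = 0
      rw [map_sub, map_sub, Representation.single_smul, one_smul]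
      exact sub_eq_zero.2 (hD g _)
    rw [hC.inf_eq_bot, Submodule.mem_bot, sub_eq_zero, Representation.single_smul, one_smul] at h1
    exact h1
  have hx' : D (ρ.asModuleEquiv x) = 0 := LinearMap.mem_ker.1 hx
  have hv' : v = ρ.asModuleEquiv x + ρ.asModuleEquiv c := by
    rw [← map_add, hv, LinearEquiv.apply_symm_apply]
  rw [hv', map_add, hx', h _ hinv, add_zero, LinearMap.zero_apply]

end Multiplicity

/-! ### Evaluation at a base point -/

section Evaluation

variable {k : Type*} [Field k] {n : ℕ}

lemma eval_of_isWeightedHomogeneous {P : Poly k n} {N : ℕ}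
    (hP : MvPolynomial.IsWeightedHomogeneous (wt n) P N) (c : k) (x y : Fin n → k) :
    MvPolynomial.eval (Sum.elim x (c • y)) P = c ^ N * MvPolynomial.eval (Sum.elim x y) P := by
  rw [P.as_sum, map_sum, map_sum, Finset.mul_sum]
  refine Finset.sum_congr rfl fun d hd => ?_
  have hdeg := hP (MvPolynomial.mem_support_iff.1 hd)
  rw [Finsupp.weight_apply, Finsupp.sum_fintype _ _ (by simp)] at hdeg
  rw [MvPolynomial.eval_monomial, MvPolynomial.eval_monomial, Finsupp.prod_fintype _ _ (by simp),
    Finsupp.prod_fintype _ _ (by simp), ← hdeg]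
  simp only [Fintype.prod_sum_type, Fintype.sum_sum_type, Sum.elim_inl, Sum.elim_inr, wt,
    Pi.smul_apply, smul_eq_mul, mul_pow, Finset.prod_mul_distrib, mul_zero, mul_one,
    Finset.sum_const_zero, zero_add, Finset.prod_pow_eq_pow_sum]
  ring

variable [NeZero n]

variable (k n) in
/-- Evaluation of functions on `U` at the base point `z = z* = (1, 0, …, 0)`. -/
def evalBase : Fun k n →ₐ[k] k :=
  IsLocalization.liftAlgHom (M := Submonoid.powers (zzs k n))
    (f := MvPolynomial.aeval (Sum.elim (Pi.single 0 1) (Pi.single 0 1))) (by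
      rintro ⟨_, m, rfl⟩
      have h : MvPolynomial.aeval (Sum.elim (Pi.single 0 1) (Pi.single 0 1) : Fin n ⊕ Fin n → k)
          (zzs k n) = 1 := by
        simp [zzs, Pi.single_apply]
      change IsUnit (MvPolynomial.aeval _ (zzs k n ^ m))
      rw [map_pow, h, one_pow]
      exact isUnit_one)

lemma evalBase_algebraMap (P : Poly k n) : evalBase k n (algebraMap (Poly k n) (Fun k n) P) =
    MvPolynomial.eval (Sum.elim (Pi.single 0 1) (Pi.single 0 1)) P := by
  rw [evalBase, IsLocalization.liftAlgHom_apply, IsLocalization.lift_eq]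
  rfl

lemma evalBase_actFun (g : GL (Fin n) k) (P : Poly k n) :
    evalBase k n (actFun g (algebraMap (Poly k n) (Fun k n) P)) =
      MvPolynomial.eval (Sum.elim (fun j => g.1 0 j) fun j => (g⁻¹).1 j 0) P := by
  rw [actFun_algebraMap, evalBase_algebraMap]
  induction P using MvPolynomial.induction_on with
  | C a => simp [actPoly, MvPolynomial.algebraMap_eq]
  | add p q hp hq => simp only [map_add, hp, hq]
  | mul_X p s hp =>
    rw [map_mul, map_mul, map_mul, hp]
    congr 1
    rcases s with j | j
    · rw [actPoly_X_inl]
      simp [Pi.single_apply, MvPolynomial.smul_eval]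
    · rw [actPoly_X_inr]
      simp [Pi.single_apply, MvPolynomial.smul_eval]

/-- `GL_n` moves the base point to all points with `zz* = 1` and nonzero first coordinate `z_1`. -/
lemma exists_GL_row_col {x y : Fin n → k} (hx : x 0 ≠ 0) (hxy : ∑ i, x i * y i = 1) :
    ∃ g : GL (Fin n) k, (fun j => g.1 0 j) = x ∧ (fun j => (g⁻¹).1 j 0) = y := by
  -- The first row of `g` is `x`, the others are rows of the projection `1 - y x` with kernel
  -- spanned by `y`; the first column of the inverse `h` is `y`, and `x` annihilates the others.
  let g : Matrix (Fin n) (Fin n) k := Matrix.of fun i j =>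
    if i = 0 then x j else (if i = j then 1 else 0) - y i * x j
  let h : Matrix (Fin n) (Fin n) k := Matrix.of fun i j =>
    if j = 0 then y i else (if i = j then 1 else 0) - if i = 0 then x j / x 0 else 0
  have hrow : ∀ j, ∑ l, x l * h l j = if j = 0 then 1 else 0 := by
    intro j
    by_cases hj : j = 0
    · simp [h, hj, hxy]
    · simp [h, hj, mul_sub, Finset.sum_sub_distrib, mul_div_cancel₀ _ hx]
  have hgh : g * h = 1 := by
    ext i j
    rw [Matrix.mul_apply, Matrix.one_apply]
    by_cases hi : i = 0
    · simp only [g, Matrix.of_apply, hi, if_true, hrow, eq_comm]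
    · have e : ∀ l, g i l * h l j = (if i = l then h l j else 0) - y i * (x l * h l j) := by
        intro l
        simp only [g, Matrix.of_apply, hi, if_false]
        split_ifs <;> ring
      rw [Finset.sum_congr rfl fun l _ => e l, Finset.sum_sub_distrib, ← Finset.mul_sum, hrow]
      by_cases hj : j = 0
      · simp [h, hj, hi]
      · simp [h, hj, hi]
  refine ⟨⟨g, h, hgh, mul_eq_one_comm.1 hgh⟩, ?_, ?_⟩
  · funext j
    simp [g]
  · funext j
    change h j 0 = y j
    simp [h]

variable [CharZero k]

/-- A function of pure degree in the `z*` which vanishes on the orbit of the base point is zero. -/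
lemma eq_zero_of_evalBase_actFun {q : ℕ} {f : Fun k n} (hf : f ∈ homFun k n q)
    (h : ∀ g, evalBase k n (actFun g f) = 0) : f = 0 := by
  obtain ⟨N, P, hP, hfP⟩ := hf
  have h1 : ∀ x y : Fin n → k, x 0 ≠ 0 → ∑ i, x i * y i = 1 →
      MvPolynomial.eval (Sum.elim x y) P = 0 := by
    intro x y hx hxy
    obtain ⟨g, rfl, rfl⟩ := exists_GL_row_col hx hxy
    rw [← evalBase_actFun, ← hfP, map_mul, map_mul, h, zero_mul]
  -- by rescaling the `z*`, the polynomial `P` vanishes wherever `zz*` and `z_1` do not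
  have h2 : P * (zzs k n * MvPolynomial.X (Sum.inl 0)) = 0 := by
    refine MvPolynomial.funext fun v => ?_
    obtain ⟨x, y, rfl⟩ : ∃ x y : Fin n → k, v = Sum.elim x y :=
      ⟨v ∘ Sum.inl, v ∘ Sum.inr, (Sum.elim_comp_inl_inr v).symm⟩
    rw [map_mul, map_mul, map_zero, MvPolynomial.eval_X, Sum.elim_inl]
    have hz : MvPolynomial.eval (Sum.elim x y) (zzs k n) = ∑ i, x i * y i := by simp [zzs]
    rw [hz]
    by_cases hx : x 0 = 0
    · rw [hx, mul_zero, mul_zero]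
    by_cases hc : ∑ i, x i * y i = 0
    · rw [hc, zero_mul, mul_zero]
    set c := ∑ i, x i * y i
    have hy : y = c • (c⁻¹ • y) := by rw [smul_smul, mul_inv_cancel₀ hc, one_smul]
    rw [hy, eval_of_isWeightedHomogeneous hP, h1 x (c⁻¹ • y) hx, mul_zero, zero_mul]
    simp only [Pi.smul_apply, smul_eq_mul, mul_left_comm (x _)]
    rw [← Finset.mul_sum]
    exact inv_mul_cancel₀ hc
  have hP0 : P = 0 := (mul_eq_zero.1 h2).resolve_right
    (mul_ne_zero zzs_ne_zero (MvPolynomial.X_ne_zero _))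
  rw [hP0, map_zero] at hfP
  refine (mul_eq_zero.1 hfP).resolve_right (pow_ne_zero _ ?_)
  rw [Ne, ← map_zero (algebraMap (Poly k n) (Fun k n)), algebraMap_injective.eq_iff]
  exact zzs_ne_zero

/-- The value at the base point of a form on `U`. -/
abbrev evalForms : Forms k n →ₗ[k] ExteriorAlgebra k (Cov k n) :=
  coeffMap (evalBase k n).toLinearMap

/-- A form of pure bidegree which vanishes on the orbit of the base point is zero. -/
lemma eq_zero_of_evalForms_actForms {p q : ℕ} {w : Forms k n} (hw : w ∈ homForms k n p q)
    (h : ∀ g, evalForms (actForms g w) = 0) : w = 0 := by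
  have h1 : ∀ (g : GL (Fin n) k) (v : Forms k n), evalForms (actForms g v) =
      ExteriorAlgebra.map (actCov g)
        (coeffMap ((evalBase k n).toLinearMap ∘ₗ (actFun g).toLinearMap) v) := by
    intro g v
    induction v using TensorProduct.induction_on with
    | zero => simp
    | add a b ha hb => simp only [map_add, ha, hb]
    | tmul f x =>
      rw [actForms, Algebra.TensorProduct.map_tmul, evalForms, coeffMap_tmul, coeffMap_tmul,
        map_smul]
      rfl
  have h2 : ∀ g : GL (Fin n) k,
      coeffMap ((evalBase k n).toLinearMap ∘ₗ (actFun g).toLinearMap) w = 0 := by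
    intro g
    have h3 := congrArg (ExteriorAlgebra.map (actCov g⁻¹)) ((h1 g w).symm.trans (h g))
    rw [map_zero, ← AlgHom.comp_apply, ExteriorAlgebra.map_comp_map, ← actCov_mul, inv_mul_cancel,
      actCov_one, ExteriorAlgebra.map_id] at h3
    exact h3
  let c (φ : Module.Dual k (ExteriorAlgebra k (Cov k n))) : Forms k n →ₗ[k] Fun k n :=
    (TensorProduct.rid k (Fun k n)).toLinearMap ∘ₗ TensorProduct.map LinearMap.id φ
  have hc : ∀ φ (d : Fun k n →ₗ[k] k) (v : Forms k n), d (c φ v) = φ (coeffMap d v) := by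
    intro φ d v
    induction v using TensorProduct.induction_on with
    | zero => simp
    | add a b ha hb => simp only [map_add, ha, hb]
    | tmul f x => simp [c, coeffMap_tmul, mul_comm]
  have hcw : ∀ φ, c φ w = 0 := by
    intro φ
    have hle : homForms k n p q ≤ (homFun k n q).comap (c φ) := by
      refine Submodule.map₂_le.2 fun f hf x _ => Submodule.mem_comap.2 ?_
      have e : c φ (f ⊗ₜ x) = φ x • f := by simp [c]
      rw [TensorProduct.mk_apply, e]
      exact Submodule.smul_mem _ _ hf
    refine eq_zero_of_evalBase_actFun (hle hw) fun g => ?_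
    have h3 := hc φ ((evalBase k n).toLinearMap ∘ₗ (actFun g).toLinearMap) w
    rwa [h2, map_zero] at h3
  by_contra hne
  obtain ⟨d, hd⟩ := exists_coeffMap_ne_zero hne
  refine hd ((Module.forall_dual_apply_eq_zero_iff k _).1 fun φ => ?_)
  rw [← hc, hcw, map_zero]

instance : FiniteDimensional k (ExteriorAlgebra k (Cov k n)) :=
  Module.Finite.of_basis (covBasis k n).ExteriorAlgebra

/-- A form is determined by its values on the orbit of the base point, and these by the values of
its translates at the base point. -/
lemma hasFiniteMultiplicities_rep (p q : ℕ) : HasFiniteMultiplicities (rep k n p q) :=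
  hasFiniteMultiplicities_of_eval inferInstance (isLocallyFinite_rep p q)
    (evalForms ∘ₗ (A k n p q).subtype) fun v hv =>
      Subtype.ext (eq_zero_of_evalForms_actForms v.2.1 hv)

/-- An invariant functional on `A^{n,n-1}` vanishes if it vanishes at `Ω dz_1 ∧ ⋯ ∧ dz_n`: the
invariant functions are constant on the orbit of the base point, so that the invariant elements of
`A^{n,n-1}` are the multiples of this form. -/
lemma eq_zero_of_invariant (D : A k n n (n - 1) →ₗ[k] k)
    (hD : ∀ g a, D (rep k n n (n - 1) g a) = D a) (h0 : D (martinelliBochnerTop k n) = 0) :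
    D = 0 := by
  have hn : 1 ≤ n := NeZero.one_le
  refine eq_zero_of_forall_invariant inferInstance D hD fun a ha => ?_
  set f := density k n (a : Forms k n)
  have hf : ∀ g, actFun g f = f := fun g => by
    rw [← density_actForms]
    exact congrArg (fun b : A k n n (n - 1) => density k n (b : Forms k n)) (ha g)
  have hf1 : f - evalBase k n f • (1 : Fun k n) = 0 := by
    refine eq_zero_of_evalBase_actFun (q := 0) (Submodule.sub_mem _ (density_mem hn a.2)
      (Submodule.smul_mem _ _ one_mem_homFun)) fun g => ?_
    rw [map_sub, hf, map_smul, map_one, map_sub, map_smul, map_one]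
    simp
  have h2 : density k n ((a : Forms k n) -
      evalBase k n f • (martinelliBochner k n * dzTop k n)) = 0 := by
    rw [map_sub, map_smul, density_martinelliBochner_mul]
    exact hf1
  have h3 := eq_zero_of_density_eq_zero hn (Submodule.sub_mem _ a.2
    (Submodule.smul_mem _ (evalBase k n f) (martinelliBochnerTop k n).2)) h2
  have h4 : a = evalBase k n f • martinelliBochnerTop k n := Subtype.ext (sub_eq_zero.1 h3)
  rw [h4, map_smul, h0, smul_zero]

lemma IsResidue.unique {R R' : A k n n (n - 1) →ₗ[k] k} (hR : IsResidue k n R)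
    (hR' : IsResidue k n R') : R = R' := by
  refine sub_eq_zero.1 (eq_zero_of_invariant (R - R') (fun g a => ?_) ?_)
  · rw [LinearMap.sub_apply, LinearMap.sub_apply, hR.1, hR'.1]
  · rw [LinearMap.sub_apply, hR.2, hR'.2, sub_self]

lemma residue_eq : residue k n = resMap k n :=
  (Classical.epsilon_spec (p := IsResidue k n) ⟨_, isResidue_resMap⟩).unique isResidue_resMap

end Evaluation

/-! ### Invariant pairings and restricted duals -/

section Perp

variable {k G M N : Type*} [Field k] [Group G]
  [AddCommGroup M] [Module k M] [Module (MonoidAlgebra k G) M]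
  [AddCommGroup N] [Module k N] [Module (MonoidAlgebra k G) N]

/-- Invariance of a pairing between two modules over the group algebra. -/
def IsInvariantPairing (B : M →ₗ[k] N →ₗ[k] k) : Prop :=
  ∀ (g : G) (x : M) (y : N),
    B (MonoidAlgebra.single g (1 : k) • x) (MonoidAlgebra.single g (1 : k) • y) = B x y

lemma IsInvariantPairing.flip {B : M →ₗ[k] N →ₗ[k] k} (hB : IsInvariantPairing (G := G) B) :
    IsInvariantPairing (G := G) B.flip := fun g y x => hB g x y

variable [IsScalarTower k (MonoidAlgebra k G) N]

/-- The orthogonal complement in `N` of a submodule of `M`, for an invariant pairing. -/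
def perp (B : M →ₗ[k] N →ₗ[k] k) (hB : IsInvariantPairing (G := G) B)
    (S : Submodule (MonoidAlgebra k G) M) : Submodule (MonoidAlgebra k G) N :=
  MonoidAlgebra.submoduleOfSMulMem
    { carrier := {y | ∀ x ∈ S, B x y = 0}
      zero_mem' := fun x _ => map_zero _
      add_mem' := fun {y y'} hy hy' x hx => by rw [map_add, hy x hx, hy' x hx, add_zero]
      smul_mem' := fun c y hy x hx => by rw [map_smul, hy x hx, smul_zero] }
    fun g y hy x hx => by
      have hg : (MonoidAlgebra.single g (1 : k)) • (MonoidAlgebra.single g⁻¹ (1 : k) • x) = x := by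
        rw [smul_smul, MonoidAlgebra.single_mul_single, mul_inv_cancel, one_mul,
          ← MonoidAlgebra.one_def, one_smul]
      rw [← hg, MonoidAlgebra.of_apply, hB g]
      exact hy _ (S.smul_mem _ hx)

/-- A fully invariant submodule is preserved by the projection onto `K'` along `K`, so that it lies
in `K` once it meets `K'` trivially. -/
lemma le_of_isCompl_of_isFullyInvariant {R M : Type*} [Ring R] [AddCommGroup M] [Module R M]
    {c K K' : Submodule R M} (hc : c.IsFullyInvariant) (hK : IsCompl K K') (h : c ⊓ K' = ⊥) :
    c ≤ K := by
  intro x hx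
  have h1 : Submodule.projection _ _ hK.symm x ∈ c ⊓ K' :=
    ⟨hc (Submodule.projection _ _ hK.symm) hx, Submodule.projection_apply_mem _ _⟩
  rw [h, Submodule.mem_bot] at h1
  rwa [Submodule.projection_apply_eq_zero_iff] at h1

variable [IsScalarTower k (MonoidAlgebra k G) M]

/-- A functional that belongs to a finite-dimensional subrepresentation vanishes on all but finitely
many isotypic components. -/
lemma finite_isotypicComponents_not_le_perp [IsSemisimpleModule (MonoidAlgebra k G) M]
    (B : M →ₗ[k] N →ₗ[k] k) (hB : IsInvariantPairing (G := G) B)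
    (W : Submodule (MonoidAlgebra k G) N) [FiniteDimensional k W] :
    {c : isotypicComponents (MonoidAlgebra k G) M | ¬ c.1 ≤ perp B.flip hB.flip W}.Finite := by
  obtain ⟨K', hK⟩ := exists_isCompl (perp B.flip hB.flip W)
  have hfin : FiniteDimensional k K' := by
    let r : K' →ₗ[k] Module.Dual k W :=
      { toFun := fun x => (B x.1) ∘ₗ W.subtype.restrictScalars k
        map_add' := fun x y => by ext; simp
        map_smul' := fun a x => by ext; simp }
    refine Module.Finite.of_injective r ((injective_iff_map_eq_zero r).2 fun x hx => ?_)
    have h1 : x.1 ∈ perp B.flip hB.flip W ⊓ K' :=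
      ⟨fun y hy => LinearMap.congr_fun hx ⟨y, hy⟩, x.2⟩
    rw [hK.inf_eq_bot] at h1
    exact Subtype.ext h1
  have : IsNoetherian (MonoidAlgebra k G) K' := isNoetherian_of_tower k inferInstance
  let t : isotypicComponents (MonoidAlgebra k G) M → Submodule (MonoidAlgebra k G) K' :=
    fun c => c.1.comap K'.subtype
  have ht : iSupIndep t := by
    intro c
    refine Submodule.disjoint_def.2 fun x hx hx' => ?_
    have h1 := ((sSupIndep_iff _).1 (sSupIndep_isotypicComponents (MonoidAlgebra k G) M)) c
    refine Subtype.ext (Submodule.disjoint_def.1 h1 x.1 hx ?_)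
    have h2 : (⨆ c' ≠ c, t c').map K'.subtype ≤ ⨆ c' ≠ c, c'.1 := by
      simp only [Submodule.map_iSup]
      exact iSup₂_mono fun c' _ => Submodule.map_comap_le _ _
    exact h2 (Submodule.mem_map_of_mem hx')
  refine (Submodule.finite_ne_bot_of_iSupIndep ht).subset fun c hc h0 => hc ?_
  refine le_of_isCompl_of_isFullyInvariant (.of_mem_isotypicComponents c.2) hK ?_
  refine eq_bot_iff.2 fun x hx => ?_
  have h1 : (⟨x, hx.2⟩ : K') ∈ t c := hx.1
  rw [h0] at h1
  exact congrArg Subtype.val h1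

/-- For a nondegenerate invariant pairing, each functional on a finite-dimensional isotypic
component, extended by zero to the other components, is given by the pairing. -/
lemma exists_eq_on_isotypicComponent [IsSemisimpleModule (MonoidAlgebra k G) N]
    (B : M →ₗ[k] N →ₗ[k] k) (hB : IsInvariantPairing (G := G) B)
    (hl : ∀ x, (∀ y, B x y = 0) → x = 0) (c : isotypicComponents (MonoidAlgebra k G) M)
    [FiniteDimensional k c.1] (l : Module.Dual k c.1) :
    ∃ y, (∀ x : c.1, B x y = l x) ∧
      ∀ c' : isotypicComponents (MonoidAlgebra k G) M, c' ≠ c → ∀ x ∈ c'.1, B x y = 0 := by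
  obtain ⟨C, hC⟩ := exists_isCompl (perp B hB c.1)
  let φ : C →ₗ[k] Module.Dual k c.1 :=
    { toFun := fun y => (B.flip y.1) ∘ₗ c.1.subtype.restrictScalars k
      map_add' := fun x y => by ext; simp
      map_smul' := fun a x => by ext; simp }
  let ψ : c.1 →ₗ[k] Module.Dual k C :=
    { toFun := fun x => (B x.1) ∘ₗ C.subtype.restrictScalars k
      map_add' := fun x y => by ext; simp
      map_smul' := fun a x => by ext; simp }
  have hφ : Function.Injective φ := (injective_iff_map_eq_zero φ).2 fun y hy => by
    have h1 : y.1 ∈ perp B hB c.1 ⊓ C := ⟨fun x hx => LinearMap.congr_fun hy ⟨x, hx⟩, y.2⟩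
    rw [hC.inf_eq_bot] at h1
    exact Subtype.ext h1
  have hker : ∀ x ∈ c.1, (∀ y ∈ C, B x y = 0) → x = 0 := fun x hx h => hl x fun y => by
    obtain ⟨u, hu, v, hv, rfl⟩ := Submodule.mem_sup.1 (hC.sup_eq_top ▸ Submodule.mem_top (x := y))
    rw [map_add, hu x hx, h v hv, add_zero]
  have hψ : Function.Injective ψ := (injective_iff_map_eq_zero ψ).2 fun x hx =>
    Subtype.ext (hker x.1 x.2 fun y hy => LinearMap.congr_fun hx ⟨y, hy⟩)
  -- The pairing of the component with `C` is nondegenerate on both sides, hence perfect.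
  have hCfin : FiniteDimensional k C := Module.Finite.of_injective φ hφ
  have h1 := LinearMap.finrank_le_finrank_of_injective hφ
  have h2 := LinearMap.finrank_le_finrank_of_injective hψ
  rw [Subspace.dual_finrank_eq] at h1 h2
  have hφs : Function.Surjective φ := (LinearMap.injective_iff_surjective_of_finrank_eq_finrank
    (by rw [Subspace.dual_finrank_eq]; exact le_antisymm h1 h2)).1 hφ
  have hψs : Function.Surjective ψ := (LinearMap.injective_iff_surjective_of_finrank_eq_finrank
    (by rw [Subspace.dual_finrank_eq]; exact le_antisymm h2 h1)).1 hψ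
  have hK : IsCompl (perp B.flip hB.flip C) c.1 := by
    refine IsCompl.of_eq (eq_bot_iff.2 fun x hx => hker x hx.2 hx.1) (eq_top_iff.2 fun x _ => ?_)
    obtain ⟨x', hx'⟩ := hψs ((B x) ∘ₗ C.subtype.restrictScalars k)
    refine Submodule.mem_sup.2 ⟨x - x'.1, fun y hy => ?_, x'.1, x'.2, sub_add_cancel _ _⟩
    have h3 : B x'.1 y = B x y := LinearMap.congr_fun hx' ⟨y, hy⟩
    rw [LinearMap.flip_apply, map_sub, LinearMap.sub_apply, h3, sub_self]
  obtain ⟨y, hy⟩ := hφs l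
  refine ⟨y.1, fun x => LinearMap.congr_fun hy x, fun c' hc' x hx => ?_⟩
  refine le_of_isCompl_of_isFullyInvariant (.of_mem_isotypicComponents c'.2) hK ?_ hx y.1 y.2
  exact ((sSupIndep_isotypicComponents (MonoidAlgebra k G) M).pairwiseDisjoint c'.2 c.2
    (fun h => hc' (Subtype.ext h))).eq_bot

end Perp

section RestrictedDual

variable {k G E F : Type*} [Field k] [Group G] [AddCommGroup E] [Module k E] [AddCommGroup F]
  [Module k F] {ρ : Representation k G E} {σ : Representation k G F}

/-- A nondegenerate invariant pairing of a representation with finite multiplicities with a locally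
finite semisimple representation identifies the latter with the restricted dual of the former. -/
lemma inducesIsoOntoRestrictedDual_of_nondegenerate (hρ : HasFiniteMultiplicities ρ)
    (hσ : IsSemisimpleModule (MonoidAlgebra k G) σ.asModule) (hσ' : IsLocallyFinite σ)
    (B : E →ₗ[k] F →ₗ[k] k) (hB : ∀ g a b, B (ρ g a) (σ g b) = B a b)
    (hl : ∀ a, (∀ b, B a b = 0) → a = 0) (hr : ∀ b, (∀ a, B a b = 0) → b = 0) :
    InducesIsoOntoRestrictedDual ρ B := by
  obtain ⟨hss, hfin⟩ := hρ
  let B' : ρ.asModule →ₗ[k] σ.asModule →ₗ[k] k :=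
    B.compl₁₂ ρ.asModuleEquiv.toLinearMap σ.asModuleEquiv.toLinearMap
  have hB' : IsInvariantPairing (G := G) B' := fun g x y => by
    have h : ∀ x y, B' x y = B (ρ.asModuleEquiv x) (σ.asModuleEquiv y) := fun _ _ => rfl
    rw [h, h, Representation.single_smul, Representation.single_smul, one_smul, one_smul]
    exact hB g _ _
  let r (c : Isotypic ρ) (b : F) : Module.Dual k c.1 :=
    B'.flip (σ.asModuleEquiv.symm b) ∘ₗ c.1.subtype.restrictScalars k
  have hfs : ∀ b, {c | r c b ≠ 0}.Finite := fun b => by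
    obtain ⟨W, hbW, hW⟩ := hσ' (σ.asModuleEquiv.symm b)
    refine (finite_isotypicComponents_not_le_perp B' hB' W).subset fun c hc hle => hc ?_
    exact LinearMap.ext fun x => hle x.2 _ hbW
  have hex : ∀ b, ∃ d : RestrictedDual ρ, ∀ c, d c = r c b := fun b => by
    classical
    refine ⟨DirectSum.mk (fun c : Isotypic ρ => Module.Dual k c.1) (hfs b).toFinset
      fun c => r c.1 b, fun c => ?_⟩
    by_cases hc : c ∈ (hfs b).toFinset
    · rw [DirectSum.mk_apply_of_mem hc]
    · rw [DirectSum.mk_apply_of_notMem hc]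
      simpa [eq_comm] using hc
  choose d hd using hex
  have hadd : ∀ c b b', r c (b + b') = r c b + r c b' := fun c b b' => by
    ext x; simp [r]
  have hsmul : ∀ c (a : k) b, r c (a • b) = a • r c b := fun c a b => by
    ext x; simp [r]
  let Φ : F →ₗ[k] RestrictedDual ρ :=
    { toFun := d
      map_add' := fun b b' => DFinsupp.ext fun c => by
        rw [DirectSum.add_apply, hd, hd, hd, hadd]
      map_smul' := fun a b => DFinsupp.ext fun c => by
        rw [RingHom.id_apply, DirectSum.smul_apply, hd, hd, hsmul] }
  refine ⟨LinearEquiv.ofBijective Φ ⟨(injective_iff_map_eq_zero Φ).2 fun b hb => ?_, ?_⟩,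
    fun b c x => LinearMap.congr_fun (hd b c) x⟩
  · have hle : sSup (isotypicComponents (MonoidAlgebra k G) ρ.asModule) ≤
        perp B'.flip hB'.flip (Submodule.span (MonoidAlgebra k G) {σ.asModuleEquiv.symm b}) := by
      refine sSup_le fun c hc x hx w hw => ?_
      have hb' : σ.asModuleEquiv.symm b ∈ perp B' hB' c := fun x hx => by
        have h1 := hd b ⟨c, hc⟩
        have h2 : d b = 0 := hb
        rw [h2, DirectSum.zero_apply] at h1
        exact (LinearMap.congr_fun h1 ⟨x, hx⟩).symm
      exact (Submodule.span_singleton_le_iff_mem _ _).2 hb' hw x hx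
    rw [sSup_isotypicComponents] at hle
    exact hr b fun a => hle (Submodule.mem_top (x := ρ.asModuleEquiv.symm a)) _
      (Submodule.mem_span_singleton_self _)
  · rw [← LinearMap.range_eq_top, eq_top_iff]
    rintro f -
    classical
    induction f using DirectSum.induction_on with
    | zero => exact Submodule.zero_mem _
    | add f g hf hg => exact Submodule.add_mem _ hf hg
    | of c l =>
      have := hfin c c.2
      obtain ⟨y, hy, hy'⟩ := exists_eq_on_isotypicComponent B' hB' (fun x hx => hl x hx) c l
      refine ⟨σ.asModuleEquiv y, DFinsupp.ext fun c' => (hd _ _).trans ?_⟩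
      by_cases h : c' = c
      · subst h
        exact (LinearMap.ext hy).trans
          (DirectSum.of_eq_same (β := fun c : Isotypic ρ => Module.Dual k c.1) c' l).symm
      · refine Eq.trans ?_
          (DirectSum.of_eq_of_ne (β := fun c : Isotypic ρ => Module.Dual k c.1) c c' l h).symm
        exact LinearMap.ext fun x => hy' c' h x x.2

end RestrictedDual

/-! ### The residue duality -/

lemma residuePairing_rep {k : Type*} [Field k] [CharZero k] {n : ℕ} [NeZero n] {p q : ℕ}
    (hp : p ≤ n) (hq : q ≤ n - 1) (g : GL (Fin n) k) (a : A k n p q)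
    (b : A k n (n - p) (n - 1 - q)) :
    residuePairing hp hq (rep k n p q g a) (rep k n (n - p) (n - 1 - q) g b) =
      residuePairing hp hq a b := by
  have h : mulTop hp hq (rep k n p q g a) (rep k n (n - p) (n - 1 - q) g b) =
      rep k n n (n - 1) g (mulTop hp hq a b) :=
    Subtype.ext (map_mul (actForms g) (a : Forms k n) (b : Forms k n)).symm
  change residue k n (mulTop hp hq _ _) = residue k n (mulTop hp hq a b)
  rw [h, residue_eq, isResidue_resMap.1]

end Jouanolou

end

theorem mainTheorem12 (k : Type*) [Field k] [CharZero k] (n : ℕ) (hn : 1 ≤ n) :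
    -- the residue map is well defined: it is the unique functional with its defining properties
    (Jouanolou.IsResidue k n (Jouanolou.residue k n) ∧
      ∀ R : Jouanolou.A k n n (n - 1) →ₗ[k] k, Jouanolou.IsResidue k n R →
        R = Jouanolou.residue k n) ∧
    ∀ (p q : ℕ) (hp : p ≤ n) (hq : q ≤ n - 1),
      -- the restricted dual is defined
      Jouanolou.HasFiniteMultiplicities (Jouanolou.rep k n p q) ∧
      -- the residue pairing is invariant under the general linear group
      (∀ (g : GL (Fin n) k) (a : Jouanolou.A k n p q)
          (b : Jouanolou.A k n (n - p) (n - 1 - q)),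
        Jouanolou.residuePairing hp hq (Jouanolou.rep k n p q g a)
            (Jouanolou.rep k n (n - p) (n - 1 - q) g b) =
          Jouanolou.residuePairing hp hq a b) ∧
      -- the residue pairing induces an isomorphism onto the restricted dual
      Jouanolou.InducesIsoOntoRestrictedDual (Jouanolou.rep k n p q)
        (Jouanolou.residuePairing hp hq) := by
  have : NeZero n := ⟨by omega⟩
  have hres : Jouanolou.IsResidue k n (Jouanolou.residue k n) :=
    Jouanolou.residue_eq (k := k) (n := n) ▸ Jouanolou.isResidue_resMap
  refine ⟨⟨hres, fun R hR => hR.unique hres⟩, fun p q hp hq =>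
    ⟨Jouanolou.hasFiniteMultiplicities_rep p q, Jouanolou.residuePairing_rep hp hq, ?_⟩⟩
  refine Jouanolou.inducesIsoOntoRestrictedDual_of_nondegenerate
    (Jouanolou.hasFiniteMultiplicities_rep p q)
    (Jouanolou.isSemisimpleModule_rep _ _) (Jouanolou.isLocallyFinite_rep _ _) _
    (Jouanolou.residuePairing_rep hp hq) (fun a ha => ?_) fun b hb => ?_
  · by_contra h
    obtain ⟨b, hb⟩ := Jouanolou.exists_resMap_mulTop_ne_zero_left hp hq h
    exact hb (Jouanolou.residue_eq (k := k) (n := n) ▸ ha b)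
  · by_contra h
    obtain ⟨a, ha⟩ := Jouanolou.exists_resMap_mulTop_ne_zero_right hp hq h
    exact ha (Jouanolou.residue_eq (k := k) (n := n) ▸ hb a)
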